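/- **Setting.** Let $R$ be a finite reduced root system spanning a real vector space $V_0$, with simple roots $\Pi$ (a basis of $V_0$), coroots $\alpha^\vee$, Weyl group $W$ generated by the simple reflections $s_\alpha(v)=v-\langle v,\alpha^\vee\rangle\alpha$, length function $l$, and let $V=\mathbb C\otimes_{\mathbb R} V_0$, $V^\vee=\operatorname{Hom}_{\mathbb C}(V,\mathbb C)$. Let $k:\Pi\to\mathbb C$ be such that $k_\alpha=k_\beta$ whenever $\alpha,\beta\in\Pi$ are $W$-conjugate. The graded Hecke algebra $\mathbb H$ is the unital associative $\mathbb C$-algebra generated by $\mathbb C[W]$ (with basis $t_w$) and the symmetric algebra $S(V)$, subject to $t_{s_\alpha}v-s_\alpha(v)t_{s_\alpha}=k_\alpha\langle v,\alpha^\vee\rangle$ for $\alpha\in\Pi$, $v\in V$. For $J\subset\Pi$ let $V_J=\operatorname{span}_{\mathbb C}J$, $R_J=R\cap V_J$, $W_J=\langle s_\alpha:\alpha\in J\rangle$, let $w_{0,J}$ be the longest element of $W_J$ (so $w_0=w_{0,\Pi}$), $W^J$ the set of minimal length representatives of $W/W_J$, $w^J$ the longest element of $W^J$, and let $\mathbb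 H_J\subset\mathbb H$ be the subalgebra generated by $V$ and the $t_w$, $w\in W_J$. For an $\mathbb H_J$-module $U$ put $I(J,U)=\mathbb H\otimes_{\mathbb H_J}U$. A functional $\gamma^\vee\in V^\vee$ is a weight of $U$ if there is $0\ne u\in U$ such that for every $v\in V$ some positive power of $v-\gamma^\vee(v)$ kills $u$. The module $U$ is tempered if the real part of each weight of $U$ has the form $\sum_{\alpha\in J}a_\alpha\alpha^\vee+\sum_{\alpha\in\Pi\setminus J}b_\alpha\omega_\alpha^\vee$ with $a_\alpha\le 0$ and $b_\alpha>0$, where $(\omega^\vee_\alpha)_{\alpha\in\Pi}$ is the basis of $V_0^\vee$ dual to $\Pi$. Let $\mathcal O(J)$ be the localization of $S(V)$ at the multiplicative set generated by all $v-c$ with $v\in V\setminus V_J$, $c\in\mathbb C$; let $\mathcal H_J=\mathbb H_J\otimes_{S(V)}\mathcal O(J)$, which is an algebra containing $\mathbb H_J$, and let $\mathcal H^J=\mathbb H\otimes_{\mathbb H_J}\mathcal H_J$, an $(\mathbb H,\mathcal H_J)$-bimodule. For $w\in W^J$ with reduced expression $w=s_{\alpha_r}\cdots s_{\alpha_1}$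 put $$\tau_w=(t_{s_{\alpha_r}}\alpha_r-k_{\alpha_r})\cdots(t_{s_{\alpha_1}}\alpha_1-k_{\alpha_1})\prod_{\alpha>0,\ w(\alpha)<0}\alpha^{-1}\in\mathcal H^J .$$ Fix a basis $\omega_1^\vee,\dots,\omega_d^\vee$ of the space of functionals in $V^\vee$ vanishing on $V_J$, and let $\eta^\vee_{\mathbf a}=\sum_i\mathbf a_i\omega_i^\vee:V\to\mathbb C(\mathbf a)=\mathbb C(\mathbf a_1,\dots,\mathbf a_d)$. For $U$ finite-dimensional, $U_{\mathbf a}=\mathbb C(\mathbf a)\otimes_{\mathbb C}U$ is the $\mathcal H_J$-module on which $t_w$ ($w\in W_J$) acts by $1\otimes t_w$ and $v\in V$ acts by $1\otimes v+\eta^\vee_{\mathbf a}(v)$. Let $\theta=-w_0$ and $\phi=\theta\circ(-w_{0,J})=w_0w_{0,J}$, so that $\phi(J)=\theta(J)\subset\Pi$. Then $t_w\mapsto t_{\phi w\phi^{-1}}$, $v\mapsto\phi(v)$ defines isomorphisms $\mathbb H_J\to\mathbb H_{\theta(J)}$ and $\mathcal H_J\to\mathcal H_{\theta(J)}$; let $\phi(U)$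 and $\phi(U_{\mathbf a})$ be the modules over $\mathbb H_{\theta(J)}$ and $\mathcal H_{\theta(J)}$ obtained from $U$ and $U_{\mathbf a}$ by transport along them, with underlying identity maps $u\mapsto\phi(u)$. An element of $\mathcal H^{\theta(J)}\otimes_{\mathcal H_{\theta(J)}}\phi(U_{\mathbf a})$ is called holomorphic if it is of the form $\sum_{w\in W^{\theta(J)}}t_w\otimes\phi(y_w)$ where each $y_w$ is a $\mathbb C(\mathbf a)$-linear combination of elements of $U$ whose coefficients are holomorphic at $\mathbf a=0$; its specialization $|_{\mathbf a=0}$ is $\sum_w t_w\otimes\phi(y_w(0))\in\mathbb H\otimes_{\mathbb H_{\theta(J)}}\phi(U)$. **Proposition.** Let $U$ be a finite-dimensional indecomposable tempered $\mathbb H_J$-module, and let $\tau=\tau_{w^{\theta(J)}}\in\mathcal H^{\theta(J)}$. 1. For every $u\in U=1\otimes U\subset U_{\mathbf a}$ the element $\tau\otimes\phi(u)$ of $\mathcal H^{\theta(J)}\otimes_{\mathcal H_{\theta(J)}}\phi(U_{\mathbf a})$ is holomorphic. 2. The subspace $\{\tau\otimes\phi(u_{\mathbf a}):u_{\mathbf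 a}\in U_{\mathbf a}\}$ is stable under $\mathbb H_J$, and $u_{\mathbf a}\mapsto\tau\otimes\phi(u_{\mathbf a})$ is an isomorphism of $\mathbb H_J$-modules from $U_{\mathbf a}$ onto it. 3. This map induces an isomorphism of $\mathbb H$-modules $\mathcal H^J\otimes_{\mathcal H_J}U_{\mathbf a}\to\mathcal H^{\theta(J)}\otimes_{\mathcal H_{\theta(J)}}\phi(U_{\mathbf a})$ with $1\otimes u_{\mathbf a}\mapsto\tau\otimes\phi(u_{\mathbf a})$. 4. The subspace $\{(\tau\otimes\phi(u))|_{\mathbf a=0}:u\in U\}$ of $I(\theta(J),\phi(U))$ is stable under $\mathbb H_J$, and $u\mapsto(\tau\otimes\phi(u))|_{\mathbf a=0}$ is an isomorphism of $\mathbb H_J$-modules from $U$ onto it. 5. The map in 4 induces a homomorphism of $\mathbb H$-modules $I(J,U)\to I(\theta(J),\phi(U))$ with $1\otimes u\mapsto(\tau\otimes\phi(u))|_{\mathbf a=0}$. If moreover $U$ is irreducible, then $I(J,U)$ has a unique maximal proper submodule (containing all proper submodules), and the image of this homomorphism is isomorphic to the corresponding unique simple quotient $L(J,U)$ of $I(J,U)$.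 -/

import Mathlib

open TensorProduct

noncomputable section

namespace GradedHecke

/-! ## Simple roots and the Weyl group -/

/-- A set of simple roots of a (finite, real, possibly non-crystallographic) root system: a set of
roots which is a basis of `V₀` and such that every root is a combination of simple roots with all
coefficients nonnegative or all coefficients nonpositive. -/
structure SimpleRoots {ι V₀ N : Type*} [AddCommGroup V₀] [Module ℝ V₀] [AddCommGroup N]
    [Module ℝ N] (P : RootPairing ι ℝ V₀ N) where
  support : Set ι
  basis : Module.Basis support ℝ V₀
  basis_apply : ∀ α : support, basis α = P.root α
  nonneg_or_nonpos : ∀ i : ι, (∀ α, 0 ≤ basis.repr (P.root i) α) ∨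
    (∀ α, basis.repr (P.root i) α ≤ 0)

section Weyl

variable {ι V₀ N : Type*} [AddCommGroup V₀] [Module ℝ V₀] [AddCommGroup N] [Module ℝ N]
  {P : RootPairing ι ℝ V₀ N} (b : SimpleRoots P)

/-- The subgroup `W_J` generated by the simple reflections `s_α`, `α ∈ J`. -/
def weyl (J : Set b.support) : Subgroup (V₀ ≃ₗ[ℝ] V₀) :=
  Subgroup.closure ((fun α : b.support => P.reflection α) '' J)

/-- The root with index `i` is positive. -/
def IsPos (i : ι) : Prop := ∀ α, 0 ≤ b.basis.repr (P.root i) α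

/-- The product `s_{α_r} ⋯ s_{α_1}` of a word `[α_r, …, α_1]` in the simple roots. -/
def wordProd (l : List b.support) : V₀ ≃ₗ[ℝ] V₀ := (l.map fun α : b.support => P.reflection α).prod

/-- The length of `w`: the least length of a word in the simple reflections with product `w`. -/
def len (w : V₀ ≃ₗ[ℝ] V₀) : ℕ := sInf {r | ∃ l : List b.support, l.length = r ∧ wordProd b l = w}

/-- A reduced expression of `w`. -/
def IsReducedWord (l : List b.support) (w : V₀ ≃ₗ[ℝ] V₀) : Prop :=
  wordProd b l = w ∧ l.length = len b w

/-- The set `W^J` of minimal length representatives of the cosets in `W / W_J`. -/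
def minReps (J : Set b.support) : Set (V₀ ≃ₗ[ℝ] V₀) :=
  {w | w ∈ weyl b Set.univ ∧ ∀ u ∈ weyl b J, len b w ≤ len b (w * u)}

/-- `w` is an element of maximal length of the set `S`. -/
def IsLongest (S : Set (V₀ ≃ₗ[ℝ] V₀)) (w : V₀ ≃ₗ[ℝ] V₀) : Prop :=
  w ∈ S ∧ ∀ w' ∈ S, len b w' ≤ len b w

open Classical in
/-- The longest element of `S`; it is applied to `S = W_J` and to `S = W^J`, where it is unique. -/
def longest (S : Set (V₀ ≃ₗ[ℝ] V₀)) : V₀ ≃ₗ[ℝ] V₀ := Classical.epsilon (IsLongest b S)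

/-- The longest element `w_{0,J}` of `W_J`. -/
def wZero (J : Set b.support) : V₀ ≃ₗ[ℝ] V₀ := longest b (weyl b J : Set (V₀ ≃ₗ[ℝ] V₀))

/-- The longest element `w^J` of `W^J`. -/
def wTop (J : Set b.support) : V₀ ≃ₗ[ℝ] V₀ := longest b (minReps b J)

/-- The set `θ(J)` of simple roots, where `θ(α) = - w₀(α)`. -/
def theta (J : Set b.support) : Set b.support :=
  {β | ∃ α ∈ J, P.root β = - wZero b Set.univ (P.root α)}

/-- The linear map `φ = θ ∘ θ_J`, where `θ = - w₀` and `θ_J = - w_{0,J}`; the signs cancel. -/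
def phi (J : Set b.support) : V₀ ≃ₗ[ℝ] V₀ := wZero b Set.univ * wZero b J

/-- The set `R(w)` of (indices of) positive roots that `w` makes negative. -/
def inversions (w : V₀ ≃ₗ[ℝ] V₀) : Set ι :=
  {i | IsPos b i ∧ ∃ j, IsPos b j ∧ w (P.root i) = - P.root j}

/-! ### The longest element of `W_J` maps `J` to `-J` -/

lemma exists_word {J : Set b.support} {w : V₀ ≃ₗ[ℝ] V₀} (hw : w ∈ weyl b J) :
    ∃ l : List b.support, (∀ α ∈ l, α ∈ J) ∧ wordProd b l = w := by
  induction hw using Subgroup.closure_induction with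
  | mem x hx =>
    obtain ⟨α, hα, rfl⟩ := hx
    exact ⟨[α], by simpa using hα, by simp [wordProd]⟩
  | one => exact ⟨[], by simp, rfl⟩
  | mul x y _ _ hx hy =>
    obtain ⟨l, hl, rfl⟩ := hx
    obtain ⟨l', hl', rfl⟩ := hy
    refine ⟨l ++ l', fun α hα => ?_, by simp [wordProd]⟩
    rcases List.mem_append.1 hα with h | h
    exacts [hl α h, hl' α h]
  | inv x hxm hx =>
    obtain ⟨l, hl, rfl⟩ := hx
    clear hxm
    refine ⟨l.reverse, fun α hα => hl α (List.mem_reverse.1 hα), ?_⟩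
    clear hl
    induction l with
    | nil => simp [wordProd]
    | cons α l ih =>
      simp only [wordProd, List.reverse_cons, List.map_append, List.prod_append, List.map_cons,
        List.prod_cons, List.map_nil, List.prod_nil, mul_one, mul_inv_rev,
        RootPairing.reflection_inv] at ih ⊢
      rw [ih]

lemma wordProd_cons (α : b.support) (l : List b.support) :
    wordProd b (α :: l) = P.reflection α * wordProd b l := by simp [wordProd]

lemma wordProd_mem {J : Set b.support} {l : List b.support} (hl : ∀ α ∈ l, α ∈ J) :
    wordProd b l ∈ weyl b J := by
  refine Subgroup.list_prod_mem _ fun x hx => ?_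
  obtain ⟨α, hα, rfl⟩ := List.mem_map.1 hx
  exact Subgroup.subset_closure ⟨α, hl α hα, rfl⟩

lemma refl_mem {J : Set b.support} {α : b.support} (hα : α ∈ J) : P.reflection α ∈ weyl b J :=
  Subgroup.subset_closure ⟨α, hα, rfl⟩

lemma weyl_mono {J J' : Set b.support} (h : J ⊆ J') : weyl b J ≤ weyl b J' :=
  Subgroup.closure_mono (Set.image_mono h)

lemma weyl_root {J : Set b.support} {w : V₀ ≃ₗ[ℝ] V₀} (hw : w ∈ weyl b J) (i : ι) :
    ∃ j, w (P.root i) = P.root j ∧ P.reflection j = w * P.reflection i * w⁻¹ := by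
  obtain ⟨l, -, rfl⟩ := exists_word b hw
  clear hw
  induction l with
  | nil => exact ⟨i, rfl, by simp [wordProd]⟩
  | cons α l ih =>
    obtain ⟨j, hj, hj'⟩ := ih
    refine ⟨P.reflectionPerm α j, ?_, ?_⟩
    · rw [wordProd_cons, LinearEquiv.mul_apply, hj, P.root_reflectionPerm]
    · rw [RootPairing.reflection_reflectionPerm, hj', wordProd_cons, mul_inv_rev,
        RootPairing.reflection_inv]
      group

/-- If `w ∈ W` and `w(α) = β` for two roots, then `s_β = w s_α w⁻¹`. -/
lemma reflection_conj {w : V₀ ≃ₗ[ℝ] V₀} (hw : w ∈ weyl b Set.univ) {i j : ι}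
    (h : w (P.root i) = P.root j) : P.reflection j = w * P.reflection i * w⁻¹ := by
  obtain ⟨l, hl, hl'⟩ := weyl_root b hw i
  rw [h] at hl
  rw [P.root.injective hl, hl']

lemma repr_reflection (α β : b.support) (h : β ≠ α) (x : V₀) :
    b.basis.repr (P.reflection α x) β = b.basis.repr x β := by
  rw [RootPairing.reflection_apply, ← b.basis_apply]
  simp [h.symm]

lemma repr_root_nonneg (α β : b.support) : 0 ≤ b.basis.repr (P.root α) β := by
  classical
  rw [← b.basis_apply, Module.Basis.repr_self, Finsupp.single_apply]
  split_ifs <;> norm_num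

lemma exists_repr_pos {i : ι} (hi : IsPos b i) : ∃ α, 0 < b.basis.repr (P.root i) α := by
  by_contra! hc
  have h0 : b.basis.repr (P.root i) = 0 := by
    ext α; exact le_antisymm (hc α) (hi α)
  exact P.ne_zero i (by simpa using h0)

lemma isPos_or (i : ι) : IsPos b i ∨ IsPos b (P.reflectionPerm i i) := by
  refine (b.nonneg_or_nonpos i).imp id fun h α => ?_
  rw [P.root_reflectionPerm, RootPairing.reflection_apply_self]
  simpa using h α


lemma eq_of_repr [P.IsReduced] {i : ι} (hi : IsPos b i) (α : b.support)
    (h : ∀ β, β ≠ α → b.basis.repr (P.root i) β = 0) : P.root i = P.root α := by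
  have h1 : P.root i = b.basis.repr (P.root i) α • P.root α := by
    rw [← b.basis_apply]
    apply b.basis.repr.injective
    ext β
    by_cases hβ : β = α
    · subst hβ; simp
    · rw [h β hβ]; simp [Ne.symm hβ]
  have h2 : ¬ LinearIndependent ℝ ![P.root i, P.root α] := by
    rw [LinearIndependent.pair_iff]
    intro hc
    have := (hc 1 (-(b.basis.repr (P.root i) α)) (by
      rw [one_smul, neg_smul, ← h1, add_neg_cancel])).1
    exact one_ne_zero this
  rcases RootPairing.IsReduced.eq_or_eq_neg _ _ h2 with h3 | h3
  · exact h3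
  · obtain ⟨β, hβ⟩ := exists_repr_pos b hi
    have := repr_root_nonneg b α β
    rw [h3, map_neg, Finsupp.neg_apply] at hβ
    linarith

/-- A simple reflection `s_α` permutes the positive roots different from `α`. -/
lemma isPos_reflection [P.IsReduced] {i : ι} (hi : IsPos b i) (α : b.support) (h : P.root i ≠ P.root α) :
    IsPos b (P.reflectionPerm α i) := by
  by_contra hc
  apply h
  apply eq_of_repr b hi
  intro β hβ
  refine le_antisymm ?_ (hi β)
  have := (b.nonneg_or_nonpos (P.reflectionPerm α i)).resolve_left hc β
  rwa [P.root_reflectionPerm, repr_reflection b α β hβ] at this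

/-- Exchange: if `w(α)` is negative, then `w s_α` has a word shorter than a given one of `w`. -/
lemma exchange [P.IsReduced] (l : List b.support) (α : b.support) (J : Set b.support) (hl : ∀ β ∈ l, β ∈ J)
    (h : ∃ j, IsPos b j ∧ wordProd b l (P.root α) = - P.root j) :
    ∃ l' : List b.support, (∀ β ∈ l', β ∈ J) ∧ l'.length + 1 = l.length ∧
      wordProd b l * P.reflection α = wordProd b l' := by
  induction l with
  | nil =>
    exfalso
    obtain ⟨j, hj, hj'⟩ := h
    obtain ⟨β, hβ⟩ := exists_repr_pos b hj
    have h1 : P.root j = - P.root α := by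
      rw [eq_neg_iff_add_eq_zero, add_comm, ← eq_neg_iff_add_eq_zero, ← hj']; rfl
    have := repr_root_nonneg b α β
    rw [h1, map_neg, Finsupp.neg_apply] at hβ
    linarith
  | cons γ l ih =>
    by_cases hn : ∃ j, IsPos b j ∧ wordProd b l (P.root α) = - P.root j
    · obtain ⟨l', h1, h2, h3⟩ := ih (fun β hβ => hl β (List.mem_cons_of_mem _ hβ)) hn
      refine ⟨γ :: l', ?_, by simp [h2], ?_⟩
      · intro β hβ
        rcases List.mem_cons.1 hβ with rfl | hβ
        exacts [hl _ List.mem_cons_self, h1 β hβ]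
      · rw [wordProd_cons, wordProd_cons, mul_assoc, h3]
    · have hw : wordProd b l ∈ weyl b Set.univ := wordProd_mem b (by simp)
      obtain ⟨i, hi, -⟩ := weyl_root b hw α
      have hip : IsPos b i := by
        refine (isPos_or b i).resolve_right fun hc => hn ⟨_, hc, ?_⟩
        rw [P.root_reflectionPerm, RootPairing.reflection_apply_self, hi, neg_neg]
      have hiγ : P.root i = P.root γ := by
        by_contra hne
        have h1 := isPos_reflection b hip γ hne
        obtain ⟨j, hj, hj'⟩ := h
        rw [wordProd_cons, LinearEquiv.mul_apply, hi, ← P.root_reflectionPerm] at hj'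
        obtain ⟨β, hβ⟩ := exists_repr_pos b h1
        rw [hj'] at hβ
        have := hj β
        simp at hβ
        linarith
      refine ⟨l, fun β hβ => hl β (List.mem_cons_of_mem _ hβ), by simp, ?_⟩
      have h4 := reflection_conj b hw (hi.trans hiγ)
      rw [wordProd_cons, h4]
      rw [inv_mul_cancel_right, mul_assoc, ← sq, RootPairing.reflection_sq, mul_one]

lemma exists_reduced {J : Set b.support} {w : V₀ ≃ₗ[ℝ] V₀} (hw : w ∈ weyl b J) :
    ∃ l : List b.support, IsReducedWord b l w := by
  obtain ⟨l, -, hl⟩ := exists_word b hw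
  have : sInf {r | ∃ l : List b.support, l.length = r ∧ wordProd b l = w} ∈
      {r | ∃ l : List b.support, l.length = r ∧ wordProd b l = w} :=
    Nat.sInf_mem ⟨_, l, rfl, hl⟩
  obtain ⟨l', h1, h2⟩ := this
  exact ⟨l', h2, h1⟩

lemma len_lt [P.IsReduced] {w : V₀ ≃ₗ[ℝ] V₀} (hw : w ∈ weyl b Set.univ) (α : b.support)
    (h : ∃ j, IsPos b j ∧ w (P.root α) = P.root j) : len b w < len b (w * P.reflection α) := by
  have hw' := mul_mem hw (refl_mem b (Set.mem_univ α))
  obtain ⟨l, h1, h2⟩ := exists_reduced b hw'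
  obtain ⟨j, hj, hj'⟩ := h
  obtain ⟨l', -, h3, h4⟩ := exchange b l α Set.univ (by simp) ⟨j, hj, by
    rw [h1, LinearEquiv.mul_apply, RootPairing.reflection_apply_self, map_neg, hj']⟩
  rw [h1, mul_assoc, ← sq, RootPairing.reflection_sq, mul_one] at h4
  have : len b w ≤ l'.length := Nat.sInf_le ⟨l', rfl, h4.symm⟩
  omega

lemma finite_weyl [Finite ι] (J : Set b.support) :
    (weyl b J : Set (V₀ ≃ₗ[ℝ] V₀)).Finite := by
  have hinj : Function.Injective
      fun (w : weyl b J) (α : b.support) => (weyl_root b w.2 α).choose := by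
    intro w w' h
    apply Subtype.ext
    apply LinearEquiv.toLinearMap_injective
    refine b.basis.ext fun α => ?_
    have h1 := congrFun h α
    have h2 := (weyl_root b w.2 α).choose_spec.1
    have h3 := (weyl_root b w'.2 α).choose_spec.1
    simp only at h1
    rw [h1, ← h3] at h2
    simpa [b.basis_apply] using h2
  have := Finite.of_injective _ hinj
  exact Set.toFinite _

lemma wZero_isLongest [Finite ι] (J : Set b.support) : IsLongest b (weyl b J) (wZero b J) := by
  apply Classical.epsilon_spec
  obtain ⟨w, hw, h⟩ := Set.exists_max_image _ (len b) (finite_weyl b J) ⟨1, one_mem _⟩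
  exact ⟨w, hw, h⟩

lemma repr_weyl {J : Set b.support} {w : V₀ ≃ₗ[ℝ] V₀} (hw : w ∈ weyl b J) (x : V₀)
    (β : b.support) (hβ : β ∉ J) : b.basis.repr (w x) β = b.basis.repr x β := by
  obtain ⟨l, hl, rfl⟩ := exists_word b hw
  clear hw
  induction l with
  | nil => rfl
  | cons α l ih =>
    rw [wordProd_cons, LinearEquiv.mul_apply, repr_reflection b α β,
      ih fun γ hγ => hl γ (List.mem_cons_of_mem _ hγ)]
    rintro rfl
    exact hβ (hl _ List.mem_cons_self)

/-- Every `α ∈ J` is of the form `- w_{0,J}(γ)` with `γ ∈ J`. -/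
lemma exists_wZero_eq_neg [Finite ι] [P.IsReduced] {J : Set b.support} {β : b.support}
    (hβ : β ∈ J) : ∃ γ ∈ J, wZero b J (P.root γ) = - P.root β := by
  obtain ⟨hw, hmax⟩ := wZero_isLongest b J
  set w := wZero b J
  have := Fintype.ofFinite b.support
  have hwu := weyl_mono b (Set.subset_univ J) hw
  have hneg : ∀ α ∈ J, ∃ j, IsPos b j ∧ w (P.root α) = - P.root j := by
    intro α hα
    obtain ⟨j, hj, -⟩ := weyl_root b hw α
    rcases isPos_or b j with h | h
    · exact absurd (len_lt b hwu α ⟨j, h, hj⟩)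
        (not_lt.2 (hmax _ (mul_mem hw (refl_mem b hα))))
    · exact ⟨_, h, by rw [P.root_reflectionPerm, RootPairing.reflection_apply_self, hj, neg_neg]⟩
  obtain ⟨i, hi, -⟩ := weyl_root b (inv_mem hw) β
  have hwi : w (P.root i) = P.root β := by
    rw [← hi, ← LinearEquiv.mul_apply, mul_inv_cancel]; rfl
  have hsupp : ∀ γ, γ ∉ J → b.basis.repr (P.root i) γ = 0 := by
    intro γ hγ
    rw [← hi, repr_weyl b (inv_mem hw) _ γ hγ, ← b.basis_apply, Module.Basis.repr_self,
      Finsupp.single_eq_of_ne]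
    rintro rfl
    exact hγ hβ
  have hsum : ∀ δ, b.basis.repr (P.root β) δ =
      ∑ γ, b.basis.repr (P.root i) γ * b.basis.repr (w (P.root γ)) δ := by
    intro δ
    conv_lhs => rw [← hwi, ← b.basis.sum_repr (P.root i)]
    simp [b.basis_apply, Finsupp.finsetSum_apply]
  have hwneg : ∀ γ ∈ J, ∀ δ, b.basis.repr (w (P.root γ)) δ ≤ 0 := by
    intro γ hγ δ
    obtain ⟨j, hj, hj'⟩ := hneg γ hγ
    rw [hj']
    simpa using hj δ
  have hin : ∀ γ, b.basis.repr (P.root i) γ ≤ 0 := by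
    refine (b.nonneg_or_nonpos i).resolve_left fun hc => ?_
    have h1 : b.basis.repr (P.root β) β ≤ 0 := by
      rw [hsum]
      refine Finset.sum_nonpos fun γ _ => ?_
      by_cases hγ : γ ∈ J
      · exact mul_nonpos_of_nonneg_of_nonpos (hc γ) (hwneg γ hγ β)
      · rw [hsupp γ hγ, zero_mul]
    rw [← b.basis_apply, Module.Basis.repr_self, Finsupp.single_eq_same] at h1
    linarith
  have hex : ∃ γ, b.basis.repr (P.root i) γ ≠ 0 := by
    by_contra! hc
    exact P.ne_zero i (b.basis.repr.map_eq_zero_iff.1 (Finsupp.ext hc))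
  obtain ⟨γ, hγ⟩ := hex
  have hγJ : γ ∈ J := by
    by_contra hc
    exact hγ (hsupp γ hc)
  refine ⟨γ, hγJ, ?_⟩
  obtain ⟨j, hj, hj'⟩ := hneg γ hγJ
  rw [hj', eq_of_repr b hj β]
  intro δ hδ
  have h0 : b.basis.repr (P.root β) δ = 0 := by
    rw [← b.basis_apply, Module.Basis.repr_self, Finsupp.single_eq_of_ne hδ]
  rw [hsum, Finset.sum_eq_zero_iff_of_nonneg] at h0
  · have h1 := (mul_eq_zero.1 (h0 γ (Finset.mem_univ _))).resolve_left hγ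
    rw [hj'] at h1
    simpa using h1
  · intro ε _
    by_cases hε : ε ∈ J
    · exact mul_nonneg_of_nonpos_of_nonpos (hin ε) (hwneg ε hε δ)
    · rw [hsupp ε hε, zero_mul]

lemma phi_mem [Finite ι] (J : Set b.support) : phi b J ∈ weyl b Set.univ :=
  mul_mem (wZero_isLongest b _).1 (weyl_mono b (Set.subset_univ J) (wZero_isLongest b J).1)

lemma wZero_eq_neg [Finite ι] [P.IsReduced] {J : Set b.support} {γ : b.support} (hγ : γ ∈ J) :
    ∃ β ∈ J, wZero b J (P.root γ) = - P.root β := by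
  choose g hg using fun β : J => exists_wZero_eq_neg b β.2
  have hinj : Function.Injective fun β : J => (⟨g β, (hg β).1⟩ : J) := by
    intro β β' h
    have h1 : g β = g β' := congrArg Subtype.val h
    have h2 := (hg β).2.symm.trans ((congrArg (fun x : b.support => wZero b J (P.root x)) h1).trans
      (hg β').2)
    exact Subtype.ext (Subtype.ext (P.root.injective (neg_injective h2)))
  obtain ⟨β, hβ⟩ := Finite.surjective_of_injective hinj ⟨γ, hγ⟩
  have h1 : g β = γ := congrArg Subtype.val hβ
  exact ⟨β, β.2, by rw [← h1]; exact (hg β).2⟩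

/-- `w ∈ W` and `w(J) = J'`. -/
structure MapsOnto (w : V₀ ≃ₗ[ℝ] V₀) (J J' : Set b.support) : Prop where
  mem : w ∈ weyl b Set.univ
  exists_right : ∀ α ∈ J, ∃ β ∈ J', w (P.root α) = P.root β
  exists_left : ∀ β ∈ J', ∃ α ∈ J, w (P.root α) = P.root β

lemma phi_mapsOnto [Finite ι] [P.IsReduced] (J : Set b.support) :
    MapsOnto b (phi b J) J (theta b J) := by
  refine ⟨phi_mem b J, fun α hα => ?_, ?_⟩
  · obtain ⟨β, hβ, h⟩ := wZero_eq_neg b hα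
    obtain ⟨β', -, h'⟩ := wZero_eq_neg b (Set.mem_univ β)
    refine ⟨β', ⟨β, hβ, by rw [h', neg_neg]⟩, ?_⟩
    rw [phi, LinearEquiv.mul_apply, h, map_neg, h', neg_neg]
  · rintro β ⟨α, hα, h⟩
    obtain ⟨γ, hγ, h'⟩ := exists_wZero_eq_neg b hα
    exact ⟨γ, hγ, by rw [phi, LinearEquiv.mul_apply, h', map_neg, h]⟩

end Weyl

/-! ## Graded Hecke algebras -/

/-- The complexification `V = ℂ ⊗ V₀`. -/
abbrev Cx (V₀ : Type*) [AddCommGroup V₀] [Module ℝ V₀] : Type _ := ℂ ⊗[ℝ] V₀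

/-- The real part `V₀ → ℝ` of a functional `γ` on `V = ℂ ⊗ V₀`. -/
def rePart {V₀ : Type*} [AddCommGroup V₀] [Module ℝ V₀] (γ : Module.Dual ℂ (Cx V₀)) :
    Module.Dual ℝ V₀ where
  toFun x := (γ (1 ⊗ₜ x)).re
  map_add' x y := by simp [tmul_add]
  map_smul' c x := by simp [tmul_smul, ← Complex.coe_smul]

/-- A linear automorphism of `V₀` acting on `V`. -/
def cxMap {V₀ : Type*} [AddCommGroup V₀] [Module ℝ V₀] (w : V₀ ≃ₗ[ℝ] V₀) : Cx V₀ →ₗ[ℂ] Cx V₀ :=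
  (w : V₀ →ₗ[ℝ] V₀).baseChange ℂ

section CxMap
variable {V₀ : Type*} [AddCommGroup V₀] [Module ℝ V₀]

@[simp] lemma cxMap_tmul (w : V₀ ≃ₗ[ℝ] V₀) (c : ℂ) (x : V₀) : cxMap w (c ⊗ₜ x) = c ⊗ₜ w x := rfl

lemma cxMap_mul (w w' : V₀ ≃ₗ[ℝ] V₀) (v : Cx V₀) : cxMap (w * w') v = cxMap w (cxMap w' v) := by
  induction v using TensorProduct.induction_on with
  | zero => simp
  | tmul c x => rfl
  | add x y hx hy => simp [hx, hy]

end CxMap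

section Hecke

variable {ι V₀ N : Type*} [AddCommGroup V₀] [Module ℝ V₀] [AddCommGroup N] [Module ℝ N]
  {P : RootPairing ι ℝ V₀ N} (b : SimpleRoots P)

/-- A parameter function `k : Π → ℂ`, constant on (the intersections with `Π` of) `W`-orbits. -/
structure Param where
  val : b.support → ℂ
  eq_of_conj : ∀ (α β : b.support), ∀ w ∈ weyl b Set.univ, w (P.root α) = P.root β → val α = val β

/-- The element `1 ⊗ α` of `V` attached to a root `α`. -/
def cxRoot (P : RootPairing ι ℝ V₀ N) (i : ι) : Cx V₀ := 1 ⊗ₜ P.root i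

/-- The functional `v ↦ ⟨v, α^∨⟩` on `V`. -/
def cxCoroot (P : RootPairing ι ℝ V₀ N) (i : ι) : Module.Dual ℂ (Cx V₀) :=
  (P.coroot' i).baseChange ℂ

lemma cxMap_reflection (i : ι) (v : Cx V₀) :
    cxMap (P.reflection i) v = v - cxCoroot P i v • cxRoot P i := by
  induction v using TensorProduct.induction_on with
  | zero => simp
  | tmul c x =>
    rw [cxMap_tmul, RootPairing.reflection_apply, tmul_sub, cxCoroot, cxRoot,
      Module.Dual.baseChange_apply_tmul, smul_tmul', tmul_smul, smul_tmul']
    simp [Algebra.smul_def, mul_comm]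
  | add x y hx hy =>
    rw [map_add, hx, hy, map_add, add_smul]; abel

variable {b} (k : Param b) (J : Set b.support) (O : Type*) [CommRing O] [Algebra ℂ O]
  (j : Cx V₀ →ₗ[ℂ] O)

/-- The simple reflection `s_α ∈ W_J` for `α ∈ J`. -/
def sRefl {J : Set b.support} {α : b.support} (hα : α ∈ J) : weyl b J :=
  ⟨P.reflection α, refl_mem b hα⟩

/-- Defining relations, on generators `t_w` (`w ∈ W_J`) and `f_q` (`q ∈ O`): `w ↦ t_w` comes from
an algebra map `ℂ[W_J] → A`, `f` is an algebra map `O → A`, and for `α ∈ J` and `v ∈ V`,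
`t_{s_α} v - s_α(v) t_{s_α} = k_α ⟨v, α^∨⟩`. -/
inductive Rel : FreeAlgebra ℂ (weyl b J ⊕ O) → FreeAlgebra ℂ (weyl b J ⊕ O) → Prop
  | t_one : Rel (FreeAlgebra.ι ℂ (.inl 1)) 1
  | t_mul (w w' : weyl b J) : Rel (FreeAlgebra.ι ℂ (.inl (w * w')))
      (FreeAlgebra.ι ℂ (.inl w) * FreeAlgebra.ι ℂ (.inl w'))
  | f_algebraMap (c : ℂ) : Rel (FreeAlgebra.ι ℂ (.inr (algebraMap ℂ O c))) (algebraMap ℂ _ c)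
  | f_add (p q : O) : Rel (FreeAlgebra.ι ℂ (.inr (p + q)))
      (FreeAlgebra.ι ℂ (.inr p) + FreeAlgebra.ι ℂ (.inr q))
  | f_mul (p q : O) : Rel (FreeAlgebra.ι ℂ (.inr (p * q)))
      (FreeAlgebra.ι ℂ (.inr p) * FreeAlgebra.ι ℂ (.inr q))
  | cross (α : b.support) (hα : α ∈ J) (v : Cx V₀) :
      Rel (FreeAlgebra.ι ℂ (.inl (sRefl hα)) * FreeAlgebra.ι ℂ (.inr (j v)) -
          FreeAlgebra.ι ℂ (.inr (j (cxMap (P.reflection α) v))) *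
            FreeAlgebra.ι ℂ (.inl (sRefl hα)))
        (algebraMap ℂ _ (k.val α * cxCoroot P α v))

/-- The `ℂ`-algebra generated by `ℂ[W_J]` and a commutative algebra `O` over `S(V)` subject to the
relations of a graded Hecke algebra. -/
abbrev HeckeAlg : Type _ := RingQuot (Rel k J O j)

namespace HeckeAlg

variable {k J O j}

/-- `w ↦ t_w`. -/
def t : weyl b J →* HeckeAlg k J O j where
  toFun w := RingQuot.mkAlgHom ℂ _ (FreeAlgebra.ι ℂ (.inl w))
  map_one' := by rw [RingQuot.mkAlgHom_rel ℂ Rel.t_one, map_one]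
  map_mul' w w' := by rw [RingQuot.mkAlgHom_rel ℂ (Rel.t_mul w w'), map_mul]

/-- `q ↦ f_q`. -/
def f : O →ₐ[ℂ] HeckeAlg k J O j :=
  AlgHom.ofLinearMap
    { toFun := fun q => RingQuot.mkAlgHom ℂ _ (FreeAlgebra.ι ℂ (.inr q))
      map_add' := fun p q => by rw [RingQuot.mkAlgHom_rel ℂ (Rel.f_add p q), map_add]
      map_smul' := fun c q => by
        rw [Algebra.smul_def, RingQuot.mkAlgHom_rel ℂ (Rel.f_mul _ q), map_mul,
          RingQuot.mkAlgHom_rel ℂ (Rel.f_algebraMap c), AlgHom.commutes, RingHom.id_apply,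
          Algebra.smul_def] }
    (by
      have := RingQuot.mkAlgHom_rel ℂ (Rel.f_algebraMap (k := k) (J := J) (O := O) (j := j) 1)
      simpa using this)
    (fun p q => by
      have := RingQuot.mkAlgHom_rel ℂ (Rel.f_mul (k := k) (J := J) (O := O) (j := j) p q)
      simpa using this)

lemma cross {α : b.support} (hα : α ∈ J) (v : Cx V₀) :
    (t (sRefl hα) * f (j v) - f (j (cxMap (P.reflection α) v)) * t (sRefl hα) :
      HeckeAlg k J O j) = algebraMap ℂ _ (k.val α * cxCoroot P α v) := by
  have := RingQuot.mkAlgHom_rel ℂ (Rel.cross (k := k) (j := j) α hα v)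
  rw [map_sub, map_mul, map_mul, AlgHom.commutes] at this
  exact this

variable {B : Type*} [Ring B] [Algebra ℂ B]

/-- The universal property of `HeckeAlg`. -/
def lift (T : weyl b J →* B) (F : O →ₐ[ℂ] B)
    (h : ∀ (α : b.support) (hα : α ∈ J) (v : Cx V₀),
      T (sRefl hα) * F (j v) - F (j (cxMap (P.reflection α) v)) * T (sRefl hα) =
        algebraMap ℂ B (k.val α * cxCoroot P α v)) :
    HeckeAlg k J O j →ₐ[ℂ] B :=
  RingQuot.liftAlgHom ℂ ⟨FreeAlgebra.lift ℂ (Sum.elim T F), by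
    intro x y hxy
    cases hxy with
    | cross α hα v => simpa using h α hα v
    | _ => simp⟩

@[simp] lemma lift_t (T : weyl b J →* B) (F : O →ₐ[ℂ] B) (h) (w : weyl b J) :
    lift (k := k) (j := j) T F h (t w) = T w := by
  simp [lift, t]

@[simp] lemma lift_f (T : weyl b J →* B) (F : O →ₐ[ℂ] B) (h) (q : O) :
    lift (k := k) (j := j) T F h (f q) = F q := by
  simp [lift, f]

end HeckeAlg
end Hecke

/-! ## The algebras `ℍ`, `ℍ_J`, `𝓗_J` -/

section Algebras

variable {ι V₀ N : Type*} [AddCommGroup V₀] [Module ℝ V₀] [AddCommGroup N] [Module ℝ N]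
  {P : RootPairing ι ℝ V₀ N} {b : SimpleRoots P} (k : Param b) (J : Set b.support)

/-- The symmetric algebra `S(V)`. -/
abbrev SV (V₀ : Type*) [AddCommGroup V₀] [Module ℝ V₀] : Type _ := SymmetricAlgebra ℂ (Cx V₀)

/-- The subspace `V_J` of `V` spanned by `J`. -/
def VJ : Submodule ℂ (Cx V₀) := Submodule.span ℂ ((fun α : b.support => cxRoot P α) '' J)

/-- The multiplicative set of the products `(v₁ - c₁) ⋯ (v_r - c_r)`, `v_i ∈ V ∖ V_J`, `c_i ∈ ℂ`.
It is trivial if `J = Π`. -/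
def denoms : Submonoid (SV V₀) :=
  Submonoid.closure {p | ∃ v : Cx V₀, v ∉ VJ J ∧ ∃ c : ℂ,
    p = SymmetricAlgebra.ι ℂ (Cx V₀) v - algebraMap ℂ _ c}

/-- The localization `𝓞(J)` of `S(V)`. -/
abbrev OJ : Type _ := Localization (denoms J)

/-- The inclusion `V → 𝓞(J)`. -/
def toOJ : Cx V₀ →ₗ[ℂ] OJ J :=
  (IsScalarTower.toAlgHom ℂ (SV V₀) (OJ J)).toLinearMap ∘ₗ SymmetricAlgebra.ι ℂ (Cx V₀)

/-- The parabolic subalgebra `ℍ_J` of the graded Hecke algebra, generated by `V` and the `t_w`,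
`w ∈ W_J`; it is again a graded Hecke algebra, for `W_J` acting on `V`, and is given here by its
own presentation, together with the map `incl` to `ℍ`. -/
abbrev HJ : Type _ := HeckeAlg k J (SV V₀) (SymmetricAlgebra.ι ℂ (Cx V₀))

/-- The graded Hecke algebra `ℍ`. -/
abbrev HH : Type _ := HJ k Set.univ

/-- The algebra `𝓗_J = ℍ_J ⊗_{S(V)} 𝓞(J)`, that is `ℍ_J` with the scalars `S(V)` extended to
`𝓞(J)`: it is generated by `ℂ[W_J]` and `𝓞(J)`, subject to the relations of `ℍ_J`. -/
abbrev RatHJ : Type _ := HeckeAlg k J (OJ J) (toOJ J)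

/-- The inclusion `ℍ_J → ℍ`. -/
def incl : HJ k J →ₐ[ℂ] HH k :=
  HeckeAlg.lift (HeckeAlg.t.comp (Subgroup.inclusion (weyl_mono b (Set.subset_univ J))))
    HeckeAlg.f fun α _ v => HeckeAlg.cross (Set.mem_univ α) v

/-- The natural map `ℍ_J → 𝓗_J`. -/
def loc : HJ k J →ₐ[ℂ] RatHJ k J :=
  HeckeAlg.lift HeckeAlg.t (HeckeAlg.f.comp (IsScalarTower.toAlgHom ℂ (SV V₀) (OJ J)))
    fun _ hα v => HeckeAlg.cross hα v

/-! ### Transport of structure along an element of `W` mapping `J` onto `J'` -/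

variable {J} {J' : Set b.support} {w : V₀ ≃ₗ[ℝ] V₀}

/-- Conjugation `x ↦ w⁻¹ x w` from `W_{J'}` to `W_J`. -/
def conjHom (h : MapsOnto b w J J') : weyl b J' →* weyl b J :=
  ((MulAut.conj w⁻¹).toMonoidHom.comp (weyl b J').subtype).codRestrict (weyl b J) (by
    rintro ⟨x, hx⟩
    have hle : weyl b J' ≤ (weyl b J).comap (MulAut.conj w⁻¹).toMonoidHom := by
      refine (Subgroup.closure_le _).2 ?_
      rintro _ ⟨β, hβ, rfl⟩
      obtain ⟨α, hα, hαβ⟩ := h.exists_left β hβ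
      have h1 := reflection_conj b h.mem hαβ
      have h2 : (MulAut.conj w⁻¹).toMonoidHom (P.reflection β) = P.reflection α := by
        simp [h1, mul_assoc]
      simp only [SetLike.mem_coe, Subgroup.mem_comap, h2]
      exact refl_mem b hα
    exact hle hx)

lemma cxMap_inv_left (w : V₀ ≃ₗ[ℝ] V₀) (v : Cx V₀) : cxMap w⁻¹ (cxMap w v) = v := by
  rw [← cxMap_mul, inv_mul_cancel]
  induction v using TensorProduct.induction_on with
  | zero => simp
  | tmul c x => rfl
  | add x y hx hy => rw [map_add, hx, hy]

lemma cxMap_inv_right (w : V₀ ≃ₗ[ℝ] V₀) (v : Cx V₀) : cxMap w (cxMap w⁻¹ v) = v := by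
  simpa using cxMap_inv_left w⁻¹ v

lemma cxMap_refl_conj {α β : b.support} (hw : w ∈ weyl b Set.univ)
    (hαβ : w (P.root α) = P.root β) (v : Cx V₀) :
    cxMap w⁻¹ (cxMap (P.reflection β) v) = cxMap (P.reflection α) (cxMap w⁻¹ v) := by
  rw [reflection_conj b hw hαβ, ← cxMap_mul, ← cxMap_mul]
  congr 2
  group

lemma cxRoot_ne_zero (i : ι) : cxRoot P i ≠ 0 := by
  intro h
  have h1 := congrArg (cxCoroot P i) h
  rw [map_zero, cxCoroot, cxRoot, Module.Dual.baseChange_apply_tmul] at h1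
  simp at h1

lemma cxCoroot_conj {α β : b.support} (hw : w ∈ weyl b Set.univ)
    (hαβ : w (P.root α) = P.root β) (v : Cx V₀) :
    cxCoroot P α (cxMap w⁻¹ v) = cxCoroot P β v := by
  have h1 := cxMap_refl_conj hw hαβ v
  have h2 : cxMap w⁻¹ (cxRoot P β) = cxRoot P α := by
    have : cxRoot P β = cxMap w (cxRoot P α) := by simp [cxRoot, hαβ]
    rw [this, cxMap_inv_left]
  rw [cxMap_reflection, cxMap_reflection, map_sub, map_smul, h2] at h1
  exact (smul_left_injective ℂ (cxRoot_ne_zero (P := P) α) (sub_right_injective h1)).symm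

/-- The map `HeckeAlg` for `J'` `→` `HeckeAlg` for `J` with `t_x ↦ t_{w⁻¹ x w}` and which is `g`,
an extension of `v ↦ w⁻¹(v)`, on the commutative part. -/
def twist {O O' : Type*} [CommRing O] [Algebra ℂ O] [CommRing O'] [Algebra ℂ O']
    {j : Cx V₀ →ₗ[ℂ] O} {j' : Cx V₀ →ₗ[ℂ] O'} (h : MapsOnto b w J J') (g : O' →ₐ[ℂ] O)
    (hg : ∀ v, g (j' v) = j (cxMap w⁻¹ v)) : HeckeAlg k J' O' j' →ₐ[ℂ] HeckeAlg k J O j :=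
  HeckeAlg.lift (HeckeAlg.t.comp (conjHom h)) (HeckeAlg.f.comp g) (by
    intro β hβ v
    obtain ⟨α, hα, hαβ⟩ := h.exists_left β hβ
    have h1 : conjHom h (sRefl hβ) = sRefl hα := by
      apply Subtype.ext
      change w⁻¹ * P.reflection β * w⁻¹⁻¹ = P.reflection α
      rw [reflection_conj b h.mem hαβ]; group
    have h2 := HeckeAlg.cross (k := k) (O := O) (j := j) hα (cxMap w⁻¹ v)
    rw [cxCoroot_conj h.mem hαβ, k.eq_of_conj α β w h.mem hαβ] at h2
    simp only [MonoidHom.comp_apply, AlgHom.comp_apply, h1, hg]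
    rw [cxMap_refl_conj h.mem hαβ]
    exact h2)

/-- The automorphism of `S(V)` extending `v ↦ w⁻¹(v)`. -/
def symInv (w : V₀ ≃ₗ[ℝ] V₀) : SV V₀ →ₐ[ℂ] SV V₀ :=
  SymmetricAlgebra.lift (SymmetricAlgebra.ι ℂ (Cx V₀) ∘ₗ cxMap w⁻¹)

lemma symInv_ι (v : Cx V₀) : symInv w (SymmetricAlgebra.ι ℂ (Cx V₀) v) =
    SymmetricAlgebra.ι ℂ (Cx V₀) (cxMap w⁻¹ v) := by
  simp [symInv]

lemma symInv_denoms (h : MapsOnto b w J J') (p : denoms J') : symInv w p ∈ denoms J := by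
  have hle : denoms J' ≤ (denoms J).comap (symInv w) := by
    refine Submonoid.closure_le.2 ?_
    rintro _ ⟨v, hv, c, rfl⟩
    refine Submonoid.subset_closure ⟨cxMap w⁻¹ v, fun hc => hv ?_, c, ?_⟩
    · have hmap : VJ J ≤ (VJ J').comap (cxMap w) := by
        refine Submodule.span_le.2 ?_
        rintro _ ⟨α, hα, rfl⟩
        obtain ⟨β, hβ, hαβ⟩ := h.exists_right α hα
        refine Submodule.subset_span ⟨β, hβ, ?_⟩
        simp [cxRoot, hαβ]
      have := hmap hc
      rwa [Submodule.mem_comap, cxMap_inv_right] at this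
    · rw [map_sub, AlgHom.commutes, symInv_ι]
  exact hle p.2

/-- The map `𝓞(J') → 𝓞(J)` extending `v ↦ w⁻¹(v)`. -/
def ratInv (h : MapsOnto b w J J') : OJ J' →ₐ[ℂ] OJ J :=
  IsLocalization.liftAlgHom (M := denoms J')
    (f := (IsScalarTower.toAlgHom ℂ (SV V₀) (OJ J)).comp (symInv w))
    fun p => IsLocalization.map_units (OJ J) (⟨symInv w p, symInv_denoms h p⟩ : denoms J)

/-- The inverse of the algebra isomorphism `w : ℍ_J → ℍ_{J'}`, `t_x ↦ t_{w x w⁻¹}`, `v ↦ w(v)`. -/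
def twistInv (h : MapsOnto b w J J') : HJ k J' →ₐ[ℂ] HJ k J :=
  twist k h (symInv w) symInv_ι

/-- The extension of `twistInv` to `𝓗_{J'} → 𝓗_J`. -/
def ratTwistInv (h : MapsOnto b w J J') : RatHJ k J' →ₐ[ℂ] RatHJ k J :=
  twist k h (ratInv h) (by
    intro v
    change IsLocalization.lift _ (algebraMap (SV V₀) (OJ J') _) = _
    refine (IsLocalization.lift_eq (M := denoms J') _ _).trans ?_
    change algebraMap (SV V₀) (OJ J) (symInv w _) = _
    rw [symInv_ι]
    rfl)

end Algebras

/-! ## Tensor products over noncommutative algebras and induced modules -/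

section Tensor

variable (H M N : Type*) {A : Type*} [Ring H] [Algebra ℂ H] [AddCommGroup M] [Module ℂ M]
  [Module H M] [IsScalarTower ℂ H M] [AddCommGroup N] [Module ℂ N]

/-- The `H`-submodule of `M ⊗_ℂ N` generated by all `m a ⊗ n - m ⊗ a n`; here `M` is a left
`H`-module on which `A` acts from the right by the `H`-linear maps `r a`, and `A` acts on `N` from
the left by the linear maps `l a`. -/
def balRel (r : A → M →ₗ[H] M) (l : A → N →ₗ[ℂ] N) : Submodule H (M ⊗[ℂ] N) :=
  Submodule.span H {x | ∃ (m : M) (a : A) (n : N), x = r a m ⊗ₜ n - m ⊗ₜ l a n}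

/-- The left `H`-module `M ⊗_A N`. -/
abbrev BalTensor (r : A → M →ₗ[H] M) (l : A → N →ₗ[ℂ] N) : Type _ := (M ⊗[ℂ] N) ⧸ balRel H M N r l

variable {H M N}

/-- The pure tensor `m ⊗ n` in `M ⊗_A N`. -/
def ptmul (r : A → M →ₗ[H] M) (l : A → N →ₗ[ℂ] N) (m : M) (n : N) : BalTensor H M N r l :=
  (balRel H M N r l).mkQ (m ⊗ₜ n)

/-- A linear endomorphism of `N` commuting with `A` induces an endomorphism of `M ⊗_A N`. -/
def balMap (r : A → M →ₗ[H] M) (l : A → N →ₗ[ℂ] N) (g : N →ₗ[ℂ] N)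
    (hg : ∀ a n, g (l a n) = l a (g n)) : BalTensor H M N r l →ₗ[H] BalTensor H M N r l :=
  (balRel H M N r l).mapQ (balRel H M N r l)
    (TensorProduct.AlgebraTensorModule.map (LinearMap.id : M →ₗ[H] M) g) (by
      refine Submodule.span_le.2 ?_
      rintro _ ⟨m, a, n, rfl⟩
      refine Submodule.subset_span ⟨m, a, g n, ?_⟩
      rw [map_sub, AlgebraTensorModule.map_tmul, AlgebraTensorModule.map_tmul, hg]
      rfl)

end Tensor

section Induced

variable {ι V₀ N : Type*} [AddCommGroup V₀] [Module ℝ V₀] [AddCommGroup N] [Module ℝ N]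
  {P : RootPairing ι ℝ V₀ N} {b : SimpleRoots P} (k : Param b) (J : Set b.support)
  {U Ua : Type*} [AddCommGroup U] [Module ℂ U] [AddCommGroup Ua] [Module ℂ Ua]

/-- The right action of `ℍ_J` on `ℍ`. -/
def rightH (a : HJ k J) : HH k →ₗ[HH k] HH k := LinearMap.toSpanSingleton _ _ (incl k J a)

variable {k J} in
/-- The induced module `I(J, U) = ℍ ⊗_{ℍ_J} U`. -/
abbrev Ind (ρ : HJ k J →ₐ[ℂ] Module.End ℂ U) : Type _ :=
  BalTensor (HH k) (HH k) U (rightH k J) ρ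

variable {k J} in
/-- The element `h ⊗ u` of `I(J, U)`. -/
abbrev Ind.tmul (ρ : HJ k J →ₐ[ℂ] Module.End ℂ U) (h : HH k) (u : U) : Ind ρ :=
  ptmul (rightH k J) (fun a => ρ a) h u

/-- The `(ℍ, 𝓗_J)`-bimodule `𝓗^J = ℍ ⊗_{ℍ_J} 𝓗_J`. -/
abbrev RatUp : Type _ :=
  BalTensor (HH k) (HH k) (RatHJ k J) (rightH k J) (fun a => LinearMap.mulLeft ℂ (loc k J a))

/-- The right action of `𝓗_J` on `𝓗^J`. -/
def rightRat (x : RatHJ k J) : RatUp k J →ₗ[HH k] RatUp k J :=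
  balMap _ _ (LinearMap.mulRight ℂ x) fun _ _ => by simp [mul_assoc]

/-- The element `h ⊗ x` of `𝓗^J`. -/
def RatUp.tmul (h : HH k) (x : RatHJ k J) : RatUp k J :=
  ptmul (rightH k J) (fun a => LinearMap.mulLeft ℂ (loc k J a)) h x

variable {k J} in
/-- The `ℍ`-module `𝓗^J ⊗_{𝓗_J} U_a`. -/
abbrev RatInd (ρa : RatHJ k J →ₐ[ℂ] Module.End ℂ Ua) : Type _ :=
  BalTensor (HH k) (RatUp k J) Ua (rightRat k J) ρa

variable {k J} in
/-- The element `x ⊗ y` of `𝓗^J ⊗_{𝓗_J} U_a`. -/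
abbrev RatInd.tmul (ρa : RatHJ k J →ₐ[ℂ] Module.End ℂ Ua) (x : RatUp k J) (y : Ua) : RatInd ρa :=
  ptmul (rightRat k J) (fun a => ρa a) x y

/-! ### The normalized intertwining element -/

/-- `(t_{s_{α_r}} α_r - k_{α_r}) ⋯ (t_{s_{α_1}} α_1 - k_{α_1}) ∈ ℍ` for a word
`[α_r, …, α_1]`. -/
def tauTilde (l : List b.support) : HH k :=
  (l.map fun α : b.support => (HeckeAlg.t (sRefl (Set.mem_univ α)) *
    HeckeAlg.f (SymmetricAlgebra.ι ℂ (Cx V₀) (cxRoot P α)) - algebraMap ℂ _ (k.val α))).prod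

/-- The element `∏_{α ∈ R(w)} α⁻¹` of `𝓞(J)`; for `w ∈ W^J` every `α ∈ R(w)` lies outside `V_J`,
so that it is invertible in `𝓞(J)`. -/
def invProd (w : V₀ ≃ₗ[ℝ] V₀) : OJ J :=
  ∏ᶠ i ∈ inversions b w, Ring.inverse (toOJ J (cxRoot P i))

/-- The intertwining element `τ_w = τ̃_w ∏_{α ∈ R(w)} α⁻¹ ∈ 𝓗^J`, where `w` is the product of the
word `l`. -/
def tau (l : List b.support) : RatUp k J :=
  RatUp.tmul k J (tauTilde k l) (HeckeAlg.f (invProd J (wordProd b l)))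

end Induced

/-! ## The deformation `U_a` -/

/-- The field of rational functions `ℂ(a_i : i ∈ m)`. -/
abbrev RatFun (m : Type*) : Type _ := FractionRing (MvPolynomial m ℂ)

section Hol

variable (m : Type*)

/-- Polynomials not vanishing at `a = 0`. -/
def nonvan : Submonoid (MvPolynomial m ℂ) :=
  (nonZeroDivisors ℂ).comap (MvPolynomial.constantCoeff (σ := m) (R := ℂ))

/-- The ring of rational functions `p / q` with `q(0) ≠ 0`, i.e. holomorphic at `a = 0`. -/
abbrev Hol : Type _ := Localization (nonvan m)

/-- The inclusion of the functions holomorphic at `0` in the rational functions. -/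
def holToRat : Hol m →ₐ[ℂ] RatFun m :=
  IsLocalization.liftAlgHom (M := nonvan m)
    (f := IsScalarTower.toAlgHom ℂ (MvPolynomial m ℂ) (RatFun m)) (by
      intro p
      refine IsUnit.mk0 _ fun h => ?_
      have h0 : (p : MvPolynomial m ℂ) = 0 :=
        (FaithfulSMul.algebraMap_injective (MvPolynomial m ℂ) (RatFun m)) (by simpa using h)
      have h1 : MvPolynomial.constantCoeff (p : MvPolynomial m ℂ) ∈ nonZeroDivisors ℂ := p.2
      rw [h0, map_zero] at h1
      exact zero_notMem_nonZeroDivisors h1)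

/-- Evaluation at `a = 0`. -/
def evalZero : Hol m →ₐ[ℂ] ℂ :=
  IsLocalization.liftAlgHom (M := nonvan m)
    (f := MvPolynomial.aeval (fun _ : m => (0 : ℂ))) (by
      intro p
      have h1 : MvPolynomial.constantCoeff (p : MvPolynomial m ℂ) ∈ nonZeroDivisors ℂ := p.2
      have h2 : MvPolynomial.aeval (fun _ : m => (0 : ℂ)) (p : MvPolynomial m ℂ) =
          MvPolynomial.constantCoeff (p : MvPolynomial m ℂ) := by
        rw [MvPolynomial.aeval_zero']; rfl
      rw [h2]
      exact IsUnit.mk0 _ (nonZeroDivisors.ne_zero h1))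

end Hol

section Deform

variable {ι V₀ N : Type*} [AddCommGroup V₀] [Module ℝ V₀] [AddCommGroup N] [Module ℝ N]
  {P : RootPairing ι ℝ V₀ N} {b : SimpleRoots P} {k : Param b} {J : Set b.support}
  {U : Type*} [AddCommGroup U] [Module ℂ U]
  {m : Type*} [Fintype m]

/-- The subspace `V_J^{∨,⊥}` of functionals on `V` vanishing on `V_J`. -/
abbrev VJPerp (J : Set b.support) : Submodule ℂ (Module.Dual ℂ (Cx V₀)) := (VJ J).dualAnnihilator

/-- The linear map `η_a = ∑ a_i ω_i^∨ : V → ℂ(a)`, for a basis `ω^∨` of `V_J^{∨,⊥}`. -/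
def eta (ω : Module.Basis m ℂ (VJPerp J)) : Cx V₀ →ₗ[ℂ] RatFun m :=
  ∑ i, (LinearMap.toSpanSingleton ℂ (RatFun m)
    (algebraMap (MvPolynomial m ℂ) (RatFun m) (MvPolynomial.X i))) ∘ₗ
      ((ω i : Module.Dual ℂ (Cx V₀)))

lemma eta_apply (ω : Module.Basis m ℂ (VJPerp J)) (v : Cx V₀) : eta ω v =
    algebraMap (MvPolynomial m ℂ) (RatFun m)
      (∑ i, (ω i : Module.Dual ℂ (Cx V₀)) v • MvPolynomial.X i) := by
  simp [eta, Algebra.smul_def, IsScalarTower.algebraMap_apply ℂ (MvPolynomial m ℂ) (RatFun m)]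

lemma eta_reflection (ω : Module.Basis m ℂ (VJPerp J)) {α : b.support} (hα : α ∈ J) (v : Cx V₀) :
    eta ω (cxMap (P.reflection α) v) = eta ω v := by
  have h : ∀ i, (ω i : Module.Dual ℂ (Cx V₀)) (cxRoot P α) = 0 := fun i =>
    (Submodule.mem_dualAnnihilator _).1 (ω i).2 _ (Submodule.subset_span ⟨α, hα, rfl⟩)
  simp [eta_apply, cxMap_reflection, h]

/-- A non-zero form `η_a(v) - c` is not algebraic over `ℂ`. -/
lemma not_isAlgebraic_eta (ω : Module.Basis m ℂ (VJPerp J)) {v : Cx V₀} (hv : v ∉ VJ J) (c : ℂ) :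
    ¬ IsAlgebraic ℂ (algebraMap ℂ (RatFun m) c - eta ω v) := by
  intro h
  have h2 : IsAlgebraic ℂ (eta ω v) := by
    simpa using (isAlgebraic_algebraMap (R := ℂ) (A := RatFun m) c).sub h
  rw [eta_apply, isAlgebraic_algebraMap_iff (FaithfulSMul.algebraMap_injective _ _)] at h2
  have hex : ∃ i, (ω i : Module.Dual ℂ (Cx V₀)) v ≠ 0 := by
    by_contra! hc
    refine hv ((Subspace.forall_mem_dualAnnihilator_apply_eq_zero_iff _ v).1 fun γ hγ => ?_)
    have h3 : γ = ∑ i, ω.repr ⟨γ, hγ⟩ i • (ω i : Module.Dual ℂ (Cx V₀)) := by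
      have h4 := congrArg (VJPerp J).subtype (ω.sum_repr ⟨γ, hγ⟩)
      rw [map_sum] at h4
      exact h4.symm
    rw [h3]
    simp [hc]
  obtain ⟨i, hi⟩ := hex
  classical
  have h3 := h2.algHom (MvPolynomial.aeval (fun l : m => if l = i then (Polynomial.X : Polynomial ℂ) else 0))
  have h4 : MvPolynomial.aeval (fun l : m => if l = i then (Polynomial.X : Polynomial ℂ) else 0)
      (∑ i, (ω i : Module.Dual ℂ (Cx V₀)) v • (MvPolynomial.X i : MvPolynomial m ℂ)) =
      (ω i : Module.Dual ℂ (Cx V₀)) v • (Polynomial.X : Polynomial ℂ) := by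
    rw [map_sum, Finset.sum_eq_single i]
    · simp
    · intro l _ hl
      simp [hl]
    · simp
  rw [h4] at h3
  have h5 := h3.smul ((ω i : Module.Dual ℂ (Cx V₀)) v)⁻¹
  rw [smul_smul, inv_mul_cancel₀ hi, one_smul] at h5
  exact Polynomial.transcendental_X ℂ h5

/-- The action of `ℂ(a) ⊗ S(V)` on `ℂ(a) ⊗ U`. -/
def scalarAct (m : Type*) (ρ : HJ k J →ₐ[ℂ] Module.End ℂ U) :
    RatFun m ⊗[ℂ] SV V₀ →ₐ[RatFun m] Module.End (RatFun m) (RatFun m ⊗[ℂ] U) :=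
  Algebra.TensorProduct.lift (Algebra.ofId (RatFun m) (Module.End (RatFun m) (RatFun m ⊗[ℂ] U)))
    ((Module.End.baseChangeHom ℂ (RatFun m) U).comp (ρ.comp HeckeAlg.f))
    (fun x _ => Algebra.commutes x _)

lemma scalarAct_tmul (m : Type*) (ρ : HJ k J →ₐ[ℂ] Module.End ℂ U) (c : RatFun m) (p : SV V₀) :
    scalarAct m ρ (c ⊗ₜ p) = algebraMap (RatFun m) _ c *
      Module.End.baseChangeHom ℂ (RatFun m) U (ρ (HeckeAlg.f p)) :=
  Algebra.TensorProduct.lift_tmul _ _ _ _ _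

/-- The linear map `v ↦ 1 ⊗ v + η_a(v) ⊗ 1` from `V` to `ℂ(a) ⊗ S(V)`. -/
def shift (ω : Module.Basis m ℂ (VJPerp J)) : Cx V₀ →ₗ[ℂ] RatFun m ⊗[ℂ] SV V₀ :=
  (Algebra.TensorProduct.includeRight :
      SV V₀ →ₐ[ℂ] RatFun m ⊗[ℂ] SV V₀).toLinearMap ∘ₗ SymmetricAlgebra.ι ℂ (Cx V₀) +
    (Algebra.TensorProduct.includeLeft :
      RatFun m →ₐ[ℂ] RatFun m ⊗[ℂ] SV V₀).toLinearMap ∘ₗ eta ω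

lemma shift_apply (ω : Module.Basis m ℂ (VJPerp J)) (v : Cx V₀) :
    shift ω v = 1 ⊗ₜ SymmetricAlgebra.ι ℂ (Cx V₀) v + eta ω v ⊗ₜ 1 := rfl

/-- The action of `S(V)` on `U_a = ℂ(a) ⊗ U`: `v` acts by `1 ⊗ v + η_a(v)`. -/
def symAct (ω : Module.Basis m ℂ (VJPerp J)) (ρ : HJ k J →ₐ[ℂ] Module.End ℂ U) :
    SV V₀ →ₐ[ℂ] Module.End (RatFun m) (RatFun m ⊗[ℂ] U) :=
  ((scalarAct m ρ).restrictScalars ℂ).comp (SymmetricAlgebra.lift (shift ω))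

lemma symAct_ι (ω : Module.Basis m ℂ (VJPerp J)) (ρ : HJ k J →ₐ[ℂ] Module.End ℂ U) (v : Cx V₀) :
    symAct ω ρ (SymmetricAlgebra.ι ℂ (Cx V₀) v) =
      Module.End.baseChangeHom ℂ (RatFun m) U (ρ (HeckeAlg.f (SymmetricAlgebra.ι ℂ (Cx V₀) v))) +
        algebraMap (RatFun m) _ (eta ω v) := by
  rw [symAct, AlgHom.comp_apply, SymmetricAlgebra.lift_ι_apply, shift_apply, map_add]
  refine congrArg₂ _ ((scalarAct_tmul m ρ _ _).trans ?_) ((scalarAct_tmul m ρ _ _).trans ?_)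
  · rw [map_one, one_mul]
  · rw [map_one, map_one, map_one, mul_one]

variable [Module.Finite ℂ U]

lemma isUnit_symAct (ω : Module.Basis m ℂ (VJPerp J)) (ρ : HJ k J →ₐ[ℂ] Module.End ℂ U)
    (p : denoms J) : IsUnit (symAct ω ρ p) := by
  obtain ⟨p, hp⟩ := p
  induction hp using Submonoid.closure_induction with
  | one => simp
  | mul x y _ _ hx hy => rw [map_mul]; exact hx.mul hy
  | mem x hx =>
    obtain ⟨v, hv, c, rfl⟩ := hx
    change IsUnit (symAct ω ρ (SymmetricAlgebra.ι ℂ (Cx V₀) v - algebraMap ℂ _ c))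
    rw [map_sub, symAct_ι, AlgHom.commutes]
    set F := ρ (HeckeAlg.f (SymmetricAlgebra.ι ℂ (Cx V₀) v))
    set G := Module.End.baseChangeHom ℂ (RatFun m) U F with hG
    rw [LinearMap.isUnit_iff_ker_eq_bot, LinearMap.ker_eq_bot']
    intro x hx
    by_contra hx0
    have h2 : Module.End.HasEigenvector G (algebraMap ℂ (RatFun m) c - eta ω v) x := by
      refine ⟨Module.End.mem_eigenspace_iff.2 ?_, hx0⟩
      have h1 : G x + eta ω v • x - algebraMap ℂ (RatFun m) c • x = 0 := by
        rw [algebraMap_smul]; exact hx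
      rw [sub_smul, ← sub_eq_zero, ← h1]
      abel
    refine not_isAlgebraic_eta ω hv c
      ⟨minpoly ℂ F, minpoly.ne_zero (Algebra.IsIntegral.isIntegral F), ?_⟩
    have h3 := Module.End.aeval_apply_of_hasEigenvector
      (p := (minpoly ℂ F).map (algebraMap ℂ (RatFun m))) h2
    rw [Polynomial.aeval_map_algebraMap, Polynomial.eval_map_algebraMap] at h3
    have h4 : Polynomial.aeval G (minpoly ℂ F) = 0 := by
      rw [hG, Polynomial.aeval_algHom_apply, minpoly.aeval, map_zero]
    rw [h4, LinearMap.zero_apply] at h3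
    exact (smul_eq_zero.1 h3.symm).resolve_right hx0

/-- The action of `𝓞(J)` on `U_a`. -/
def ratAct (ω : Module.Basis m ℂ (VJPerp J)) (ρ : HJ k J →ₐ[ℂ] Module.End ℂ U) :
    OJ J →ₐ[ℂ] Module.End (RatFun m) (RatFun m ⊗[ℂ] U) :=
  { OreLocalization.universalHom (symAct ω ρ : SV V₀ →+* _)
      (IsUnit.liftRight ((symAct ω ρ : SV V₀ →* _).comp (denoms J).subtype) (isUnit_symAct ω ρ))
      (fun _ => rfl) with
    commutes' := fun c => by
      rw [IsScalarTower.algebraMap_apply ℂ (SV V₀) (OJ J)]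
      refine (OreLocalization.universalHom_commutes _ _ _).trans ?_
      exact AlgHom.commutes (symAct ω ρ) c }

lemma ratAct_algebraMap (ω : Module.Basis m ℂ (VJPerp J)) (ρ : HJ k J →ₐ[ℂ] Module.End ℂ U)
    (p : SV V₀) : ratAct ω ρ (algebraMap (SV V₀) (OJ J) p) = symAct ω ρ p :=
  OreLocalization.universalHom_commutes _ _ _

/-- The `𝓗_J`-module `U_a = ℂ(a) ⊗ U`: `t_w` acts by `1 ⊗ t_w` and `v ∈ V` by
`1 ⊗ v + η_a(v)`. -/
def deform (ω : Module.Basis m ℂ (VJPerp J)) (ρ : HJ k J →ₐ[ℂ] Module.End ℂ U) :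
    RatHJ k J →ₐ[ℂ] Module.End (RatFun m) (RatFun m ⊗[ℂ] U) :=
  HeckeAlg.lift (k := k) (j := toOJ J) (B := Module.End (RatFun m) (RatFun m ⊗[ℂ] U))
    (((Module.End.baseChangeHom ℂ (RatFun m) U : Module.End ℂ U →* _).comp
      (ρ : HJ k J →* _)).comp HeckeAlg.t) (ratAct ω ρ) (by
    intro α hα v
    have h := congrArg (fun x => Module.End.baseChangeHom ℂ (RatFun m) U (ρ x))
      (HeckeAlg.cross (k := k) (j := SymmetricAlgebra.ι ℂ (Cx V₀)) hα v)
    simp only [map_sub, map_mul, AlgHom.commutes] at h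
    have hv : ∀ v, ratAct ω ρ (toOJ J v) = symAct ω ρ (SymmetricAlgebra.ι ℂ (Cx V₀) v) :=
      fun v => ratAct_algebraMap ω ρ _
    rw [hv, hv, symAct_ι, symAct_ι, eta_reflection ω hα, map_mul, ← h]
    simp only [MonoidHom.comp_apply, MonoidHom.coe_coe]
    rw [mul_add, add_mul, Algebra.commutes (eta ω v)]
    abel)

/-- `U_a` as a complex representation of `𝓗_J`. -/
def deformC (ω : Module.Basis m ℂ (VJPerp J)) (ρ : HJ k J →ₐ[ℂ] Module.End ℂ U) :
    RatHJ k J →ₐ[ℂ] Module.End ℂ (RatFun m ⊗[ℂ] U) :=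
  AlgHom.comp
    { toFun := fun g => LinearMap.restrictScalars ℂ g
      map_one' := rfl
      map_mul' := fun _ _ => rfl
      map_zero' := rfl
      map_add' := fun _ _ => rfl
      commutes' := fun _ => rfl } (deform ω ρ)

end Deform

/-! ## Holomorphic elements and specialization at `a = 0` -/

section Holomorphic

variable {ι V₀ N : Type*} [AddCommGroup V₀] [Module ℝ V₀] [AddCommGroup N] [Module ℝ N]
  {P : RootPairing ι ℝ V₀ N} {b : SimpleRoots P} {k : Param b} {J : Set b.support}
  {U : Type*} [AddCommGroup U] [Module ℂ U] {m : Type*}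

/-- `t_w ∈ ℍ` for `w ∈ W^J`. -/
def tRep (w : minReps b J) : HH k := HeckeAlg.t ⟨w, w.2.1⟩

/-- The sum `∑_{w ∈ W^J} t_w ⊗ y_w` in `𝓗^J ⊗_{𝓗_J} (ℂ(a) ⊗ U)`, where the `y_w` are
combinations of elements of `U` with coefficients in `ℂ(a)` holomorphic at `a = 0`. -/
def holSum (ρa : RatHJ k J →ₐ[ℂ] Module.End ℂ (RatFun m ⊗[ℂ] U))
    (y : minReps b J →₀ Hol m ⊗[ℂ] U) : RatInd ρa :=
  y.sum fun w z => RatInd.tmul ρa (RatUp.tmul k J (tRep w) 1)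
    (TensorProduct.map (holToRat m).toLinearMap LinearMap.id z)

/-- The value `∑_{w ∈ W^J} t_w ⊗ y_w(0)` of such a sum at `a = 0`, an element of `ℍ ⊗_{ℍ_J} U`. -/
def zeroSum (ρ : HJ k J →ₐ[ℂ] Module.End ℂ U) (y : minReps b J →₀ Hol m ⊗[ℂ] U) : Ind ρ :=
  y.sum fun w z => Ind.tmul ρ (tRep w)
    (TensorProduct.lid ℂ U (TensorProduct.map (evalZero m).toLinearMap LinearMap.id z))

/-- An element of `𝓗^J ⊗_{𝓗_J} (ℂ(a) ⊗ U)` is holomorphic (at `a = 0`) if it can be written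
`∑_{w ∈ W^J} t_w ⊗ y_w` with coefficients holomorphic at `a = 0`. -/
def IsHolomorphic (ρa : RatHJ k J →ₐ[ℂ] Module.End ℂ (RatFun m ⊗[ℂ] U)) (x : RatInd ρa) : Prop :=
  ∃ y : minReps b J →₀ Hol m ⊗[ℂ] U, x = holSum ρa y

open Classical in
/-- The specialization `x|_{a = 0} ∈ ℍ ⊗_{ℍ_J} U` of a holomorphic element `x` (and `0` for other
`x`). -/
def atZero (ρ : HJ k J →ₐ[ℂ] Module.End ℂ U)
    (ρa : RatHJ k J →ₐ[ℂ] Module.End ℂ (RatFun m ⊗[ℂ] U)) (x : RatInd ρa) : Ind ρ :=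
  if h : IsHolomorphic ρa x then zeroSum ρ h.choose else 0

end Holomorphic

/-! ## Tempered modules -/

section Tempered

variable {ι V₀ N : Type*} [AddCommGroup V₀] [Module ℝ V₀] [AddCommGroup N] [Module ℝ N]
  {P : RootPairing ι ℝ V₀ N} {b : SimpleRoots P} {k : Param b} {J : Set b.support}
  {U : Type*} [AddCommGroup U] [Module ℂ U]

/-- `γ ∈ V^∨` is a weight of `U`. -/
def IsWeight (ρ : HJ k J →ₐ[ℂ] Module.End ℂ U) (γ : Module.Dual ℂ (Cx V₀)) : Prop :=
  ∃ u : U, u ≠ 0 ∧ ∀ v : Cx V₀, ∃ r : ℕ, 0 < r ∧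
    ((ρ (HeckeAlg.f (SymmetricAlgebra.ι ℂ (Cx V₀) v)) - algebraMap ℂ _ (γ v)) ^ r) u = 0

/-- `U` is `ℍ_J`-tempered: for each weight `γ`,
`Re γ = ∑_{α ∈ J} a_α α^∨ + ∑_{α ∈ Π ∖ J} c_α ω_α^∨` with `a_α ≤ 0` and `c_α > 0`, where the
`ω_α^∨` are the fundamental coweights, i.e. the basis of `V₀^∨` dual to the simple roots. -/
def IsTempered (ρ : HJ k J →ₐ[ℂ] Module.End ℂ U) : Prop :=
  ∀ γ, IsWeight ρ γ → ∃ a c : b.support → ℝ, (∀ α, a α ≤ 0) ∧ (∀ α, 0 < c α) ∧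
    rePart γ = (∑ᶠ α ∈ J, a α • P.coroot' α) + ∑ᶠ α ∈ Jᶜ, c α • b.basis.coord α

/-- A subspace stable under the action of `ℍ_J`. -/
def IsStable (ρ : HJ k J →ₐ[ℂ] Module.End ℂ U) (p : Submodule ℂ U) : Prop :=
  ∀ h, ∀ u ∈ p, ρ h u ∈ p

/-- `U` is an irreducible `ℍ_J`-module. -/
def IsIrred (ρ : HJ k J →ₐ[ℂ] Module.End ℂ U) : Prop :=
  Nontrivial U ∧ ∀ p, IsStable ρ p → p = ⊥ ∨ p = ⊤

/-- `U` is an indecomposable `ℍ_J`-module. -/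
def IsIndec (ρ : HJ k J →ₐ[ℂ] Module.End ℂ U) : Prop :=
  Nontrivial U ∧ ∀ p q, IsStable ρ p → IsStable ρ q → IsCompl p q → p = ⊥ ∨ q = ⊥

end Tempered

/-! ## The intertwining maps -/

section Intertwining

variable {ι V₀ N : Type*} [Finite ι] [AddCommGroup V₀] [Module ℝ V₀] [AddCommGroup N] [Module ℝ N]
  {P : RootPairing ι ℝ V₀ N} [P.IsReduced] {b : SimpleRoots P} {k : Param b} {J : Set b.support}
  {U : Type*} [AddCommGroup U] [Module ℂ U]
  {m : Type*} [Fintype m]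

/-- The `ℍ_{θ(J)}`-module `φ(U)`: the space is `U`, and `h` acts by `φ⁻¹(h)`. -/
def phiRep (ρ : HJ k J →ₐ[ℂ] Module.End ℂ U) : HJ k (theta b J) →ₐ[ℂ] Module.End ℂ U :=
  ρ.comp (twistInv k (phi_mapsOnto b J))

variable [Module.Finite ℂ U]

/-- The `𝓗_{θ(J)}`-module `φ(U_a)`: the space is `U_a`, and `h` acts by `φ⁻¹(h)`. -/
def phiDeform (ω : Module.Basis m ℂ (VJPerp J)) (ρ : HJ k J →ₐ[ℂ] Module.End ℂ U) :
    RatHJ k (theta b J) →ₐ[ℂ] Module.End ℂ (RatFun m ⊗[ℂ] U) :=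
  (deformC ω ρ).comp (ratTwistInv k (phi_mapsOnto b J))

/-- The element `τ ⊗ φ(y)` of `𝓗^{θ(J)} ⊗ φ(U_a)`, for `y ∈ U_a` and `τ` given by the word `l`. -/
def tauTmul (ω : Module.Basis m ℂ (VJPerp J)) (ρ : HJ k J →ₐ[ℂ] Module.End ℂ U)
    (l : List b.support) (y : RatFun m ⊗[ℂ] U) : RatInd (phiDeform ω ρ) :=
  RatInd.tmul (phiDeform ω ρ) (tau k (theta b J) l) y

/-- The element `(τ ⊗ φ(u))|_{a = 0}` of `ℍ ⊗_{ℍ_{θ(J)}} φ(U)`, for `u ∈ U`. -/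
def tauZero (ω : Module.Basis m ℂ (VJPerp J)) (ρ : HJ k J →ₐ[ℂ] Module.End ℂ U)
    (l : List b.support) (u : U) : Ind (phiRep ρ) :=
  atZero (phiRep ρ) (phiDeform ω ρ) (tauTmul ω ρ l (1 ⊗ₜ[ℂ] u))

end Intertwining

end GradedHecke

end

open GradedHecke

/-!
The element `τ̃ = ∏ (t_{s_α} α - k_α)` of `ℍ`, the numerator of `τ`, intertwines the actions of `V` up
to the longest element `φ⁻¹` of `W^{θ(J)}` (`vec_mul_tauTilde`), and its leading coefficient is the
product of the roots that `φ⁻¹` makes negative (`tauTilde_sub_mem`), which is the denominator of `τ`.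
Hence `v (τ ⊗ φ(y)) = τ ⊗ φ(v y)` for `v ∈ V`, and the coordinate of `τ ⊗ φ(y)` at the longest element
of `W^{θ(J)}`, its *top coordinate*, is `y` (`indRep_vec_tauCoord`, `tauCoord_top`). The theorem holds
because, for tempered `U`, these two properties determine `τ ⊗ φ(y)`.

*Coordinates.* To speak of coordinates one needs that the `t_y ⊗ u`, `y ∈ W^J`, span an induced module
freely. Functions `W → E` carry an action of `ℍ` in which `V` acts by operators of Dunkl type
(`dunkl`, `dunkl_cross`, `dunkl_comm`), the module induced from `S(V)`; a quotient of it is an `ℍ`-module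
of functions `W^J → E` (`indRep`), and it is isomorphic to `ℍ ⊗_{ℍ_J} E` (`indEquiv`) and to
`𝓗^J ⊗_{𝓗_J} E` (`ratEquiv`). In it `V` acts triangularly with respect to the length, by `y⁻¹(v)` on the
diagonal entry at `y` (`indRep_vec_single`), while on the top coordinate of the module induced from
`φ(E)` all of `ℍ_J` acts as on `E` (`indRep_incl_top`).

*Separation of weights.* By Langlands' combinatorial lemma (`langlands`) a weight of a tempered
indecomposable `U` is never the image of a weight of `U` under a nontrivial element of `W^J`
(`IsTempered.weight_ne`); indecomposability enters in that all weights agree on the vectors of `V`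
fixed by `W_J`, which are central in `ℍ_J`.
So there is `v ∈ V` whose eigenvalues on `U` differ from those of `x⁻¹(v)` for all `1 ≠ x ∈ W^J`, and
with `v - x⁻¹(v) ∉ V_J` (`exists_generic`). The product `Q` of the characteristic polynomials of the
`x⁻¹(v)` (`annPoly`), on `U` or on a deformation of it, then annihilates all diagonal entries of `v`
on the module induced from `φ(E)` except that at the top, where it is invertible: on `U` and on the lattice of the elements of `U_a`
holomorphic at `a = 0` because the eigenvalues differ, on `U_a` because `η_a(v - x⁻¹(v))` is
transcendental (`isUnit_rep`, `isUnit_holRep`, `isUnit_ratRep`). Consequently a power of `Q(v)` kills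
every vector with zero top coordinate (`eq_zero_of_top_eq_zero`).

*Consequences.* For `s = s_α`, `α ∈ J`, the vector `t_s (τ ⊗ φ(y)) - τ ⊗ φ(t_s y)` has top coordinate
`0` and depends on `y` compatibly with `V`, up to `s`; since `Q(s(v))` is invertible on `U_a`, the vector
vanishes, and `y ↦ τ ⊗ φ(y)` is `ℍ_J`-linear (`indRep_incl_tauCoord`). For `y = Q(v)^N z` one has
`τ ⊗ φ(y) = Q(v)^N (t_w ⊗ φ(z))` with `w` the longest element, as the top coordinates of `τ ⊗ φ(z)` and
`t_w ⊗ φ(z)` agree; the right-hand side is holomorphic whenever `z` is, and `Q(v)` is invertible on the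
holomorphic elements, which gives holomorphy (`exists_integral_tauCoord`). The specialization at
`a = 0` inherits the linearity and the top coordinate `u`, hence is injective
(`exists_intertwining_specialize`).

The map of the induced modules is bijective because `τ̃` of the reversed word times `τ̃` is a product of
factors `k² - β²` with roots `β` outside `V_J`, which are invertible in the localization
(`tauTilde_reverse_mul`, `isUnit_sqProd`, `lift_bijective`).

Finally, let `U` be irreducible and `M` a proper submodule of `I(J, U)`. It does not meet `1 ⊗ U`, to
which a power of `Q(v)` maps `I(J, U)`; so that power kills `M`. As it is invertible on the top
coordinate of the target, the image of `M` has zero top coordinates; since every coordinate is the top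
coordinate of a translate, the image is zero. So the kernel of the specialized map is the largest proper
submodule (`le_ker_of_ne_top`).
-/

noncomputable section

namespace GradedHecke

/-! ### Lengths, minimal coset representatives and inversions -/

section WeylComb

set_option linter.unusedSectionVars false

variable {ι V₀ N : Type*} [AddCommGroup V₀] [Module ℝ V₀] [AddCommGroup N] [Module ℝ N]
  {P : RootPairing ι ℝ V₀ N} (b : SimpleRoots P)

/-- The vector `x` has nonnegative coordinates in the basis of simple roots; for a root this
says that the root is positive. -/
def PosVec (x : V₀) : Prop := ∀ α, 0 ≤ b.basis.repr x α

lemma PosVec.add {x y : V₀} (hx : PosVec b x) (hy : PosVec b y) : PosVec b (x + y) := fun α => by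
  rw [map_add, Finsupp.add_apply]; exact add_nonneg (hx α) (hy α)

lemma PosVec.smul {x : V₀} (hx : PosVec b x) {c : ℝ} (hc : 0 ≤ c) : PosVec b (c • x) := fun α => by
  rw [map_smul, Finsupp.smul_apply]; exact mul_nonneg hc (hx α)

lemma posVec_simple (α : b.support) : PosVec b (P.root α) := repr_root_nonneg b α

lemma PosVec.eq_zero {x : V₀} (h : PosVec b x) (h' : PosVec b (-x)) : x = 0 := by
  apply b.basis.repr.injective
  ext α
  have := h' α
  rw [map_neg, Finsupp.neg_apply] at this
  simpa using le_antisymm (by linarith) (h α)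

lemma posVec_or (i : ι) : PosVec b (P.root i) ∨ PosVec b (-P.root i) :=
  (b.nonneg_or_nonpos i).imp id fun h α => by simpa using h α

lemma not_posVec_neg {i : ι} (h : PosVec b (P.root i)) : ¬ PosVec b (-P.root i) :=
  fun h' => P.ne_zero i (h.eq_zero b h')

lemma posVec_neg_iff (i : ι) : PosVec b (-P.root i) ↔ ¬ PosVec b (P.root i) :=
  ⟨fun h h' => not_posVec_neg b h' h, (posVec_or b i).resolve_left⟩

lemma posVec_weyl_or {w : V₀ ≃ₗ[ℝ] V₀} (hw : w ∈ weyl b Set.univ) (i : ι) :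
    PosVec b (w (P.root i)) ∨ PosVec b (-w (P.root i)) := by
  obtain ⟨j, hj, -⟩ := weyl_root b hw i
  rw [hj]
  exact posVec_or b j

lemma not_posVec_weyl_neg {w : V₀ ≃ₗ[ℝ] V₀} {i : ι} (h : PosVec b (w (P.root i))) :
    ¬ PosVec b (-w (P.root i)) := fun h' =>
  P.ne_zero i (w.map_eq_zero_iff.1 (h.eq_zero b h'))

section
variable [Finite ι]

/-- A root is the sum of the simple roots with its coordinates as coefficients, after applying
a linear map. -/
lemma map_eq_sum [Fintype b.support] (f : V₀ →ₗ[ℝ] V₀) (x : V₀) :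
    f x = ∑ α, b.basis.repr x α • f (P.root α) := by
  conv_lhs => rw [← b.basis.sum_repr x]
  simp [b.basis_apply]

lemma PosVec.map (f : V₀ →ₗ[ℝ] V₀) {x : V₀} (hx : PosVec b x)
    (h : ∀ α, b.basis.repr x α ≠ 0 → PosVec b (f (P.root α))) : PosVec b (f x) := by
  have := Fintype.ofFinite b.support
  intro γ
  rw [map_eq_sum b f x, map_sum, Finsupp.finsetSum_apply]
  refine Finset.sum_nonneg fun α _ => ?_
  rw [map_smul, Finsupp.smul_apply]
  by_cases hα : b.basis.repr x α = 0
  · simp [hα]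
  · exact mul_nonneg (hx α) (h α hα γ)

end

lemma len_wordProd_le (l : List b.support) : len b (wordProd b l) ≤ l.length :=
  Nat.sInf_le ⟨l, rfl, rfl⟩

lemma wordProd_append (l l' : List b.support) :
    wordProd b (l ++ l') = wordProd b l * wordProd b l' := by simp [wordProd]

lemma wordProd_reverse (l : List b.support) : wordProd b l.reverse = (wordProd b l)⁻¹ := by
  induction l with
  | nil => simp [wordProd]
  | cons α l ih =>
    rw [List.reverse_cons, wordProd_append, ih, wordProd_cons b α l, mul_inv_rev,
      RootPairing.reflection_inv]
    simp [wordProd]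

lemma len_inv (w : V₀ ≃ₗ[ℝ] V₀) : len b w⁻¹ = len b w := by
  unfold len
  congr 1
  ext r
  constructor
  · rintro ⟨l, hl, h⟩
    exact ⟨l.reverse, by simpa using hl, by rw [wordProd_reverse, h, inv_inv]⟩
  · rintro ⟨l, hl, h⟩
    exact ⟨l.reverse, by simpa using hl, by rw [wordProd_reverse, h]⟩

lemma len_one : len b (1 : V₀ ≃ₗ[ℝ] V₀) = 0 :=
  Nat.le_zero.1 (len_wordProd_le b [])

lemma eq_one_of_len_eq_zero {w : V₀ ≃ₗ[ℝ] V₀} (hw : w ∈ weyl b Set.univ) (h : len b w = 0) :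
    w = 1 := by
  obtain ⟨l, hl, hl'⟩ := exists_reduced b hw
  rw [h, List.length_eq_zero_iff] at hl'
  rw [← hl, hl']
  rfl

lemma len_refl_mul_le {w : V₀ ≃ₗ[ℝ] V₀} (hw : w ∈ weyl b Set.univ) (α : b.support) :
    len b (P.reflection α * w) ≤ len b w + 1 := by
  obtain ⟨l, hl, hl'⟩ := exists_reduced b hw
  rw [← hl', ← hl, ← wordProd_cons]
  exact len_wordProd_le b (α :: l)

lemma refl_mul_refl (i : ι) : P.reflection i * P.reflection i = 1 := by
  rw [← sq, RootPairing.reflection_sq]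

variable [P.IsReduced]

lemma len_lt_mul_refl {w : V₀ ≃ₗ[ℝ] V₀} (hw : w ∈ weyl b Set.univ) {α : b.support}
    (h : PosVec b (w (P.root α))) : len b w < len b (w * P.reflection α) := by
  obtain ⟨j, hj, -⟩ := weyl_root b hw α
  exact len_lt b hw α ⟨j, by rw [hj] at h; exact h, hj⟩

lemma len_mul_refl_lt {w : V₀ ≃ₗ[ℝ] V₀} (hw : w ∈ weyl b Set.univ) {α : b.support}
    (h : PosVec b (-w (P.root α))) : len b (w * P.reflection α) < len b w := by
  have := len_lt_mul_refl b (mul_mem hw (refl_mem b (Set.mem_univ α))) (α := α) (by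
    rw [LinearEquiv.mul_apply, RootPairing.reflection_apply_self, map_neg]; exact h)
  rwa [mul_assoc, refl_mul_refl, mul_one] at this

lemma len_lt_refl_mul {w : V₀ ≃ₗ[ℝ] V₀} (hw : w ∈ weyl b Set.univ) {α : b.support}
    (h : PosVec b (w⁻¹ (P.root α))) : len b w < len b (P.reflection α * w) := by
  have := len_lt_mul_refl b (inv_mem hw) h
  rwa [len_inv, ← RootPairing.reflection_inv, ← mul_inv_rev, len_inv] at this

lemma len_refl_mul_lt {w : V₀ ≃ₗ[ℝ] V₀} (hw : w ∈ weyl b Set.univ) {α : b.support}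
    (h : PosVec b (-w⁻¹ (P.root α))) : len b (P.reflection α * w) < len b w := by
  have := len_mul_refl_lt b (inv_mem hw) h
  rwa [len_inv, ← RootPairing.reflection_inv, ← mul_inv_rev, len_inv] at this

/-- A nontrivial element of `W_J` makes some element of `J` negative. -/
lemma exists_descent {J : Set b.support} {x : V₀ ≃ₗ[ℝ] V₀} (hx : x ∈ weyl b J) (h1 : x ≠ 1) :
    ∃ α ∈ J, PosVec b (-x (P.root α)) := by
  classical
  have hex : ∃ n : ℕ, ∃ l : List b.support, (∀ α ∈ l, α ∈ J) ∧ wordProd b l = x ∧ l.length = n := by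
    obtain ⟨l, hl, hl'⟩ := exists_word b hx
    exact ⟨_, l, hl, hl', rfl⟩
  obtain ⟨l, hlJ, hl, hln⟩ := Nat.find_spec hex
  rcases List.eq_nil_or_concat l with rfl | ⟨l', β, rfl⟩
  · exact absurd hl.symm h1
  rw [List.concat_eq_append] at *
  have hβ : β ∈ J := hlJ β (by simp)
  refine ⟨β, hβ, ?_⟩
  have hxu := weyl_mono b (Set.subset_univ J) hx
  refine (posVec_weyl_or b hxu β).resolve_left fun hc => ?_
  have hx' : x = wordProd b l' * P.reflection β := by
    rw [← hl, wordProd_append]; simp [wordProd]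
  obtain ⟨j, hj, -⟩ := weyl_root b hxu β
  obtain ⟨l'', h2, h3, h4⟩ := exchange b l' β J (fun γ hγ => hlJ γ (by simp [hγ]))
    ⟨j, by rw [hj] at hc; exact hc, by
      rw [← hj, hx', LinearEquiv.mul_apply, RootPairing.reflection_apply_self, map_neg, neg_neg]⟩
  refine Nat.find_min hex (m := l''.length) ?_ ⟨l'', h2, by rw [← h4, ← hx'], rfl⟩
  rw [← hln, List.length_append, ← h3]
  simp

lemma eq_one_of_posVec {w : V₀ ≃ₗ[ℝ] V₀} (hw : w ∈ weyl b Set.univ)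
    (h : ∀ α : b.support, PosVec b (w (P.root α))) : w = 1 := by
  by_contra hc
  obtain ⟨α, -, hα⟩ := exists_descent b hw hc
  exact not_posVec_weyl_neg b (h α) hα

lemma posVec_of_mem_minReps {J : Set b.support} {w : V₀ ≃ₗ[ℝ] V₀} (hw : w ∈ minReps b J)
    {α : b.support} (hα : α ∈ J) : PosVec b (w (P.root α)) := by
  refine (posVec_weyl_or b hw.1 α).resolve_right fun h => ?_
  exact (len_mul_refl_lt b hw.1 h).not_ge (hw.2 _ (refl_mem b hα))

lemma repr_weyl_simple {J : Set b.support} {x : V₀ ≃ₗ[ℝ] V₀} (hx : x ∈ weyl b J) {α : b.support}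
    (hα : α ∈ J) {γ : b.support} (hγ : γ ∉ J) : b.basis.repr (x (P.root α)) γ = 0 := by
  rw [repr_weyl b hx _ γ hγ, ← b.basis_apply, Module.Basis.repr_self, Finsupp.single_eq_of_ne]
  rintro rfl
  exact hγ hα

variable [Finite ι]

lemma eq_one_of_posVec_mul {J : Set b.support} {y x : V₀ ≃ₗ[ℝ] V₀}
    (hy : ∀ α ∈ J, PosVec b (y (P.root α))) (hx : x ∈ weyl b J)
    (hyx : ∀ α ∈ J, PosVec b ((y * x) (P.root α))) : x = 1 := by
  by_contra hc
  obtain ⟨α, hα, hneg⟩ := exists_descent b hx hc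
  refine not_posVec_weyl_neg b (hyx α hα) ?_
  have := hneg.map b (y : V₀ →ₗ[ℝ] V₀) fun γ hγ => hy γ (by
    by_contra h
    exact hγ (by rw [map_neg, Finsupp.neg_apply, repr_weyl_simple b hx hα h, neg_zero]))
  simpa [LinearEquiv.mul_apply] using this

/-- Every element of `W` is a product of an element of `W^J`, not longer than it, and one of
`W_J`. -/
lemma exists_minReps_mul (J : Set b.support) {w : V₀ ≃ₗ[ℝ] V₀} (hw : w ∈ weyl b Set.univ) :
    ∃ y ∈ minReps b J, ∃ x ∈ weyl b J, w = y * x ∧ len b y ≤ len b w := by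
  obtain ⟨u, hu, hmin⟩ := Set.exists_min_image (weyl b J : Set (V₀ ≃ₗ[ℝ] V₀))
    (fun u => len b (w * u)) (finite_weyl b J) ⟨1, one_mem _⟩
  refine ⟨w * u, ⟨mul_mem hw (weyl_mono b (Set.subset_univ J) hu), fun v hv => ?_⟩, u⁻¹,
    inv_mem hu, by group, by simpa using hmin 1 (one_mem _)⟩
  rw [mul_assoc]
  exact hmin _ (mul_mem hu hv)

lemma mem_minReps_iff {J : Set b.support} {w : V₀ ≃ₗ[ℝ] V₀} : w ∈ minReps b J ↔
    w ∈ weyl b Set.univ ∧ ∀ α ∈ J, PosVec b (w (P.root α)) := by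
  refine ⟨fun h => ⟨h.1, fun α hα => posVec_of_mem_minReps b h hα⟩, fun ⟨hw, h⟩ => ?_⟩
  obtain ⟨y, hy, x, hx, rfl, -⟩ := exists_minReps_mul b J hw
  have : x = 1 := eq_one_of_posVec_mul b (fun α hα => posVec_of_mem_minReps b hy hα) hx h
  rwa [this, mul_one]

lemma minReps_unique {J : Set b.support} {y y' x x' : V₀ ≃ₗ[ℝ] V₀} (hy : y ∈ minReps b J)
    (hy' : y' ∈ minReps b J) (hx : x ∈ weyl b J) (hx' : x' ∈ weyl b J) (h : y * x = y' * x') :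
    y = y' ∧ x = x' := by
  have h1 : y' = y * (x * x'⁻¹) := by rw [← mul_assoc, h]; group
  have h2 : x * x'⁻¹ = 1 := eq_one_of_posVec_mul b (fun α hα => posVec_of_mem_minReps b hy hα)
    (mul_mem hx (inv_mem hx')) (fun α hα => by
      rw [← h1]; exact posVec_of_mem_minReps b hy' hα)
  exact ⟨by rw [h1, h2, mul_one], mul_inv_eq_one.1 h2⟩

lemma one_mem_minReps (J : Set b.support) : (1 : V₀ ≃ₗ[ℝ] V₀) ∈ minReps b J :=
  (mem_minReps_iff b).2 ⟨one_mem _, fun α _ => posVec_simple b α⟩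

lemma wTop_isLongest (J : Set b.support) : IsLongest b (minReps b J) (wTop b J) := by
  apply Classical.epsilon_spec
  obtain ⟨w, hw, h⟩ := Set.exists_max_image (minReps b J) (len b)
    ((finite_weyl b Set.univ).subset fun w hw => hw.1) ⟨1, one_mem_minReps b J⟩
  exact ⟨w, hw, h⟩

/-- A longest element of `W^J` makes every positive root outside the span of `J` negative. -/
lemma IsLongest.posVec_neg {J : Set b.support} {y : V₀ ≃ₗ[ℝ] V₀}
    (hy : IsLongest b (minReps b J) y) {i : ι} (hi : PosVec b (P.root i)) {γ : b.support}
    (hγ : γ ∉ J) (hiγ : b.basis.repr (P.root i) γ ≠ 0) : PosVec b (-y (P.root i)) := by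
  have := Fintype.ofFinite b.support
  obtain ⟨hymin, hmax⟩ := hy
  have hyW := hymin.1
  have hdesc : ∀ α : b.support, PosVec b (-y⁻¹ (P.root α)) ∨ ∃ β ∈ J, y⁻¹ (P.root α) = P.root β := by
    intro α
    refine (posVec_weyl_or b (inv_mem hyW) α).symm.imp id fun hα => ?_
    have h1 := len_lt_refl_mul b hyW hα
    have h2 : P.reflection α * y ∉ minReps b J := fun hc => (hmax _ hc).not_gt h1
    rw [mem_minReps_iff] at h2
    push Not at h2
    obtain ⟨β, hβ, hneg⟩ := h2 (mul_mem (refl_mem b (Set.mem_univ α)) hyW)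
    refine ⟨β, hβ, ?_⟩
    obtain ⟨j, hj, -⟩ := weyl_root b hyW β
    have hjp := posVec_of_mem_minReps b hymin hβ
    rw [hj] at hjp
    have : P.root j = P.root α := by
      by_contra hne
      apply hneg
      rw [LinearEquiv.mul_apply, hj, ← P.root_reflectionPerm]
      exact isPos_reflection b hjp α hne
    rw [← this, ← hj, ← LinearEquiv.mul_apply, inv_mul_cancel]
    rfl
  refine (posVec_weyl_or b hyW i).resolve_left fun hc => hiγ (le_antisymm ?_ (hi γ))
  have h1 : P.root i = (y⁻¹ : V₀ ≃ₗ[ℝ] V₀) (y (P.root i)) := by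
    rw [← LinearEquiv.mul_apply, inv_mul_cancel]; rfl
  have h2 := map_eq_sum b ((y⁻¹ : V₀ ≃ₗ[ℝ] V₀) : V₀ →ₗ[ℝ] V₀) (y (P.root i))
  rw [LinearEquiv.coe_coe, ← h1] at h2
  rw [h2, map_sum, Finsupp.finsetSum_apply]
  refine Finset.sum_nonpos fun α _ => ?_
  rw [map_smul, Finsupp.smul_apply]
  refine mul_nonpos_of_nonneg_of_nonpos (hc α) ?_
  rcases hdesc α with h | ⟨β, hβ, h⟩
  · have := h γ
    rw [map_neg, Finsupp.neg_apply] at this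
    linarith
  · rw [h, ← b.basis_apply, Module.Basis.repr_self, Finsupp.single_eq_of_ne]
    rintro rfl
    exact hγ hβ

/-- The longest element of `W^{θ(J)}` is `φ⁻¹`; in particular it is unique. -/
lemma IsLongest.mul_phi {J : Set b.support} {y : V₀ ≃ₗ[ℝ] V₀}
    (hy : IsLongest b (minReps b (theta b J)) y) : y * phi b J = 1 := by
  have := Fintype.ofFinite b.support
  have hφ := phi_mapsOnto b J
  refine eq_one_of_posVec b (mul_mem hy.1.1 (phi_mem b J)) fun α => ?_
  rw [LinearEquiv.mul_apply]
  by_cases hα : α ∈ J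
  · obtain ⟨β, hβ, h⟩ := hφ.exists_right α hα
    rw [h]
    exact posVec_of_mem_minReps b hy.1 hβ
  obtain ⟨hJ, -⟩ := wZero_isLongest b J
  obtain ⟨i, hi, -⟩ := weyl_root b hJ α
  have hiα : b.basis.repr (P.root i) α = 1 := by
    rw [← hi, repr_weyl b hJ _ α hα, ← b.basis_apply, Module.Basis.repr_self,
      Finsupp.single_eq_same]
  have hip : PosVec b (P.root i) := by
    refine (posVec_or b i).resolve_right fun h => ?_
    have := h α
    rw [map_neg, Finsupp.neg_apply, hiα] at this
    linarith
  obtain ⟨j, hj, -⟩ := weyl_root b (phi_mem b J) α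
  have hneg : PosVec b (-P.root j) := by
    have h1 := hip.map b (-(wZero b Set.univ : V₀ →ₗ[ℝ] V₀)) fun γ _ => by
      obtain ⟨β, -, h⟩ := wZero_eq_neg b (Set.mem_univ γ)
      rw [LinearMap.neg_apply, LinearEquiv.coe_coe, h, neg_neg]
      exact posVec_simple b β
    rwa [LinearMap.neg_apply, LinearEquiv.coe_coe, ← hi, ← LinearEquiv.mul_apply, ← phi, hj] at h1
  have hj' : P.root (P.reflectionPerm j j) = -P.root j := by
    rw [P.root_reflectionPerm, RootPairing.reflection_apply_self]
  have hex : ∃ γ, γ ∉ theta b J ∧ b.basis.repr (-P.root j) γ ≠ 0 := by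
    by_contra! hc
    have h1 : P.root α = (phi b J)⁻¹ (P.root j) := by
      rw [← hj, ← LinearEquiv.mul_apply, inv_mul_cancel]; rfl
    have h2 := map_eq_sum b (((phi b J)⁻¹ : V₀ ≃ₗ[ℝ] V₀) : V₀ →ₗ[ℝ] V₀) (P.root j)
    rw [LinearEquiv.coe_coe, ← h1] at h2
    have h3 := congrArg (fun x => b.basis.repr x α) h2
    simp only [map_sum, Finsupp.finsetSum_apply] at h3
    rw [← b.basis_apply, Module.Basis.repr_self, Finsupp.single_eq_same] at h3
    refine one_ne_zero (h3.trans (Finset.sum_eq_zero fun β _ => ?_))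
    rw [map_smul, Finsupp.smul_apply]
    by_cases hβ : β ∈ theta b J
    · obtain ⟨δ, hδ, h⟩ := hφ.exists_left β hβ
      have h4 : (phi b J)⁻¹ (P.root β) = P.root δ := by
        rw [← h, ← LinearEquiv.mul_apply, inv_mul_cancel]; rfl
      rw [h4, ← b.basis_apply, Module.Basis.repr_self, Finsupp.single_eq_of_ne, smul_zero]
      rintro rfl
      exact hα hδ
    · have := hc β hβ
      rw [map_neg, Finsupp.neg_apply, neg_eq_zero] at this
      rw [this, zero_smul]
  obtain ⟨γ, hγ, hne⟩ := hex
  have h5 := hy.posVec_neg b (i := P.reflectionPerm j j) (by rw [hj']; exact hneg) hγ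
    (by rw [hj']; exact hne)
  rwa [hj', map_neg, neg_neg, ← hj] at h5

lemma wTop_mul_phi (J : Set b.support) : wTop b (theta b J) * phi b J = 1 :=
  (wTop_isLongest b _).mul_phi b

lemma len_lt_wTop {J : Set b.support} {y : V₀ ≃ₗ[ℝ] V₀} (hy : y ∈ minReps b (theta b J))
    (hne : y ≠ wTop b (theta b J)) : len b y < len b (wTop b (theta b J)) := by
  refine lt_of_le_of_ne ((wTop_isLongest b _).2 y hy) fun h => hne ?_
  have h1 : IsLongest b (minReps b (theta b J)) y :=
    ⟨hy, fun z hz => ((wTop_isLongest b _).2 z hz).trans h.ge⟩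
  exact mul_right_cancel ((h1.mul_phi b).trans (wTop_mul_phi b J).symm)

lemma mul_phi_mem_minReps {J : Set b.support} {y : V₀ ≃ₗ[ℝ] V₀}
    (hy : y ∈ minReps b (theta b J)) : y * phi b J ∈ minReps b J := by
  rw [mem_minReps_iff]
  refine ⟨mul_mem hy.1 (phi_mem b J), fun α hα => ?_⟩
  obtain ⟨β, hβ, h⟩ := (phi_mapsOnto b J).exists_right α hα
  rw [LinearEquiv.mul_apply, h]
  exact posVec_of_mem_minReps b hy hβ

lemma mul_phi_inv_mem_minReps {J : Set b.support} {y : V₀ ≃ₗ[ℝ] V₀}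
    (hy : y ∈ minReps b J) : y * (phi b J)⁻¹ ∈ minReps b (theta b J) := by
  rw [mem_minReps_iff]
  refine ⟨mul_mem hy.1 (inv_mem (phi_mem b J)), fun β hβ => ?_⟩
  obtain ⟨α, hα, h⟩ := (phi_mapsOnto b J).exists_left β hβ
  rw [LinearEquiv.mul_apply, ← h, ← LinearEquiv.mul_apply _ (phi b J), inv_mul_cancel]
  exact posVec_of_mem_minReps b hy hα

lemma mem_inversions_iff {w : V₀ ≃ₗ[ℝ] V₀} (hw : w ∈ weyl b Set.univ) {i : ι} :
    i ∈ inversions b w ↔ PosVec b (P.root i) ∧ PosVec b (-w (P.root i)) := by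
  refine and_congr_right fun _ => ⟨fun ⟨j, hj, h⟩ => by rw [h, neg_neg]; exact hj, fun h => ?_⟩
  obtain ⟨j, hj, -⟩ := weyl_root b hw i
  refine ⟨P.reflectionPerm j j, ?_, ?_⟩
  · change PosVec b _
    rw [P.root_reflectionPerm, RootPairing.reflection_apply_self, ← hj]
    exact h
  · rw [P.root_reflectionPerm, RootPairing.reflection_apply_self, neg_neg, hj]

end WeylComb


/-! ### Inversions of reduced words -/

section Inversions

set_option linter.unusedSectionVars false

variable {ι V₀ N : Type*} [AddCommGroup V₀] [Module ℝ V₀] [AddCommGroup N] [Module ℝ N]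
  {P : RootPairing ι ℝ V₀ N} (b : SimpleRoots P) [P.IsReduced] [Finite ι]

/-- The word `l` is a reduced expression of its product. -/
abbrev IsReduced (l : List b.support) : Prop := IsReducedWord b l (wordProd b l)

lemma wordProd_mem_univ (l : List b.support) : wordProd b l ∈ weyl b Set.univ :=
  wordProd_mem b fun _ _ => Set.mem_univ _

lemma IsReduced.tail {α : b.support} {l : List b.support} (h : IsReduced b (α :: l)) :
    IsReduced b l := by
  refine ⟨rfl, le_antisymm ?_ (len_wordProd_le b l)⟩
  have h1 := h.2
  have h2 := len_refl_mul_le b (wordProd_mem_univ b l) α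
  rw [← wordProd_cons, ← h1, List.length_cons] at h2
  omega

lemma IsReduced.posVec {α : b.support} {l : List b.support} (h : IsReduced b (α :: l)) :
    PosVec b ((wordProd b l)⁻¹ (P.root α)) := by
  refine (posVec_weyl_or b (inv_mem (wordProd_mem_univ b l)) α).resolve_right fun hc => ?_
  have h1 := len_refl_mul_lt b (wordProd_mem_univ b l) hc
  have h2 := h.2
  have h3 := len_wordProd_le b l
  rw [wordProd_cons, List.length_cons] at h2
  omega

/-- The inversions of a reduced word `α :: l` are those of `l` and one more root. -/
lemma IsReduced.inversions_cons {α : b.support} {l : List b.support} (h : IsReduced b (α :: l)) :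
    ∃ i, P.root i = (wordProd b l)⁻¹ (P.root α) ∧ i ∉ inversions b (wordProd b l) ∧
      inversions b (wordProd b (α :: l)) = insert i (inversions b (wordProd b l)) := by
  have hw := wordProd_mem_univ b l
  have hp := h.posVec
  obtain ⟨i, hi, -⟩ := weyl_root b (inv_mem hw) α
  set w := wordProd b l with hwdef
  have hwi : w (P.root i) = P.root α := by
    rw [← hi, ← LinearEquiv.mul_apply, mul_inv_cancel]; rfl
  rw [hi] at hp
  refine ⟨i, hi.symm, fun hc => ?_, ?_⟩
  · rw [mem_inversions_iff b hw, hwi] at hc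
    exact not_posVec_neg b (posVec_simple b α) hc.2
  ext j
  rw [Set.mem_insert_iff, mem_inversions_iff b hw, mem_inversions_iff b (wordProd_mem_univ b _),
    wordProd_cons, LinearEquiv.mul_apply, ← hwdef]
  obtain ⟨r, hr, -⟩ := weyl_root b hw j
  rw [hr]
  constructor
  · rintro ⟨hj, hneg⟩
    by_cases hrp : PosVec b (P.root r)
    · left
      have hrα : P.root r = P.root α := by
        by_contra hne
        refine not_posVec_neg b (i := P.reflectionPerm α r) (isPos_reflection b hrp α hne) ?_
        rwa [P.root_reflectionPerm]
      apply P.root.injective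
      apply w.injective
      rw [hr, hrα, hwi]
    · exact Or.inr ⟨hj, (posVec_neg_iff b r).2 hrp⟩
  · rintro (rfl | ⟨hj, hneg⟩)
    · refine ⟨hp, ?_⟩
      rw [← hr, hwi, RootPairing.reflection_apply_self, neg_neg]
      exact posVec_simple b α
    · refine ⟨hj, ?_⟩
      have hr' : P.root (P.reflectionPerm r r) = -P.root r := by
        rw [P.root_reflectionPerm, RootPairing.reflection_apply_self]
      rw [← map_neg, ← hr', ← P.root_reflectionPerm]
      refine isPos_reflection b (by change PosVec b _; rwa [hr']) α fun hc => ?_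
      have h1 : w (P.root j) = -w (P.root i) := by rw [hr, hwi, ← hc, hr', neg_neg]
      have h2 : P.root j = -P.root i := w.injective (by rw [h1, map_neg])
      exact not_posVec_neg b hp (by rw [← h2]; exact hj)

end Inversions

/-! ### Dominant vectors -/

section Dominant

set_option linter.unusedSectionVars false

variable {ι V₀ N : Type*} [Fintype ι] [AddCommGroup V₀] [Module ℝ V₀] [AddCommGroup N] [Module ℝ N]
  {P : RootPairing ι ℝ V₀ N} (b : SimpleRoots P)

lemma rootSpan_eq_top (b : SimpleRoots P) : P.rootSpan ℝ = ⊤ := by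
  rw [eq_top_iff, ← b.basis.span_eq, Submodule.span_le]
  rintro _ ⟨α, rfl⟩
  rw [b.basis_apply]
  exact Submodule.subset_span ⟨α, rfl⟩

lemma rootForm_pos (b : SimpleRoots P) {x : V₀} (hx : x ≠ 0) : 0 < P.RootForm x x :=
  P.rootForm_pos_of_ne_zero (by rw [rootSpan_eq_top b]; trivial) hx

lemma rootForm_comm (x y : V₀) : P.RootForm x y = P.RootForm y x := by
  simp [RootPairing.rootForm_apply_apply, mul_comm]

lemma rootForm_weyl {w : V₀ ≃ₗ[ℝ] V₀} (hw : w ∈ weyl b Set.univ) (x y : V₀) :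
    P.RootForm (w x) (w y) = P.RootForm x y := by
  obtain ⟨l, -, rfl⟩ := exists_word b hw
  clear hw
  induction l with
  | nil => rfl
  | cons α l ih =>
    rw [wordProd_cons, LinearEquiv.mul_apply, LinearEquiv.mul_apply,
      P.rootForm_reflection_reflection_apply, ih]

/-- The coroot of a root, as a functional, is `2 B(α, -) / B(α, α)`. -/
lemma two_mul_rootForm (i : ι) (x : V₀) :
    2 * P.RootForm (P.root i) x = P.RootForm (P.root i) (P.root i) * P.coroot' i x := by
  have h := rootForm_comm (P := P) (P.reflection i (P.root i)) (P.reflection i x)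
  rw [P.rootForm_reflection_reflection_apply, RootPairing.reflection_apply_self,
    RootPairing.reflection_apply, map_neg, map_sub, map_smul,
    LinearMap.sub_apply, LinearMap.smul_apply, smul_eq_mul] at h
  have h2 := rootForm_comm (P := P) (P.root i) x
  linarith

variable [P.IsReduced]

lemma posVec_sub_weyl {n : V₀} (hn : ∀ α : b.support, 0 ≤ P.RootForm (P.root α) n)
    {w : V₀ ≃ₗ[ℝ] V₀} (hw : w ∈ weyl b Set.univ) : PosVec b (n - w n) := by
  obtain ⟨l, hl, hl'⟩ := exists_reduced b hw
  subst hl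
  induction l with
  | nil => intro α; simp [wordProd]
  | cons α l ih =>
    have hred : IsReduced b (α :: l) := ⟨rfl, hl'⟩
    have h1 := ih (wordProd_mem_univ b l) hred.tail.2
    have hp := hred.posVec
    set y := wordProd b l with hy
    have hyW := wordProd_mem_univ b l
    have hB : 0 ≤ P.RootForm (P.root α) (y n) := by
      have h2 : P.RootForm (P.root α) (y n) = P.RootForm (y⁻¹ (P.root α)) n := by
        rw [← rootForm_weyl b (inv_mem hyW), ← LinearEquiv.mul_apply _ y, inv_mul_cancel]; rfl
      have := Fintype.ofFinite b.support
      have h3 := map_eq_sum b (LinearMap.id (R := ℝ) (M := V₀)) (y⁻¹ (P.root α))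
      simp only [LinearMap.id_apply] at h3
      rw [h2, h3, map_sum, LinearMap.sum_apply]
      refine Finset.sum_nonneg fun γ _ => ?_
      rw [map_smul, LinearMap.smul_apply, smul_eq_mul]
      exact mul_nonneg (hp γ) (hn γ)
    have hc : 0 ≤ P.coroot' α (y n) := by
      have h2 := two_mul_rootForm (P := P) α (y n)
      have h3 := rootForm_pos b (P.ne_zero (α : ι))
      by_contra hneg
      push Not at hneg
      have := mul_neg_of_pos_of_neg h3 hneg
      linarith
    rw [wordProd_cons, LinearEquiv.mul_apply, ← hy, RootPairing.reflection_apply]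
    have h4 : n - (y n - P.coroot' α (y n) • P.root α) =
        (n - y n) + P.coroot' α (y n) • P.root α := by
      rw [sub_sub_eq_add_sub, add_sub_right_comm]
    rw [h4]
    exact h1.add b ((posVec_simple b α).smul b hc)

/-- Langlands' combinatorial lemma: let `n` be orthogonal to `J` and positive on the other simple
roots, and let `d`, `d'` be in the cone generated by `-J`. If `x ∈ W^J` maps `n + d'` to `n + d`,
then `x = 1`. -/
lemma langlands {J : Set b.support} {n d d' : V₀}
    (hnJ : ∀ α ∈ J, P.RootForm (P.root α) n = 0) (hn : ∀ α ∉ J, 0 < P.RootForm (P.root α) n)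
    (hd' : PosVec b (-d')) (hdJ : ∀ γ ∉ J, b.basis.repr d γ = 0)
    (hdJ' : ∀ γ ∉ J, b.basis.repr d' γ = 0) {x : V₀ ≃ₗ[ℝ] V₀} (hx : x ∈ minReps b J)
    (h : x (n + d') = n + d) : x = 1 := by
  have := Fintype.ofFinite b.support
  have hn0 : ∀ α : b.support, 0 ≤ P.RootForm (P.root α) n := fun α => by
    by_cases hα : α ∈ J
    exacts [(hnJ α hα).ge, (hn α hα).le]
  have h1 := posVec_sub_weyl b hn0 hx.1
  have h2 : PosVec b (-x d') := by
    have := hd'.map b (x : V₀ →ₗ[ℝ] V₀) fun α hα => posVec_of_mem_minReps b hx (by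
      by_contra hc
      exact hα (by rw [map_neg, Finsupp.neg_apply, hdJ' α hc, neg_zero]))
    simpa using this
  have h3 : (n - x n) + (-x d') = -d := by
    rw [map_add] at h
    rw [← sub_eq_zero, ← sub_eq_zero.2 h.symm]; abel
  -- both summands are nonnegative, so that both are supported in `J`
  have h4 : ∀ γ ∉ J, b.basis.repr (n - x n) γ = 0 := fun γ hγ => by
    have h5 := congrArg (fun z => b.basis.repr z γ) h3
    simp only [map_add, Finsupp.add_apply] at h5
    rw [map_neg (b.basis.repr) d, Finsupp.neg_apply, hdJ γ hγ] at h5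
    have := h1 γ
    have := h2 γ
    linarith
  have h5 : P.RootForm (n - x n) n = 0 := by
    have h6 := map_eq_sum b (LinearMap.id (R := ℝ) (M := V₀)) (n - x n)
    simp only [LinearMap.id_apply] at h6
    rw [h6, map_sum, LinearMap.sum_apply]
    refine Finset.sum_eq_zero fun γ _ => ?_
    rw [map_smul, LinearMap.smul_apply, smul_eq_mul]
    by_cases hγ : γ ∈ J
    · rw [hnJ γ hγ, mul_zero]
    · rw [h4 γ hγ, zero_mul]
  have h6 : n - x n = 0 := by
    by_contra hne
    have h7 := rootForm_pos b hne
    have h8 := rootForm_weyl b hx.1 n n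
    have h9 := rootForm_comm (P := P) (x n) n
    simp only [map_sub, LinearMap.sub_apply] at h5 h7
    linarith
  by_contra hne
  obtain ⟨α, -, hα⟩ := exists_descent b hx.1 hne
  have hαJ : α ∉ J := fun hc => not_posVec_weyl_neg b (posVec_of_mem_minReps b hx hc) hα
  have h7 : P.RootForm (P.root α) n = P.RootForm (x (P.root α)) n := by
    rw [← rootForm_weyl b hx.1, ← sub_eq_zero.1 h6]
  have h8 : 0 ≤ P.RootForm (-x (P.root α)) n := by
    have h6 := map_eq_sum b (LinearMap.id (R := ℝ) (M := V₀)) (-x (P.root α))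
    simp only [LinearMap.id_apply] at h6
    rw [h6, map_sum, LinearMap.sum_apply]
    refine Finset.sum_nonneg fun γ _ => ?_
    rw [map_smul, LinearMap.smul_apply, smul_eq_mul]
    exact mul_nonneg (hα γ) (hn0 γ)
  rw [map_neg, LinearMap.neg_apply] at h8
  have := hn α hαJ
  linarith

end Dominant


/-! ### Generators and commutation relations of graded Hecke algebras -/

section SymLift

variable {M B : Type*} [AddCommGroup M] [Module ℂ M] [Ring B] [Algebra ℂ B]

open scoped IsMulCommutative in
/-- A linear map with commuting values, from `M` to a possibly noncommutative algebra, extends to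
the symmetric algebra of `M`. -/
def symLift (g : M →ₗ[ℂ] B) (hg : ∀ x y, g x * g y = g y * g x) :
    SymmetricAlgebra ℂ M →ₐ[ℂ] B :=
  haveI : IsMulCommutative (Algebra.adjoin ℂ (Set.range g)) := Algebra.isMulCommutative_adjoin ℂ (by
    rintro _ ⟨x, rfl⟩ _ ⟨y, rfl⟩; exact hg x y)
  (Algebra.adjoin ℂ (Set.range g)).val.comp
    (SymmetricAlgebra.lift (A := Algebra.adjoin ℂ (Set.range g)) (LinearMap.codRestrict
      (Subalgebra.toSubmodule (Algebra.adjoin ℂ (Set.range g))) g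
      fun x => Algebra.subset_adjoin ⟨x, rfl⟩))

open scoped IsMulCommutative in
lemma symLift_ι (g : M →ₗ[ℂ] B) (hg : ∀ x y, g x * g y = g y * g x) (x : M) :
    symLift g hg (SymmetricAlgebra.ι ℂ M x) = g x := by
  have : IsMulCommutative (Algebra.adjoin ℂ (Set.range g)) := Algebra.isMulCommutative_adjoin ℂ (by
    rintro _ ⟨x, rfl⟩ _ ⟨y, rfl⟩; exact hg x y)
  exact congrArg Subtype.val (SymmetricAlgebra.lift_ι_apply (A := Algebra.adjoin ℂ (Set.range g))
    (LinearMap.codRestrict (Subalgebra.toSubmodule (Algebra.adjoin ℂ (Set.range g))) g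
      fun x => Algebra.subset_adjoin ⟨x, rfl⟩) x)

end SymLift

section Relations

set_option linter.unusedSectionVars false

variable {ι V₀ N : Type*} [AddCommGroup V₀] [Module ℝ V₀] [AddCommGroup N] [Module ℝ N]
  {P : RootPairing ι ℝ V₀ N} {b : SimpleRoots P} {k : Param b} {J : Set b.support}

@[elab_as_elim]
lemma HeckeAlg.induction {O : Type*} [CommRing O] [Algebra ℂ O] {j : Cx V₀ →ₗ[ℂ] O}
    {C : HeckeAlg k J O j → Prop}
    (algebraMap : ∀ c : ℂ, C (algebraMap ℂ _ c)) (t : ∀ w, C (HeckeAlg.t w))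
    (f : ∀ q, C (HeckeAlg.f q)) (mul : ∀ x y, C x → C y → C (x * y))
    (add : ∀ x y, C x → C y → C (x + y)) (x : HeckeAlg k J O j) : C x := by
  obtain ⟨x, rfl⟩ := RingQuot.mkAlgHom_surjective ℂ _ x
  induction x using FreeAlgebra.induction with
  | grade0 c => rw [AlgHom.commutes]; exact algebraMap c
  | grade1 i =>
    cases i with
    | inl w => exact t w
    | inr q => exact f q
  | mul x y hx hy => rw [map_mul]; exact mul _ _ hx hy
  | add x y hx hy => rw [map_add]; exact add _ _ hx hy

/-- The element `v ∈ V` of `ℍ_J`. -/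
abbrev vec (k : Param b) (J : Set b.support) (v : Cx V₀) : HJ k J :=
  HeckeAlg.f (SymmetricAlgebra.ι ℂ (Cx V₀) v)

lemma t_sRefl_induction {C : weyl b J → Prop} (one : C 1)
    (mul : ∀ (α : b.support) (hα : α ∈ J) (w : weyl b J), C w → C (sRefl hα * w))
    (w : weyl b J) : C w := by
  obtain ⟨w, hw⟩ := w
  obtain ⟨l, hl, rfl⟩ := exists_word b hw
  induction l with
  | nil => exact one
  | cons α l ih =>
    have hl' : ∀ β ∈ l, β ∈ J := fun β hβ => hl β (List.mem_cons_of_mem _ hβ)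
    have := mul α (hl α List.mem_cons_self) _ (ih hl' (wordProd_mem b hl'))
    convert this using 1
    exact Subtype.ext (wordProd_cons b α l)

/-- `ℍ_J` is generated by the `t_{s_α}`, `α ∈ J`, and `V`. -/
@[elab_as_elim]
lemma HJ.induction {C : HJ k J → Prop} (algebraMap : ∀ c : ℂ, C (algebraMap ℂ _ c))
    (refl : ∀ (α : b.support) (hα : α ∈ J), C (HeckeAlg.t (sRefl hα)))
    (vec : ∀ v, C (vec k J v)) (mul : ∀ x y, C x → C y → C (x * y))
    (add : ∀ x y, C x → C y → C (x + y)) (x : HJ k J) : C x := by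
  induction x using HeckeAlg.induction with
  | algebraMap c => exact algebraMap c
  | t w =>
    induction w using t_sRefl_induction with
    | one => simpa using algebraMap 1
    | mul α hα w ih => rw [map_mul]; exact mul _ _ (refl α hα) ih
  | f q =>
    induction q using SymmetricAlgebra.induction with
    | algebraMap c => rw [AlgHom.commutes]; exact algebraMap c
    | ι v => exact vec v
    | mul x y hx hy => rw [map_mul]; exact mul _ _ hx hy
    | add x y hx hy => rw [map_add]; exact add _ _ hx hy
  | mul x y hx hy => exact mul _ _ hx hy
  | add x y hx hy => exact add _ _ hx hy

lemma cxMap_one (v : Cx V₀) : cxMap (1 : V₀ ≃ₗ[ℝ] V₀) v = v := by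
  have := cxMap_inv_left (1 : V₀ ≃ₗ[ℝ] V₀) v
  rwa [← cxMap_mul, inv_one, mul_one] at this

lemma cxMap_refl_refl (i : ι) (v : Cx V₀) :
    cxMap (P.reflection i) (cxMap (P.reflection i) v) = v := by
  rw [← cxMap_mul, refl_mul_refl, cxMap_one]

lemma cxMap_refl_cxRoot (i : ι) : cxMap (P.reflection i) (cxRoot P i) = -cxRoot P i := by
  rw [cxRoot, cxMap_tmul, RootPairing.reflection_apply_self, tmul_neg]

lemma cxCoroot_refl (i : ι) (v : Cx V₀) :
    cxCoroot P i (cxMap (P.reflection i) v) = -cxCoroot P i v := by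
  have h := cxMap_refl_refl (P := P) i v
  rw [cxMap_reflection, cxMap_reflection, sub_sub, sub_eq_self, ← add_smul] at h
  have := (smul_eq_zero.1 h).resolve_right (cxRoot_ne_zero i)
  rw [cxMap_reflection]
  linear_combination this

lemma vec_mul_t_sRefl {α : b.support} (hα : α ∈ J) (v : Cx V₀) :
    vec k J v * HeckeAlg.t (sRefl hα) = HeckeAlg.t (sRefl hα) * vec k J (cxMap (P.reflection α) v) +
      algebraMap ℂ _ (k.val α * cxCoroot P α v) := by
  have h := HeckeAlg.cross (k := k) (j := SymmetricAlgebra.ι ℂ (Cx V₀)) hα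
    (cxMap (P.reflection α) v)
  rw [cxMap_refl_refl, cxCoroot_refl, mul_neg, map_neg, sub_eq_iff_eq_add] at h
  rw [h]
  abel

/-- The product of a word, as an element of `W`. -/
def wordW (b : SimpleRoots P) (l : List b.support) : weyl b Set.univ :=
  ⟨wordProd b l, wordProd_mem b fun _ _ => Set.mem_univ _⟩

lemma wordW_cons (α : b.support) (l : List b.support) :
    wordW b (α :: l) = sRefl (Set.mem_univ α) * wordW b l := Subtype.ext (wordProd_cons b α l)

lemma wordW_nil : wordW b [] = 1 := rfl

/-- The span of the `t_w p` with `w ∈ W` of length less than `n` and `p ∈ S(V)`. -/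
def lowH (k : Param b) (n : ℕ) : Submodule ℂ (HH k) :=
  Submodule.span ℂ {h | ∃ (w : weyl b Set.univ) (p : SV V₀), len b w < n ∧
    h = HeckeAlg.t w * HeckeAlg.f p}

lemma mem_lowH {n : ℕ} {w : weyl b Set.univ} (hw : len b w < n) (p : SV V₀) :
    (HeckeAlg.t w * HeckeAlg.f p : HH k) ∈ lowH k n :=
  Submodule.subset_span ⟨w, p, hw, rfl⟩

lemma lowH_mono {n n' : ℕ} (h : n ≤ n') : lowH k n ≤ lowH k n' :=
  Submodule.span_mono fun _ ⟨w, p, hw, hx⟩ => ⟨w, p, hw.trans_le h, hx⟩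

lemma t_sRefl_mul_mem_lowH {n : ℕ} {x : HH k} (hx : x ∈ lowH k n) (α : b.support) :
    HeckeAlg.t (sRefl (Set.mem_univ α)) * x ∈ lowH k (n + 1) := by
  induction hx using Submodule.span_induction with
  | mem x hx =>
    obtain ⟨w, p, hw, rfl⟩ := hx
    rw [← mul_assoc, ← map_mul]
    refine mem_lowH ?_ p
    exact (len_refl_mul_le b w.2 α).trans_lt (by omega)
  | zero => rw [mul_zero]; exact zero_mem _
  | add x y _ _ hx hy => rw [mul_add]; exact add_mem hx hy
  | smul c x _ hx => rw [mul_smul_comm]; exact Submodule.smul_mem _ _ hx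

lemma mul_f_mem_lowH {n : ℕ} {x : HH k} (hx : x ∈ lowH k n) (q : SV V₀) :
    x * HeckeAlg.f q ∈ lowH k n := by
  induction hx using Submodule.span_induction with
  | mem x hx =>
    obtain ⟨w, p, hw, rfl⟩ := hx
    rw [mul_assoc, ← map_mul]
    exact mem_lowH hw _
  | zero => rw [zero_mul]; exact zero_mem _
  | add x y _ _ hx hy => rw [add_mul]; exact add_mem hx hy
  | smul c x _ hx => rw [smul_mul_assoc]; exact Submodule.smul_mem _ _ hx

lemma vec_mul_t_wordW (l : List b.support) (v : Cx V₀) :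
    vec k Set.univ v * HeckeAlg.t (wordW b l) -
      HeckeAlg.t (wordW b l) * vec k Set.univ (cxMap (wordProd b l)⁻¹ v) ∈ lowH k l.length := by
  induction l generalizing v with
  | nil =>
    rw [wordW_nil, map_one, mul_one, one_mul]
    have : wordProd b [] = 1 := rfl
    rw [this, inv_one, cxMap_one, sub_self]
    exact zero_mem _
  | cons α l ih =>
    have h := t_sRefl_mul_mem_lowH (ih (cxMap (P.reflection α) v)) α
    have h2 : (algebraMap ℂ (HH k) (k.val α * cxCoroot P α v)) * HeckeAlg.t (wordW b l) ∈
        lowH k (l.length + 1) := by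
      rw [← Algebra.smul_def]
      refine Submodule.smul_mem _ _ ?_
      have := mem_lowH (k := k) (w := wordW b l) (n := l.length + 1)
        (Nat.lt_succ_of_le (len_wordProd_le b l)) 1
      rwa [map_one, mul_one] at this
    rw [List.length_cons]
    convert add_mem h h2 using 1
    rw [wordW_cons, map_mul, ← mul_assoc, vec_mul_t_sRefl, wordProd_cons, mul_inv_rev, cxMap_mul,
      RootPairing.reflection_inv]
    simp only [mul_sub, add_mul, mul_assoc]
    abel

lemma vec_mul_t (w : weyl b Set.univ) (v : Cx V₀) :
    vec k Set.univ v * HeckeAlg.t w - HeckeAlg.t w * vec k Set.univ (cxMap (w : V₀ ≃ₗ[ℝ] V₀)⁻¹ v) ∈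
      lowH k (len b w) := by
  obtain ⟨l, hl, hl'⟩ := exists_reduced b w.2
  have := vec_mul_t_wordW (k := k) l v
  have hw : wordW b l = w := Subtype.ext hl
  rwa [hl', hw, hl] at this

/-! ### The intertwining elements -/

/-- The intertwining element `t_{s_α} α - k_α` of a simple reflection. -/
def tauRefl (k : Param b) (α : b.support) : HH k :=
  HeckeAlg.t (sRefl (Set.mem_univ α)) * vec k Set.univ (cxRoot P α) - algebraMap ℂ _ (k.val α)

lemma tauTilde_cons (α : b.support) (l : List b.support) :
    tauTilde k (α :: l) = tauRefl k α * tauTilde k l := by simp [tauTilde, tauRefl]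

lemma tauTilde_append (l l' : List b.support) :
    tauTilde k (l ++ l') = tauTilde k l * tauTilde k l' := by simp [tauTilde]

lemma vec_mul_vec (v v' : Cx V₀) : vec k J v * vec k J v' = vec k J v' * vec k J v := by
  rw [← map_mul, mul_comm, map_mul]

lemma vec_sub_smul (v v' : Cx V₀) (c : ℂ) :
    vec k J (v - c • v') = vec k J v - algebraMap ℂ _ c * vec k J v' := by
  rw [vec, map_sub, map_smul, map_sub, map_smul, Algebra.smul_def]

lemma vec_mul_tauRefl (α : b.support) (v : Cx V₀) :
    vec k Set.univ v * tauRefl k α = tauRefl k α * vec k Set.univ (cxMap (P.reflection α) v) := by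
  have h1 := vec_mul_t_sRefl (k := k) (Set.mem_univ α) v
  have h2 := vec_mul_vec (k := k) (J := Set.univ) (cxMap (P.reflection α) v) (cxRoot P α)
  have h3 : vec k Set.univ (cxMap (P.reflection α) v) = vec k Set.univ v -
      algebraMap ℂ _ (cxCoroot P α v) * vec k Set.univ (cxRoot P α) := by
    rw [cxMap_reflection, vec_sub_smul]
  have h4 := Algebra.commutes (k.val α) (vec k Set.univ v)
  rw [tauRefl, mul_sub, ← mul_assoc, h1, add_mul, mul_assoc, h2, sub_mul, ← h4, h3, map_mul]
  simp only [mul_sub, mul_assoc]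
  abel

/-- `τ̃_w` intertwines the actions of `V` up to `w`. -/
lemma vec_mul_tauTilde (l : List b.support) (v : Cx V₀) :
    vec k Set.univ v * tauTilde k l =
      tauTilde k l * vec k Set.univ (cxMap (wordProd b l)⁻¹ v) := by
  induction l generalizing v with
  | nil =>
    have : wordProd b [] = 1 := rfl
    rw [this, inv_one, cxMap_one]
    simp [tauTilde]
  | cons α l ih =>
    rw [tauTilde_cons, ← mul_assoc, vec_mul_tauRefl, mul_assoc, ih, ← mul_assoc, wordProd_cons,
      mul_inv_rev, cxMap_mul, RootPairing.reflection_inv]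

/-- The root `w⁻¹(α)`, for the product `w` of the word `l`, in `S(V)`. -/
def symRoot (α : b.support) (l : List b.support) : SV V₀ :=
  SymmetricAlgebra.ι ℂ (Cx V₀) (cxMap (wordProd b l)⁻¹ (cxRoot P α))

/-- The product of the roots which a reduced word makes negative; it is the leading coefficient of
`τ̃`. -/
def rootProd : List b.support → SV V₀
  | [] => 1
  | α :: l => rootProd l * symRoot α l

/-- The product of the `k_α² - β²`, with `β` as in `rootProd`. -/
def sqProd (k : Param b) : List b.support → SV V₀
  | [] => 1
  | α :: l => sqProd k l * (algebraMap ℂ _ (k.val α ^ 2) - symRoot α l ^ 2)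

/-- The leading term of `τ̃`; what is left is of smaller length. -/
lemma tauTilde_sub_mem (l : List b.support) :
    tauTilde k l - HeckeAlg.t (wordW b l) * HeckeAlg.f (rootProd l) ∈ lowH k l.length := by
  induction l with
  | nil => simp [tauTilde, rootProd, wordW_nil]
  | cons α l ih =>
    have h1 := mul_f_mem_lowH (t_sRefl_mul_mem_lowH ih α) (symRoot α l)
    have h2 := Submodule.smul_mem (lowH k (l.length + 1)) (k.val α)
      (lowH_mono (Nat.le_succ _) ih)
    have h3 := Submodule.smul_mem (lowH k (l.length + 1)) (k.val α)
      (mem_lowH (k := k) (w := wordW b l) (n := l.length + 1)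
        (Nat.lt_succ_of_le (len_wordProd_le b l)) (rootProd l))
    rw [List.length_cons]
    convert sub_mem (sub_mem h1 h2) h3 using 1
    have h4 := vec_mul_tauTilde (k := k) l (cxRoot P α)
    rw [tauTilde_cons, tauRefl, sub_mul, mul_assoc, h4, wordW_cons, map_mul, rootProd, map_mul,
      Algebra.smul_def, Algebra.smul_def, symRoot]
    simp only [mul_sub, sub_mul, mul_assoc]
    abel

lemma sq_sub_of_mul_self_eq_one {A : Type*} [Ring A] {T x c : A} (hT : T * T = 1)
    (hc : ∀ y, c * y = y * c) (h : x * (T * x - c) = (T * x - c) * (-x)) :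
    (T * x - c) * (T * x - c) = c * c - x * x := by
  have h1 : (T * x - c) * (T * x - c) = T * (x * (T * x - c)) - c * (T * x - c) := by
    rw [sub_mul, mul_assoc]
  have h2 : T * (T * x * x) = x * x := by rw [mul_assoc, ← mul_assoc T T, hT, one_mul]
  rw [h1, h, sub_mul, mul_sub, mul_sub, mul_neg, mul_neg, mul_neg, mul_neg, h2, hc (T * x),
    hc x, ← mul_assoc]
  abel

lemma tauRefl_sq (α : b.support) : tauRefl k α * tauRefl k α =
    algebraMap ℂ _ (k.val α ^ 2) - vec k Set.univ (cxRoot P α) * vec k Set.univ (cxRoot P α) := by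
  have h1 := vec_mul_tauRefl (k := k) α (cxRoot P α)
  have h2 : vec k Set.univ (cxMap (P.reflection α) (cxRoot P α)) = -vec k Set.univ (cxRoot P α) := by
    rw [cxMap_refl_cxRoot, vec, map_neg, map_neg]
  have h3 : HeckeAlg.t (sRefl (Set.mem_univ α)) * HeckeAlg.t (sRefl (Set.mem_univ α)) =
      (1 : HH k) := by
    rw [← map_mul, ← map_one HeckeAlg.t]
    exact congrArg _ (Subtype.ext (refl_mul_refl _))
  rw [h2] at h1
  rw [sq, map_mul]
  exact sq_sub_of_mul_self_eq_one h3 (Algebra.commutes _) h1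

/-- The intertwining element of the reversed word inverts `τ̃` up to a factor in `S(V)`. -/
lemma tauTilde_reverse_mul (l : List b.support) :
    tauTilde k l.reverse * tauTilde k l = HeckeAlg.f (sqProd k l) := by
  induction l with
  | nil => simp [tauTilde, sqProd]
  | cons α l ih =>
    have h0 : tauTilde k [α] = tauRefl k α := by simp [tauTilde, tauRefl]
    have h4 := vec_mul_tauTilde (k := k) l (cxRoot P α)
    have h5 : HeckeAlg.f (symRoot α l ^ 2) =
        vec k Set.univ (cxMap (wordProd b l)⁻¹ (cxRoot P α)) *
          vec k Set.univ (cxMap (wordProd b l)⁻¹ (cxRoot P α)) := by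
      rw [sq, map_mul]; rfl
    rw [List.reverse_cons, tauTilde_append, h0, tauTilde_cons, mul_assoc, ← mul_assoc (tauRefl k α),
      tauRefl_sq, sub_mul, mul_assoc, h4, ← mul_assoc, h4, mul_sub, mul_assoc,
      Algebra.commutes, ← mul_assoc, ih, ← mul_assoc, ih, sqProd, map_mul, map_sub, AlgHom.commutes,
      mul_sub, h5]

end Relations


/-! ### The module induced from `S(V)` -/

section Regular

set_option linter.unusedSectionVars false

variable {ι V₀ N : Type*} [Fintype ι] [AddCommGroup V₀] [Module ℝ V₀] [AddCommGroup N] [Module ℝ N]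
  {P : RootPairing ι ℝ V₀ N} {b : SimpleRoots P} (k : Param b)

instance (J : Set b.support) : Finite (weyl b J) := (finite_weyl b J).to_subtype

instance (J : Set b.support) : Fintype (weyl b J) := Fintype.ofFinite _

open Classical in
/-- The extension of the parameters to all roots that are `W`-conjugate to simple roots. (All roots
are, but the value `0` at other roots spares a proof of this.) -/
def rootParam (i : ι) : ℂ :=
  if h : ∃ α : b.support, ∃ w ∈ weyl b Set.univ, w (P.root α) = P.root i then k.val h.choose else 0

open Classical in
variable (b) in
/-- The reflection in a root, as an element of `W`. -/
def reflW (i : ι) : weyl b Set.univ :=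
  if h : P.reflection i ∈ weyl b Set.univ then ⟨P.reflection i, h⟩ else 1

lemma rootParam_eq {α : b.support} {w : V₀ ≃ₗ[ℝ] V₀} (hw : w ∈ weyl b Set.univ) {i : ι}
    (h : w (P.root α) = P.root i) : rootParam k i = k.val α := by
  have hex : ∃ α : b.support, ∃ w ∈ weyl b Set.univ, w (P.root α) = P.root i := ⟨α, w, hw, h⟩
  rw [rootParam, dif_pos hex]
  obtain ⟨w', hw', h'⟩ := hex.choose_spec
  refine k.eq_of_conj _ _ (w⁻¹ * w') (mul_mem (inv_mem hw) hw') ?_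
  rw [LinearEquiv.mul_apply, h', ← h, ← LinearEquiv.mul_apply, inv_mul_cancel]
  rfl

lemma rootParam_simple (α : b.support) : rootParam k (α : ι) = k.val α :=
  rootParam_eq k (one_mem _) rfl

lemma rootParam_reflectionPerm (α : b.support) (i : ι) :
    rootParam k (P.reflectionPerm α i) = rootParam k i := by
  have hs := refl_mem b (Set.mem_univ α)
  have h1 : P.reflection α (P.root i) = P.root (P.reflectionPerm α i) :=
    (P.root_reflectionPerm α i).symm
  by_cases h : ∃ γ : b.support, ∃ w ∈ weyl b Set.univ, w (P.root γ) = P.root i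
  · obtain ⟨γ, w, hw, hγ⟩ := h
    rw [rootParam_eq k hw hγ, rootParam_eq k (mul_mem hs hw) (by
      rw [LinearEquiv.mul_apply, hγ, h1])]
  · have h' : ¬ ∃ γ : b.support, ∃ w ∈ weyl b Set.univ,
        w (P.root γ) = P.root (P.reflectionPerm α i) := by
      rintro ⟨γ, w, hw, hγ⟩
      refine h ⟨γ, P.reflection α * w, mul_mem hs hw, ?_⟩
      rw [LinearEquiv.mul_apply, hγ, ← h1, ← LinearEquiv.mul_apply, refl_mul_refl]
      rfl
    rw [rootParam, rootParam, dif_neg h, dif_neg h']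

lemma refl_mem_of_rootParam_ne_zero {i : ι} (h : rootParam k i ≠ 0) :
    P.reflection i ∈ weyl b Set.univ := by
  by_cases hex : ∃ γ : b.support, ∃ w ∈ weyl b Set.univ, w (P.root γ) = P.root i
  · obtain ⟨γ, w, hw, hγ⟩ := hex
    rw [reflection_conj b hw hγ]
    exact mul_mem (mul_mem hw (refl_mem b (Set.mem_univ γ))) (inv_mem hw)
  · rw [rootParam, dif_neg hex] at h
    exact absurd rfl h

lemma reflW_val {i : ι} (h : P.reflection i ∈ weyl b Set.univ) :
    (reflW b i : V₀ ≃ₗ[ℝ] V₀) = P.reflection i := by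
  rw [reflW, dif_pos h]

lemma cxCoroot_reflectionPerm (j i : ι) (v : Cx V₀) :
    cxCoroot P (P.reflectionPerm j i) v = cxCoroot P i (cxMap (P.reflection j) v) := by
  induction v using TensorProduct.induction_on with
  | zero => simp
  | tmul c x =>
    rw [cxMap_tmul, cxCoroot, cxCoroot, Module.Dual.baseChange_apply_tmul,
      Module.Dual.baseChange_apply_tmul, P.coroot'_reflection]
  | add x y hx hy => rw [map_add, hx, hy, map_add, map_add]

variable (A E : Type*) [CommRing A] [Algebra ℂ A] [AddCommGroup E] [Module ℂ E] [Module A E]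
  [IsScalarTower ℂ A E]

variable (b) in
/-- The action of `W` on functions `W → E` by left translation. -/
def transl : weyl b Set.univ →* Module.End A (weyl b Set.univ → E) where
  toFun g := LinearMap.funLeft A E (fun w => g⁻¹ * w)
  map_one' := by ext F w; simp [LinearMap.funLeft]
  map_mul' g g' := by
    refine LinearMap.ext fun F => funext fun w => ?_
    simp [LinearMap.funLeft, mul_assoc]

lemma transl_apply (g : weyl b Set.univ) (F : weyl b Set.univ → E) (w : weyl b Set.univ) :
    transl b A E g F w = F (g⁻¹ * w) := rfl

open Classical in
lemma transl_single (g w : weyl b Set.univ) (u : E) :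
    transl b A E g (Pi.single w u) = Pi.single (g * w) u := by
  ext w'
  rw [transl_apply]
  by_cases h : w' = g * w
  · subst h
    rw [inv_mul_cancel_left, Pi.single_eq_same, Pi.single_eq_same]
  · rw [Pi.single_eq_of_ne h, Pi.single_eq_of_ne]
    rintro rfl
    exact h (by simp)

variable {A E}

open Classical in
/-- The action of `V` on the induced module, realized on functions `W → E`: on the function
supported at `w ∈ W` with value `u` it is given by
`w ⊗ u ↦ w ⊗ w⁻¹(v) u + ∑ k_β ⟨v, β^∨⟩ s_β w ⊗ u`, the sum over `β > 0` with `w⁻¹(β) < 0`. -/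
def dunkl (σ : Cx V₀ →ₗ[ℂ] Module.End A E) :
    Cx V₀ →ₗ[ℂ] Module.End A (weyl b Set.univ → E) where
  toFun v :=
    { toFun := fun F w => σ (cxMap (w⁻¹ : V₀ ≃ₗ[ℝ] V₀) v) (F w) +
        ∑ i, if IsPos b i ∧ PosVec b ((w⁻¹ : V₀ ≃ₗ[ℝ] V₀) (P.root i)) then
          (rootParam k i * cxCoroot P i v) • F (reflW b i * w) else 0
      map_add' := fun F G => by
        ext w
        simp only [Pi.add_apply, map_add, smul_add]
        rw [add_add_add_comm, ← Finset.sum_add_distrib]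
        congr 2
        ext i
        split_ifs <;> simp
      map_smul' := fun c F => by
        ext w
        simp only [Pi.smul_apply, map_smul, RingHom.id_apply, smul_add, Finset.smul_sum]
        congr 2
        ext i
        split_ifs
        · rw [smul_comm]
        · simp }
  map_add' v v' := by
    refine LinearMap.ext fun F => funext fun w => ?_
    simp only [LinearMap.add_apply, Pi.add_apply, map_add, LinearMap.coe_mk, AddHom.coe_mk]
    rw [add_add_add_comm, ← Finset.sum_add_distrib]
    congr 2
    ext i
    split_ifs
    · rw [mul_add, add_smul]
    · simp
  map_smul' c v := by
    refine LinearMap.ext fun F => funext fun w => ?_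
    simp only [LinearMap.smul_apply, Pi.smul_apply, map_smul, LinearMap.coe_mk, AddHom.coe_mk,
      RingHom.id_apply, smul_add, Finset.smul_sum]
    congr 2
    ext i
    split_ifs
    · rw [smul_eq_mul, mul_left_comm, mul_smul]
    · simp

open Classical in
lemma dunkl_apply (σ : Cx V₀ →ₗ[ℂ] Module.End A E) (v : Cx V₀) (F : weyl b Set.univ → E)
    (w : weyl b Set.univ) : dunkl k σ v F w = σ (cxMap (w⁻¹ : V₀ ≃ₗ[ℝ] V₀) v) (F w) +
        ∑ i, if IsPos b i ∧ PosVec b ((w⁻¹ : V₀ ≃ₗ[ℝ] V₀) (P.root i)) then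
          (rootParam k i * cxCoroot P i v) • F (reflW b i * w) else 0 := rfl

open Classical in
lemma dunkl_single (σ : Cx V₀ →ₗ[ℂ] Module.End A E) (v : Cx V₀) (u : E) :
    dunkl k σ v (Pi.single 1 u) = Pi.single 1 (σ v u) := by
  ext w
  rw [dunkl_apply]
  have h0 : (∑ i, if IsPos b i ∧ PosVec b ((w⁻¹ : V₀ ≃ₗ[ℝ] V₀) (P.root i)) then
      (rootParam k i * cxCoroot P i v) •
        (Pi.single 1 u : weyl b Set.univ → E) (reflW b i * w) else 0) = 0 := by
    refine Finset.sum_eq_zero fun i _ => ?_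
    split_ifs with h
    · by_cases hk : rootParam k i = 0
      · rw [hk, zero_mul, zero_smul]
      rw [Pi.single_eq_of_ne, smul_zero]
      intro hw
      have h1 : (w⁻¹ : V₀ ≃ₗ[ℝ] V₀) = P.reflection i := by
        rw [← reflW_val (refl_mem_of_rootParam_ne_zero k hk), mul_eq_one_iff_eq_inv.1 hw]
        simp
      rw [h1, RootPairing.reflection_apply_self] at h
      exact not_posVec_neg b h.1 h.2
    · rfl
  rw [h0, add_zero]
  by_cases hw : w = 1
  · subst hw
    rw [Pi.single_eq_same, Pi.single_eq_same]
    simp [cxMap_one]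
  · rw [Pi.single_eq_of_ne hw, Pi.single_eq_of_ne hw, map_zero]

variable [P.IsReduced]

lemma isPos_reflectionPerm_iff (α : b.support) {i : ι} (h : P.root i ≠ P.root α)
    (h' : P.root i ≠ -P.root α) : IsPos b (P.reflectionPerm α i) ↔ IsPos b i := by
  refine ⟨fun hp => ?_, fun hi => isPos_reflection b hi α h⟩
  by_contra hn
  have h1 : P.root (P.reflectionPerm i i) = -P.root i := by
    rw [P.root_reflectionPerm, RootPairing.reflection_apply_self]
  have h2 : IsPos b (P.reflectionPerm i i) := (isPos_or b i).resolve_left hn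
  have h3 := isPos_reflection b h2 α (by rw [h1]; intro hc; exact h' (by rw [← hc, neg_neg]))
  refine not_posVec_neg b (i := P.reflectionPerm α i) hp ?_
  rw [P.root_reflectionPerm, ← map_neg, ← h1, ← P.root_reflectionPerm]
  exact h3

/-- The operators `dunkl v` and the translations satisfy the cross relations of `ℍ`: the reflection
`s_α` permutes the positive roots other than `α`, so that only the term of `α` remains. -/
lemma dunkl_cross (σ : Cx V₀ →ₗ[ℂ] Module.End A E) (α : b.support) (v : Cx V₀) :
    transl b A E (sRefl (Set.mem_univ α)) * dunkl k σ v -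
      dunkl k σ (cxMap (P.reflection α) v) * transl b A E (sRefl (Set.mem_univ α)) =
    algebraMap ℂ _ (k.val α * cxCoroot P α v) := by
  classical
  refine LinearMap.ext fun F => funext fun w => ?_
  set s : weyl b Set.univ := sRefl (Set.mem_univ α) with hs
  have hsv : (s : V₀ ≃ₗ[ℝ] V₀) = P.reflection α := rfl
  have hss : s * s = 1 := Subtype.ext (refl_mul_refl _)
  have hsi : s⁻¹ = s := inv_eq_of_mul_eq_one_left hss
  have hα' : P.root (P.reflectionPerm α α) = -P.root α := by
    rw [P.root_reflectionPerm, RootPairing.reflection_apply_self]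
  set T : ι → E := fun i => (rootParam k i * cxCoroot P i v) • F (reflW b i * (s * w)) with hT
  set Q : ι → Prop := fun i => PosVec b ((w⁻¹ : V₀ ≃ₗ[ℝ] V₀) (P.reflection α (P.root i))) with hQ
  have e1 : (transl b A E s * dunkl k σ v) F w =
      σ (cxMap ((s * w : weyl b Set.univ)⁻¹ : V₀ ≃ₗ[ℝ] V₀) v) (F (s * w)) +
        ∑ i, if IsPos b i ∧ Q i then T i else 0 := by
    rw [Module.End.mul_apply, transl_apply, hsi, dunkl_apply]
    have h1 : ∀ i, PosVec b (((s * w : weyl b Set.univ)⁻¹ : V₀ ≃ₗ[ℝ] V₀) (P.root i)) ↔ Q i := by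
      intro i
      rw [hQ, Subgroup.coe_mul, mul_inv_rev, LinearEquiv.mul_apply, hsv, RootPairing.reflection_inv]
    simp only [h1, hT]
  have e2 : (dunkl k σ (cxMap (P.reflection α) v) * transl b A E s) F w =
      σ (cxMap ((s * w : weyl b Set.univ)⁻¹ : V₀ ≃ₗ[ℝ] V₀) v) (F (s * w)) +
        ∑ i, if IsPos b (P.reflectionPerm α i) ∧ Q i then T i else 0 := by
    rw [Module.End.mul_apply, dunkl_apply, transl_apply, hsi]
    congr 1
    · rw [← cxMap_mul, Subgroup.coe_mul, mul_inv_rev, hsv, RootPairing.reflection_inv]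
    rw [← (P.reflectionPerm α).sum_comp]
    refine Finset.sum_congr rfl fun i _ => ?_
    rw [P.root_reflectionPerm]
    by_cases hk : rootParam k i = 0
    · simp only [rootParam_reflectionPerm, hT, hk, zero_mul, zero_smul, ite_self]
    have hm := refl_mem_of_rootParam_ne_zero k hk
    have hm' := refl_mem_of_rootParam_ne_zero k (i := P.reflectionPerm α i)
      (by rwa [rootParam_reflectionPerm])
    have h1 : reflW b (P.reflectionPerm α i) = s * reflW b i * s := by
      apply Subtype.ext
      rw [reflW_val hm', Subgroup.coe_mul, Subgroup.coe_mul, reflW_val hm, hsv,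
        RootPairing.reflection_reflectionPerm]
    have h2 : transl b A E s F (reflW b (P.reflectionPerm α i) * w) = F (reflW b i * (s * w)) := by
      rw [transl_apply, hsi, h1]
      simp only [← mul_assoc, hss, one_mul]
    have h3 : cxCoroot P (P.reflectionPerm α i) (cxMap (P.reflection α) v) = cxCoroot P i v := by
      rw [cxCoroot_reflectionPerm, cxMap_refl_refl]
    rw [h2, h3, rootParam_reflectionPerm]
  have hne : (α : ι) ≠ P.reflectionPerm α α := fun hc => by
    have := congrArg P.root hc
    rw [hα'] at this
    exact not_posVec_neg b (posVec_simple b α) (by rw [← this]; exact posVec_simple b α)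
  have hpα : IsPos b (α : ι) := posVec_simple b α
  have hpα' : ¬ IsPos b (P.reflectionPerm α α) := fun hc =>
    not_posVec_neg b (posVec_simple b α) (by rw [← hα']; exact hc)
  have hTα : T α = (k.val α * cxCoroot P α v) • F w := by
    rw [hT]
    simp only
    have h1 : reflW b (α : ι) = s := Subtype.ext (reflW_val s.2)
    rw [rootParam_simple, h1, ← mul_assoc, hss, one_mul]
  have hTα' : T (P.reflectionPerm α α) = -T α := by
    rw [hT]
    simp only
    have h0 : P.reflection (P.reflectionPerm α α) = P.reflection α := by
      rw [RootPairing.reflection_reflectionPerm, refl_mul_refl, one_mul]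
    have h1 : reflW b (P.reflectionPerm α α) = reflW b (α : ι) := by
      apply Subtype.ext
      rw [reflW_val s.2, reflW_val (by rw [h0]; exact s.2), h0]
    rw [rootParam_reflectionPerm, h1, cxCoroot_reflectionPerm, cxCoroot_refl, mul_neg, neg_smul]
  have hQQ : Q (P.reflectionPerm α α) ↔ ¬ Q α := by
    simp only [hQ]
    rw [hα', map_neg, map_neg, RootPairing.reflection_apply_self]
    obtain ⟨j, hj, -⟩ := weyl_root b (inv_mem w.2) α
    rw [map_neg, hj, neg_neg, posVec_neg_iff, not_not]
  rw [LinearMap.sub_apply, Pi.sub_apply, e1, e2, add_sub_add_left_eq_sub, ← Finset.sum_sub_distrib,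
    Finset.sum_eq_add (α : ι) (P.reflectionPerm α α) hne]
  · rw [P.reflectionPerm_self, hTα']
    have h1 : algebraMap ℂ (Module.End A (weyl b Set.univ → E)) (k.val α * cxCoroot P α v) F w =
        T α := by rw [hTα]; rfl
    rw [h1]
    by_cases hq : Q α
    · simp [hpα, hpα', hQQ, hq]
    · simp [hpα, hpα', hQQ, hq]
  · rintro i - ⟨h1, h2⟩
    rw [isPos_reflectionPerm_iff α (fun hc => h1 (P.root.injective hc))
      (fun hc => h2 (P.root.injective (hc.trans hα'.symm))), sub_self]
  · exact fun h => absurd (Finset.mem_univ _) h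
  · exact fun h => absurd (Finset.mem_univ _) h

end Regular


/-! ### Coordinates on induced modules -/

section IndRep

set_option linter.unusedSectionVars false

variable {ι V₀ N : Type*} [Fintype ι] [AddCommGroup V₀] [Module ℝ V₀] [AddCommGroup N] [Module ℝ N]
  {P : RootPairing ι ℝ V₀ N} {b : SimpleRoots P} {k : Param b} {J : Set b.support}
  {A E : Type*} [CommRing A] [Algebra ℂ A] [AddCommGroup E] [Module ℂ E] [Module A E]
  [IsScalarTower ℂ A E] [P.IsReduced]

instance (J : Set b.support) : Finite (minReps b J) :=
  ((finite_weyl b Set.univ).subset fun _ hw => hw.1).to_subtype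

instance (J : Set b.support) : Fintype (minReps b J) := Fintype.ofFinite _

lemma comm_aux {B : Type*} [Ring B] [Algebra ℂ B] {T D D' X : B} {c a a' : ℂ}
    (h : T * D = (D - a • X) * T + algebraMap ℂ B (c * a))
    (h' : T * D' = (D' - a' • X) * T + algebraMap ℂ B (c * a')) :
    T * (D * D' - D' * D) = ((D - a • X) * (D' - a' • X) - (D' - a' • X) * (D - a • X)) * T := by
  have e1 : T * (D * D') = (D - a • X) * (D' - a' • X) * T + ((c * a') • (D - a • X) +
      (c * a) • D') := by
    rw [← mul_assoc, h, add_mul, mul_assoc, h', mul_add, ← Algebra.smul_def, ← Algebra.commutes,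
      ← Algebra.smul_def, mul_assoc, add_assoc]
  have e2 : T * (D' * D) = (D' - a' • X) * (D - a • X) * T + ((c * a) • (D' - a' • X) +
      (c * a') • D) := by
    rw [← mul_assoc, h', add_mul, mul_assoc, h, mul_add, ← Algebra.smul_def, ← Algebra.commutes,
      ← Algebra.smul_def, mul_assoc, add_assoc]
  rw [mul_sub, e1, e2, sub_mul ((D - a • X) * (D' - a' • X))]
  module

open Classical in
lemma eq_sum_transl (F : weyl b Set.univ → E) :
    F = ∑ w, transl b A E w (Pi.single 1 (F w)) := by
  ext w
  simp only [transl_single, mul_one]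
  rw [Finset.sum_apply, Finset.sum_eq_single w]
  · simp
  · intro w' _ h
    rw [Pi.single_eq_of_ne h.symm]
  · simp

/-- The operators `dunkl v` commute. The commutator of two of them commutes with the translations up
to a change of the two vectors, by the cross relations, so that it vanishes because it does on the
functions supported at `1`, where `dunkl` is the given action of `V`. -/
lemma dunkl_comm (k : Param b) (σ : Cx V₀ →ₗ[ℂ] Module.End A E)
    (hσ : ∀ x y, σ x * σ y = σ y * σ x) (x y : Cx V₀) :
    dunkl k σ x * dunkl k σ y = dunkl k σ y * dunkl k σ x := by
  classical
  -- the commutators of the operators of `V` are permuted by `W`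
  have hT : ∀ (w : weyl b Set.univ) (x y : Cx V₀), transl b A E w *
      (dunkl k σ x * dunkl k σ y - dunkl k σ y * dunkl k σ x) =
      (dunkl k σ (cxMap w x) * dunkl k σ (cxMap w y) -
        dunkl k σ (cxMap w y) * dunkl k σ (cxMap w x)) * transl b A E w := by
    intro w
    induction w using t_sRefl_induction with
    | one => intro x y; simp [cxMap_one]
    | mul α hα w ih =>
      intro x y
      rw [map_mul, mul_assoc, ih, ← mul_assoc]
      have hs : ∀ v, transl b A E (sRefl (Set.mem_univ α)) * dunkl k σ v =
          (dunkl k σ v - cxCoroot P α v • dunkl k σ (cxRoot P α)) *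
            transl b A E (sRefl (Set.mem_univ α)) +
            algebraMap ℂ _ (k.val α * cxCoroot P α v) := by
        intro v
        have := dunkl_cross k σ α v
        rw [sub_eq_iff_eq_add, add_comm, cxMap_reflection, map_sub, map_smul] at this
        exact this
      have hv : ∀ v, dunkl k σ v - cxCoroot P α v • dunkl k σ (cxRoot P α) =
          dunkl k σ (cxMap (P.reflection α) v) := by
        intro v
        rw [cxMap_reflection, map_sub, map_smul]
      have := comm_aux (hs (cxMap w x)) (hs (cxMap w y))
      rw [hv, hv] at this
      rw [this, mul_assoc, ← cxMap_mul, ← cxMap_mul]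
      rfl
  rw [← sub_eq_zero]
  refine LinearMap.ext fun F => ?_
  rw [eq_sum_transl (A := A) F, map_sum]
  refine Finset.sum_eq_zero fun w _ => ?_
  have h1 := hT w (cxMap (w⁻¹ : V₀ ≃ₗ[ℝ] V₀) x) (cxMap (w⁻¹ : V₀ ≃ₗ[ℝ] V₀) y)
  rw [cxMap_inv_right, cxMap_inv_right] at h1
  rw [← Module.End.mul_apply, ← h1, Module.End.mul_apply, LinearMap.sub_apply,
    Module.End.mul_apply, Module.End.mul_apply, dunkl_single, dunkl_single, dunkl_single,
    dunkl_single, ← Module.End.mul_apply, hσ, Module.End.mul_apply, sub_self, map_zero]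

/-- The action of `V` in a representation of `ℍ_J`. -/
def vecAct (ρ : HJ k J →ₐ[ℂ] Module.End A E) : Cx V₀ →ₗ[ℂ] Module.End A E :=
  ρ.toLinearMap ∘ₗ HeckeAlg.f.toLinearMap ∘ₗ SymmetricAlgebra.ι ℂ (Cx V₀)

lemma vecAct_apply (ρ : HJ k J →ₐ[ℂ] Module.End A E) (v : Cx V₀) :
    vecAct ρ v = ρ (vec k J v) := rfl

/-- The representation of `ℍ` induced from a representation of `S(V)`. -/
def regRep (ρ : HJ k J →ₐ[ℂ] Module.End A E) :
    HH k →ₐ[ℂ] Module.End A (weyl b Set.univ → E) :=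
  HeckeAlg.lift (transl b A E) (symLift (dunkl k (vecAct ρ)) (dunkl_comm k _ fun x y => by
    rw [vecAct_apply, vecAct_apply, ← map_mul, vec_mul_vec, map_mul])) (by
    intro α _ v
    rw [symLift_ι, symLift_ι]
    exact dunkl_cross k _ α v)

lemma regRep_t (ρ : HJ k J →ₐ[ℂ] Module.End A E) (w : weyl b Set.univ) :
    regRep ρ (HeckeAlg.t w) = transl b A E w := HeckeAlg.lift_t _ _ _ w

lemma regRep_vec (ρ : HJ k J →ₐ[ℂ] Module.End A E) (v : Cx V₀) :
    regRep ρ (vec k Set.univ v) = dunkl k (vecAct ρ) v :=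
  (HeckeAlg.lift_f _ _ _ _).trans (symLift_ι _ _ v)

/-- The inclusion `W_J → W`. -/
def weylIncl (J : Set b.support) : weyl b J →* weyl b Set.univ :=
  Subgroup.inclusion (weyl_mono b (Set.subset_univ J))

/-- An element of `W^J`, as an element of `W`. -/
def repW (y : minReps b J) : weyl b Set.univ := ⟨y, y.2.1⟩

lemma exists_repW_mul (J : Set b.support) (w : weyl b Set.univ) : ∃ (y : minReps b J) (x : weyl b J),
    w = repW y * weylIncl J x ∧ len b y ≤ len b w := by
  obtain ⟨y, hy, x, hx, h, hl⟩ := exists_minReps_mul b J w.2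
  exact ⟨⟨y, hy⟩, ⟨x, hx⟩, Subtype.ext h, hl⟩

lemma repW_mul_inj {y y' : minReps b J} {x x' : weyl b J}
    (h : repW y * weylIncl J x = repW y' * weylIncl J x') : y = y' ∧ x = x' := by
  obtain ⟨h1, h2⟩ := minReps_unique b y.2 y'.2 x.2 x'.2 (congrArg Subtype.val h)
  exact ⟨Subtype.ext h1, Subtype.ext h2⟩

/-- The map `F ↦ (w ↦ ∑ t_x F(w x))`, the sum over `x ∈ W_J`. -/
def avg (ρ : HJ k J →ₐ[ℂ] Module.End A E) :
    (weyl b Set.univ → E) →ₗ[A] (weyl b Set.univ → E) :=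
  LinearMap.pi fun w => ∑ x : weyl b J, ρ (HeckeAlg.t x) ∘ₗ LinearMap.proj (w * weylIncl J x)

lemma avg_apply (ρ : HJ k J →ₐ[ℂ] Module.End A E) (F : weyl b Set.univ → E)
    (w : weyl b Set.univ) :
    avg ρ F w = ∑ x : weyl b J, ρ (HeckeAlg.t x) (F (w * weylIncl J x)) := by
  simp [avg]

lemma avg_mul (ρ : HJ k J →ₐ[ℂ] Module.End A E) (F : weyl b Set.univ → E)
    (w : weyl b Set.univ) (x : weyl b J) :
    avg ρ F w = ρ (HeckeAlg.t x) (avg ρ F (w * weylIncl J x)) := by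
  rw [avg_apply, avg_apply, map_sum,
    ← Equiv.sum_comp (Equiv.mulLeft x) fun z => ρ (HeckeAlg.t z) (F (w * weylIncl J z))]
  refine Finset.sum_congr rfl fun z _ => ?_
  rw [Equiv.coe_mulLeft, map_mul, map_mul, map_mul, Module.End.mul_apply, mul_assoc]

lemma avg_transl (ρ : HJ k J →ₐ[ℂ] Module.End A E) (F : weyl b Set.univ → E)
    (g w : weyl b Set.univ) : avg ρ (transl b A E g F) w = avg ρ F (g⁻¹ * w) := by
  simp only [avg_apply, transl_apply, mul_assoc]

/-- The coordinates, indexed by `W^J`, of the class of a function `W → E` in the module induced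
from a representation of `ℍ_J`; this module is the quotient of the one induced from `S(V)` by the
kernel of the coordinate map. -/
def coord (ρ : HJ k J →ₐ[ℂ] Module.End A E) : (weyl b Set.univ → E) →ₗ[A] (minReps b J → E) :=
  LinearMap.funLeft A E repW ∘ₗ avg ρ

lemma coord_apply (ρ : HJ k J →ₐ[ℂ] Module.End A E) (F : weyl b Set.univ → E) (y : minReps b J) :
    coord ρ F y = avg ρ F (repW y) := rfl

open Classical in
lemma coord_single (ρ : HJ k J →ₐ[ℂ] Module.End A E) (y : minReps b J) (x : weyl b J) (u : E) :
    coord ρ (Pi.single (repW y * weylIncl J x) u) = Pi.single y (ρ (HeckeAlg.t x) u) := by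
  ext y'
  rw [coord_apply, avg_apply]
  by_cases h : y' = y
  · subst h
    rw [Pi.single_eq_same, Finset.sum_eq_single x, Pi.single_eq_same]
    · intro x' _ hx'
      rw [Pi.single_eq_of_ne, map_zero]
      exact fun hc => hx' (repW_mul_inj hc).2
    · simp
  · rw [Pi.single_eq_of_ne h]
    refine Finset.sum_eq_zero fun x' _ => ?_
    rw [Pi.single_eq_of_ne, map_zero]
    exact fun hc => h (repW_mul_inj hc).1

open Classical in
lemma coord_single_rep (ρ : HJ k J →ₐ[ℂ] Module.End A E) (y : minReps b J) (u : E) :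
    coord ρ (Pi.single (repW y) u) = Pi.single y u := by
  have := coord_single ρ y 1 u
  rwa [map_one, mul_one, map_one, map_one, Module.End.one_apply] at this

open Classical in
/-- The function `W → E` with given values on `W^J` and zero elsewhere. -/
def extend (J : Set b.support) (A E : Type*) [CommRing A] [AddCommGroup E] [Module A E] :
    (minReps b J → E) →ₗ[A] (weyl b Set.univ → E) :=
  ∑ y : minReps b J, LinearMap.single A (fun _ => E) (repW y) ∘ₗ LinearMap.proj y

open Classical in
lemma extend_single (y : minReps b J) (u : E) :
    extend J A E (Pi.single y u) = Pi.single (repW y) u := by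
  rw [extend, LinearMap.sum_apply, Finset.sum_eq_single y]
  · simp
  · intro y' _ h
    simp [Pi.single_eq_of_ne h]
  · simp

lemma eq_sum_single {κ : Type*} [Fintype κ] [DecidableEq κ] (G : κ → E) : G = ∑ y, Pi.single y (G y) :=
  (Finset.univ_sum_single G).symm

lemma coord_extend (ρ : HJ k J →ₐ[ℂ] Module.End A E) (G : minReps b J → E) :
    coord ρ (extend J A E G) = G := by
  classical
  conv_rhs => rw [eq_sum_single G]
  conv_lhs => rw [eq_sum_single G]
  rw [map_sum, map_sum]
  exact Finset.sum_congr rfl fun y _ => by rw [extend_single, coord_single_rep]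

lemma transl_mem_ker (ρ : HJ k J →ₐ[ℂ] Module.End A E) {F : weyl b Set.univ → E}
    (hF : F ∈ LinearMap.ker (coord ρ)) (g : weyl b Set.univ) :
    transl b A E g F ∈ LinearMap.ker (coord ρ) := by
  have h : ∀ w, avg ρ F w = 0 := by
    intro w
    obtain ⟨y, x, rfl, -⟩ := exists_repW_mul J w
    have h1 := avg_mul ρ F (repW y * weylIncl J x) x⁻¹
    rw [map_inv (weylIncl J), mul_inv_cancel_right] at h1
    rw [h1]
    have h2 : avg ρ F (repW y) = 0 := congrFun (LinearMap.mem_ker.1 hF) y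
    rw [h2, map_zero]
  refine LinearMap.mem_ker.2 (funext fun y => ?_)
  rw [coord_apply, avg_transl, h]
  rfl

/-- The largest subspace of the kernel of the coordinate map which `V` maps to the kernel. -/
def kerCore (ρ : HJ k J →ₐ[ℂ] Module.End A E) : Submodule A (weyl b Set.univ → E) :=
  LinearMap.ker (coord ρ) ⊓ ⨅ v, (LinearMap.ker (coord ρ)).comap (dunkl k (vecAct ρ) v)

lemma mem_kerCore {ρ : HJ k J →ₐ[ℂ] Module.End A E} {F : weyl b Set.univ → E} :
    F ∈ kerCore ρ ↔ F ∈ LinearMap.ker (coord ρ) ∧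
      ∀ v, dunkl k (vecAct ρ) v F ∈ LinearMap.ker (coord ρ) := by
  simp [kerCore, Submodule.mem_iInf]

lemma transl_mem_kerCore {ρ : HJ k J →ₐ[ℂ] Module.End A E} {F : weyl b Set.univ → E}
    (hF : F ∈ kerCore ρ) (w : weyl b Set.univ) : transl b A E w F ∈ kerCore ρ := by
  induction w using t_sRefl_induction with
  | one => rwa [map_one]
  | mul α hα w ih =>
    rw [map_mul, Module.End.mul_apply]
    set G := transl b A E w F
    rw [mem_kerCore] at ih ⊢
    refine ⟨transl_mem_ker ρ ih.1 _, fun v => ?_⟩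
    have h := dunkl_cross k (vecAct ρ) α (cxMap (P.reflection α) v)
    rw [cxMap_refl_refl, sub_eq_iff_eq_add, ← sub_eq_iff_eq_add'] at h
    rw [← Module.End.mul_apply]
    have h2 : sRefl hα = sRefl (Set.mem_univ α) := rfl
    rw [h2, ← h, LinearMap.sub_apply, Module.End.mul_apply]
    refine sub_mem (transl_mem_ker ρ (ih.2 _) _) ?_
    rw [Module.algebraMap_end_apply, ← algebraMap_smul A]
    exact Submodule.smul_mem _ _ ih.1

open Classical in
/-- The elements `x ⊗ u - 1 ⊗ t_x u`, whose translates span the kernel of the coordinate map, are mapped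
by `V` to this kernel. The relation `v t_{s_α} = t_{s_α} s_α(v) + k_α ⟨v, α^∨⟩` holds both for `dunkl` and in
`ℍ_J`; the general case follows by induction on the word of `x`. -/
lemma single_sub_single_mem_kerCore (ρ : HJ k J →ₐ[ℂ] Module.End A E) (x : weyl b J) (u : E) :
    (Pi.single (weylIncl J x) u - Pi.single 1 (ρ (HeckeAlg.t x) u) : weyl b Set.univ → E) ∈
      kerCore ρ := by
  have hker : ∀ (x : weyl b J) (u : E),
      (Pi.single (weylIncl J x) u - Pi.single 1 (ρ (HeckeAlg.t x) u) : weyl b Set.univ → E) ∈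
        LinearMap.ker (coord ρ) := by
    intro x u
    have h1 := coord_single ρ ⟨1, one_mem_minReps b J⟩ x u
    have h2 := coord_single_rep ρ ⟨1, one_mem_minReps b J⟩ (ρ (HeckeAlg.t x) u)
    have h3 : repW (⟨1, one_mem_minReps b J⟩ : minReps b J) = 1 := rfl
    rw [h3, one_mul] at h1
    rw [h3] at h2
    rw [LinearMap.mem_ker, map_sub, h1, h2, sub_self]
  induction x using t_sRefl_induction generalizing u with
  | one => simp
  | mul α hα x ih =>
    have hs : weylIncl J (sRefl hα) = sRefl (Set.mem_univ α) := rfl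
    have h1 : (Pi.single (weylIncl J (sRefl hα)) (ρ (HeckeAlg.t x) u) -
        Pi.single 1 (ρ (HeckeAlg.t (sRefl hα)) (ρ (HeckeAlg.t x) u)) : weyl b Set.univ → E) ∈
        kerCore ρ := by
      refine mem_kerCore.2 ⟨hker _ _, fun v => ?_⟩
      set u' := ρ (HeckeAlg.t x) u
      have h2 := dunkl_cross k (vecAct ρ) α (cxMap (P.reflection α) v)
      rw [cxMap_refl_refl, sub_eq_iff_eq_add, ← sub_eq_iff_eq_add'] at h2
      have h3 : (Pi.single (weylIncl J (sRefl hα)) u' : weyl b Set.univ → E) =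
          transl b A E (sRefl (Set.mem_univ α)) (Pi.single 1 u') := by
        rw [transl_single, mul_one, hs]
      have h4 := congrArg (fun h => ρ h u') (vec_mul_t_sRefl (k := k) hα v)
      simp only [map_mul, map_add, Module.End.mul_apply, LinearMap.add_apply, AlgHom.commutes,
        Module.algebraMap_end_apply] at h4
      rw [map_sub, h3, ← Module.End.mul_apply, ← h2, LinearMap.sub_apply, Module.End.mul_apply,
        dunkl_single, dunkl_single, vecAct_apply, vecAct_apply, h4, Module.algebraMap_end_apply,
        transl_single, mul_one, cxCoroot_refl]
      have h5 := hker (sRefl hα) (ρ (vec k J (cxMap (P.reflection α) v)) u')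
      rw [hs] at h5
      convert h5 using 1
      rw [Pi.single_add, mul_neg, neg_smul, smul_smul, Pi.single_smul]
      abel
    have h2 := transl_mem_kerCore (ih u) (sRefl (Set.mem_univ α))
    rw [map_sub, transl_single, transl_single, mul_one, ← hs, ← map_mul] at h2
    have h3 := add_mem h2 h1
    rwa [sub_add_sub_cancel, ← Module.End.mul_apply, ← map_mul, ← map_mul] at h3

/-- The kernel of the coordinate map is stable under `V`, hence under `ℍ`; so the induced
representation is defined on the coordinates. -/
lemma ker_le_kerCore (ρ : HJ k J →ₐ[ℂ] Module.End A E) :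
    LinearMap.ker (coord ρ) ≤ kerCore ρ := by
  classical
  intro F hF
  have h1 : F = ∑ w, (Pi.single w (F w) - extend J A E (coord ρ (Pi.single w (F w)))) := by
    rw [Finset.sum_sub_distrib, ← map_sum, ← map_sum, Finset.univ_sum_single,
      LinearMap.mem_ker.1 hF, map_zero, sub_zero]
  rw [h1]
  refine sum_mem fun w _ => ?_
  obtain ⟨y, x, hw, -⟩ := exists_repW_mul J w
  have h2 := transl_mem_kerCore (single_sub_single_mem_kerCore ρ x (F w)) (repW y)
  rwa [map_sub, transl_single, transl_single, mul_one, ← extend_single (A := A), ← coord_single,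
    ← hw] at h2

lemma regRep_mem_ker (ρ : HJ k J →ₐ[ℂ] Module.End A E) (h : HH k) {F : weyl b Set.univ → E}
    (hF : F ∈ LinearMap.ker (coord ρ)) : regRep ρ h F ∈ LinearMap.ker (coord ρ) := by
  induction h using HJ.induction generalizing F with
  | algebraMap c =>
    rw [AlgHom.commutes, Module.algebraMap_end_apply, ← algebraMap_smul A]
    exact Submodule.smul_mem _ _ hF
  | refl α hα => rw [regRep_t]; exact transl_mem_ker ρ hF _
  | vec v => rw [regRep_vec]; exact (mem_kerCore.1 (ker_le_kerCore ρ hF)).2 v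
  | mul x y hx hy => rw [map_mul]; exact hx (hy hF)
  | add x y hx hy => rw [map_add]; exact add_mem (hx hF) (hy hF)

lemma coord_regRep (ρ : HJ k J →ₐ[ℂ] Module.End A E) (h : HH k) (F : weyl b Set.univ → E) :
    coord ρ (regRep ρ h (extend J A E (coord ρ F))) = coord ρ (regRep ρ h F) := by
  rw [← sub_eq_zero, ← map_sub, ← map_sub, ← LinearMap.mem_ker]
  refine regRep_mem_ker ρ h ?_
  rw [LinearMap.mem_ker, map_sub, coord_extend, sub_self]

/-- The representation of `ℍ` induced from a representation of `ℍ_J` on `E`, in coordinates: the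
function `F : W^J → E` stands for `∑ t_y ⊗ F(y)`. -/
def indRep (ρ : HJ k J →ₐ[ℂ] Module.End A E) : HH k →ₐ[ℂ] Module.End A (minReps b J → E) :=
  AlgHom.ofLinearMap
    { toFun := fun h => coord ρ ∘ₗ regRep ρ h ∘ₗ extend J A E
      map_add' := fun h h' => by
        refine LinearMap.ext fun F => ?_
        simp
      map_smul' := fun c h => by
        refine LinearMap.ext fun F => ?_
        simp only [map_smul, LinearMap.comp_apply, LinearMap.smul_apply, RingHom.id_apply]
        rw [← algebraMap_smul A, map_smul, algebraMap_smul] }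
    (by
      refine LinearMap.ext fun F => ?_
      simp [coord_extend])
    (fun h h' => by
      refine LinearMap.ext fun F => ?_
      simp only [LinearMap.coe_mk, AddHom.coe_mk, LinearMap.comp_apply, Module.End.mul_apply,
        map_mul]
      rw [coord_regRep])

lemma indRep_apply (ρ : HJ k J →ₐ[ℂ] Module.End A E) (h : HH k) (G : minReps b J → E) :
    indRep ρ h G = coord ρ (regRep ρ h (extend J A E G)) := rfl

/-- The translation by `g` on the induced module, in coordinates. -/
lemma indRep_t_apply (ρ : HJ k J →ₐ[ℂ] Module.End A E) {g : weyl b Set.univ} {y y' : minReps b J}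
    {x : weyl b J} (h : g * repW y' = repW y * weylIncl J x) (G : minReps b J → E) :
    indRep ρ (HeckeAlg.t g) G y = ρ (HeckeAlg.t x) (G y') := by
  have h1 : g⁻¹ * repW y * weylIncl J x = repW y' := by
    rw [mul_assoc, ← h, inv_mul_cancel_left]
  rw [indRep_apply, regRep_t, coord_apply, avg_transl, avg_mul ρ _ _ x, h1, ← coord_apply,
    coord_extend]

open Classical in
lemma indRep_t_single (ρ : HJ k J →ₐ[ℂ] Module.End A E) {g : weyl b Set.univ} {y y' : minReps b J}
    {x : weyl b J} (h : g * repW y' = repW y * weylIncl J x) (u : E) :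
    indRep ρ (HeckeAlg.t g) (Pi.single y' u) = Pi.single y (ρ (HeckeAlg.t x) u) := by
  rw [indRep_apply, extend_single, regRep_t, transl_single, h, coord_single]

/-- The unit element of `W^J`. -/
def oneRep (J : Set b.support) : minReps b J := ⟨1, one_mem_minReps b J⟩

lemma repW_oneRep : repW (oneRep J) = 1 := rfl

open Classical in
lemma single_eq_indRep (ρ : HJ k J →ₐ[ℂ] Module.End A E) (y : minReps b J) (u : E) :
    Pi.single y u = indRep ρ (HeckeAlg.t (repW y)) (Pi.single (oneRep J) u) := by
  rw [indRep_t_single ρ (y := y) (y' := oneRep J) (x := 1) (by rw [repW_oneRep, map_one]), map_one,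
    map_one, Module.End.one_apply]

open Classical in
/-- The embedding `u ↦ 1 ⊗ u` in the induced module is `ℍ_J`-linear. -/
lemma indRep_incl_single (ρ : HJ k J →ₐ[ℂ] Module.End A E) (h : HJ k J) (u : E) :
    indRep ρ (incl k J h) (Pi.single (oneRep J) u) = Pi.single (oneRep J) (ρ h u) := by
  induction h using HJ.induction generalizing u with
  | algebraMap c =>
    rw [AlgHom.commutes, AlgHom.commutes, AlgHom.commutes, Module.algebraMap_end_apply,
      Module.algebraMap_end_apply, Pi.single_smul]
  | refl α hα =>
    have : incl k J (HeckeAlg.t (sRefl hα)) = HeckeAlg.t (weylIncl J (sRefl hα)) :=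
      HeckeAlg.lift_t _ _ _ _
    rw [this, indRep_t_single ρ (y := oneRep J) (x := sRefl hα)
      (by rw [repW_oneRep, one_mul, mul_one])]
  | vec v =>
    have : incl k J (vec k J v) = vec k Set.univ v := HeckeAlg.lift_f _ _ _ _
    rw [this, indRep_apply, extend_single, regRep_vec, repW_oneRep, dunkl_single, ← repW_oneRep,
      coord_single_rep, vecAct_apply]
  | mul x y hx hy => rw [map_mul, map_mul, Module.End.mul_apply, hy, hx, map_mul]; rfl
  | add x y hx hy =>
    rw [map_add, map_add, LinearMap.add_apply, hx, hy, map_add, LinearMap.add_apply, Pi.single_add]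

end IndRep


/-! ### The length filtration of an induced module -/

section PolynomialOperators

open Polynomial

lemma aeval_apply_mem {A M : Type*} [CommRing A] [AddCommGroup M] [Module A M] (S : Submodule A M)
    {D : Module.End A M} (hD : ∀ x ∈ S, D x ∈ S) (Q : A[X]) {x : M} (hx : x ∈ S) :
    aeval D Q x ∈ S := by
  induction Q using Polynomial.induction_on generalizing x with
  | C a => rw [aeval_C, Module.algebraMap_end_apply]; exact S.smul_mem _ hx
  | add p q hp hq => rw [map_add]; exact S.add_mem (hp hx) (hq hx)
  | monomial n a h =>
    rw [pow_succ, ← mul_assoc, map_mul, aeval_X, Module.End.mul_apply]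
    exact h (hD _ hx)

lemma aeval_mul_X_apply {A M : Type*} [CommRing A] [AddCommGroup M] [Module A M]
    (D : Module.End A M) (Q : A[X]) (x : M) : aeval D (Q * X) x = aeval D Q (D x) := by
  rw [map_mul, aeval_X]; rfl

/-- Polynomials in operators which correspond under a semilinear map correspond. -/
lemma map_aeval_apply {A A' M M' : Type*} [CommRing A] [AddCommGroup M] [Module A M] [CommRing A']
    [AddCommGroup M'] [Module A' M'] (φ : A →+* A') (g : M →+ M')
    (hg : ∀ (a : A) (x : M), g (a • x) = φ a • g x) {D : Module.End A M} {D' : Module.End A' M'}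
    (hD : ∀ x, g (D x) = D' (g x)) (Q : A[X]) (x : M) :
    g (aeval D Q x) = aeval D' (Q.map φ) (g x) := by
  induction Q using Polynomial.induction_on generalizing x with
  | C a => rw [map_C, aeval_C, aeval_C, Module.algebraMap_end_apply, Module.algebraMap_end_apply, hg]
  | add p q hp hq =>
    rw [map_add, Polynomial.map_add, map_add, LinearMap.add_apply, LinearMap.add_apply, map_add,
      hp, hq]
  | monomial n a h =>
    rw [pow_succ, ← mul_assoc, aeval_mul_X_apply, h, hD, Polynomial.map_mul (q := X), map_X,
      aeval_mul_X_apply]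

end PolynomialOperators

section Filtration

set_option linter.unusedSectionVars false

open Polynomial

variable {ι V₀ N : Type*} [Fintype ι] [AddCommGroup V₀] [Module ℝ V₀] [AddCommGroup N] [Module ℝ N]
  {P : RootPairing ι ℝ V₀ N} {b : SimpleRoots P} {k : Param b} {J : Set b.support}
  {A E : Type*} [CommRing A] [Algebra ℂ A] [AddCommGroup E] [Module ℂ E] [Module A E]
  [IsScalarTower ℂ A E] [P.IsReduced]

/-- The functions on `W^J` supported on the elements of length less than `n`. -/
def filt (J : Set b.support) (A E : Type*) [CommRing A] [AddCommGroup E] [Module A E] (n : ℕ) :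
    Submodule A (minReps b J → E) where
  carrier := {F | ∀ y : minReps b J, n ≤ len b y → F y = 0}
  add_mem' := fun hF hG y hy => by rw [Pi.add_apply, hF y hy, hG y hy, add_zero]
  zero_mem' := fun _ _ => rfl
  smul_mem' := fun c F hF y hy => by rw [Pi.smul_apply, hF y hy, smul_zero]

lemma filt_mono {n n' : ℕ} (h : n ≤ n') : filt (b := b) J A E n ≤ filt J A E n' :=
  fun _ hF y hy => hF y (h.trans hy)

open Classical in
lemma single_mem_filt {n : ℕ} {y : minReps b J} (hy : len b y < n) (u : E) :
    Pi.single y u ∈ filt J A E n := fun y' hy' => by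
  rw [Pi.single_eq_of_ne]
  rintro rfl
  omega

lemma incl_f (p : SV V₀) : incl k J (HeckeAlg.f p) = HeckeAlg.f p := HeckeAlg.lift_f _ _ _ _

lemma incl_vec (v : Cx V₀) : incl k J (vec k J v) = vec k Set.univ v := incl_f _

lemma incl_t (x : weyl b J) : incl k J (HeckeAlg.t x) = HeckeAlg.t (weylIncl J x) :=
  HeckeAlg.lift_t _ _ _ _

open Classical in
lemma indRep_t_single_mem_filt (ρ : HJ k J →ₐ[ℂ] Module.End A E) {g : weyl b Set.univ} {n : ℕ}
    (hg : len b g < n) (u : E) :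
    indRep ρ (HeckeAlg.t g) (Pi.single (oneRep J) u) ∈ filt J A E n := by
  obtain ⟨y, x, h, hl⟩ := exists_repW_mul J g
  rw [indRep_t_single ρ (y := y) (y' := oneRep J) (x := x) (by rw [repW_oneRep, mul_one, h])]
  exact single_mem_filt (hl.trans_lt hg) _

lemma smul_mem_filt (c : ℂ) {n : ℕ} {F : minReps b J → E} (hF : F ∈ filt J A E n) :
    c • F ∈ filt J A E n := by
  rw [← algebraMap_smul A]
  exact Submodule.smul_mem _ _ hF

open Classical in
lemma indRep_lowH_single (ρ : HJ k J →ₐ[ℂ] Module.End A E) {n : ℕ} {h : HH k} (hh : h ∈ lowH k n)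
    (u : E) : indRep ρ h (Pi.single (oneRep J) u) ∈ filt J A E n := by
  induction hh using Submodule.span_induction with
  | mem x hx =>
    obtain ⟨w, p, hw, rfl⟩ := hx
    rw [map_mul, Module.End.mul_apply, ← incl_f (J := J), indRep_incl_single]
    exact indRep_t_single_mem_filt ρ hw _
  | zero => rw [map_zero]; exact zero_mem _
  | add x y _ _ hx hy => rw [map_add]; exact add_mem hx hy
  | smul c x _ hx => rw [map_smul]; exact smul_mem_filt c hx

open Classical in
/-- The action of `V` on the induced module is triangular. -/
lemma indRep_vec_single (ρ : HJ k J →ₐ[ℂ] Module.End A E) (v : Cx V₀) (y : minReps b J) (u : E) :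
    indRep ρ (vec k Set.univ v) (Pi.single y u) -
      Pi.single y (ρ (vec k J (cxMap (y : V₀ ≃ₗ[ℝ] V₀)⁻¹ v)) u) ∈ filt J A E (len b y) := by
  have h := indRep_lowH_single ρ (vec_mul_t (k := k) (repW y) v) u
  rw [map_sub, LinearMap.sub_apply, map_mul, map_mul, Module.End.mul_apply, Module.End.mul_apply,
    ← single_eq_indRep, ← incl_vec (J := J) (cxMap _ v), indRep_incl_single, ← single_eq_indRep] at h
  exact h

lemma indRep_vec_mem_filt (ρ : HJ k J →ₐ[ℂ] Module.End A E) (v : Cx V₀) {n : ℕ}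
    {F : minReps b J → E} (hF : F ∈ filt J A E n) :
    indRep ρ (vec k Set.univ v) F ∈ filt J A E n := by
  classical
  rw [eq_sum_single F, map_sum]
  refine sum_mem fun y _ => ?_
  by_cases hy : n ≤ len b y
  · rw [hF y hy, Pi.single_zero, map_zero]
    exact zero_mem _
  · have h := filt_mono (by omega) (indRep_vec_single ρ v y (F y)) (n' := n)
    have := add_mem h (single_mem_filt (A := A) (not_le.1 hy)
      (ρ (vec k J (cxMap (y : V₀ ≃ₗ[ℝ] V₀)⁻¹ v)) (F y)))
    rwa [sub_add_cancel] at this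

open Classical in
lemma aeval_vec_single (ρ : HJ k J →ₐ[ℂ] Module.End A E) (v : Cx V₀) (Q : A[X])
    (y : minReps b J) (u : E) : aeval (indRep ρ (vec k Set.univ v)) Q (Pi.single y u) -
      Pi.single y (aeval (ρ (vec k J (cxMap (y : V₀ ≃ₗ[ℝ] V₀)⁻¹ v))) Q u) ∈
        filt J A E (len b y) := by
  induction Q using Polynomial.induction_on generalizing u with
  | C a =>
    rw [aeval_C, aeval_C, Module.algebraMap_end_apply, Module.algebraMap_end_apply, Pi.single_smul,
      sub_self]
    exact zero_mem _
  | add p q hp hq =>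
    have := add_mem (hp u) (hq u)
    rwa [sub_add_sub_comm, ← Pi.single_add, ← LinearMap.add_apply, ← LinearMap.add_apply,
      ← map_add, ← map_add] at this
  | monomial n a h =>
    have h1 := aeval_apply_mem _ (fun x hx => indRep_vec_mem_filt ρ v hx) (C a * X ^ n)
      (indRep_vec_single ρ v y u)
    have h2 := add_mem h1 (h (ρ (vec k J (cxMap (y : V₀ ≃ₗ[ℝ] V₀)⁻¹ v)) u))
    rwa [map_sub, sub_add_sub_cancel, ← aeval_mul_X_apply, ← aeval_mul_X_apply, mul_assoc,
      ← pow_succ] at h2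

/-- If `Q` annihilates the action of `y⁻¹(v)` for the `y ∈ W^J` with `n ≤ l(y) < n + d`, then the
power `Q^d` evaluated at `v` lowers the filtration from `n + d` to `n`. -/
lemma aeval_pow_mem_filt (ρ : HJ k J →ₐ[ℂ] Module.End A E) (v : Cx V₀) (Q : A[X]) {n d : ℕ}
    (hQ : ∀ y : minReps b J, n ≤ len b y → len b y < n + d →
      aeval (ρ (vec k J (cxMap (y : V₀ ≃ₗ[ℝ] V₀)⁻¹ v))) Q = 0)
    {F : minReps b J → E} (hF : F ∈ filt J A E (n + d)) :
    aeval (indRep ρ (vec k Set.univ v)) (Q ^ d) F ∈ filt J A E n := by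
  classical
  induction d generalizing F with
  | zero => simpa using hF
  | succ d ih =>
    rw [pow_succ, map_mul, Module.End.mul_apply]
    refine ih (fun y h1 h2 => hQ y h1 (by omega)) ?_
    rw [eq_sum_single F, map_sum]
    refine sum_mem fun y _ => ?_
    by_cases hy : n + d + 1 ≤ len b y
    · rw [hF y hy, Pi.single_zero, map_zero]
      exact zero_mem _
    by_cases hy' : n + d ≤ len b y
    · have h := aeval_vec_single ρ v Q y (F y)
      rw [hQ y (by omega) (by omega), LinearMap.zero_apply, Pi.single_zero, sub_zero] at h
      exact filt_mono (by omega) h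
    · exact aeval_apply_mem _ (fun x hx => indRep_vec_mem_filt ρ v hx) Q
        (single_mem_filt (not_le.1 hy') _)

/-- The version of `aeval_pow_mem_filt` with a larger exponent. -/
lemma aeval_pow_mem_filt' (ρ : HJ k J →ₐ[ℂ] Module.End A E) (v : Cx V₀) (Q : A[X]) {n d N : ℕ}
    (hN : d ≤ N) (hQ : ∀ y : minReps b J, n ≤ len b y → len b y < n + d →
      aeval (ρ (vec k J (cxMap (y : V₀ ≃ₗ[ℝ] V₀)⁻¹ v))) Q = 0)
    {F : minReps b J → E} (hF : F ∈ filt J A E (n + d)) :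
    aeval (indRep ρ (vec k Set.univ v)) (Q ^ N) F ∈ filt J A E n := by
  obtain ⟨e, rfl⟩ := Nat.exists_eq_add_of_le' hN
  rw [pow_add, map_mul, Module.End.mul_apply]
  exact aeval_apply_mem _ (fun x hx => indRep_vec_mem_filt ρ v hx) _
    (aeval_pow_mem_filt ρ v Q hQ hF)

lemma filt_zero : filt (b := b) J A E 0 = ⊥ := by
  refine (Submodule.eq_bot_iff _).2 fun F hF => funext fun y => hF y (Nat.zero_le _)

open Classical in
lemma eq_single_of_mem_filt_one {F : minReps b J → E} (hF : F ∈ filt J A E 1) :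
    F = Pi.single (oneRep J) (F (oneRep J)) := by
  ext y
  by_cases hy : y = oneRep J
  · subst hy; rw [Pi.single_eq_same]
  · rw [Pi.single_eq_of_ne hy]
    refine hF y (Nat.one_le_iff_ne_zero.2 fun h0 => hy (Subtype.ext ?_))
    exact eq_one_of_len_eq_zero b y.2.1 h0

/-! ### Naturality of induction -/

section Naturality

variable {A' E' : Type*} [CommRing A'] [Algebra ℂ A'] [AddCommGroup E'] [Module ℂ E'] [Module A' E']
  [IsScalarTower ℂ A' E']

lemma map_smul_of_intertwines (ρ : HJ k J →ₐ[ℂ] Module.End A E) (ρ' : HJ k J →ₐ[ℂ] Module.End A' E')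
    (g : E →+ E') (hg : ∀ h u, g (ρ h u) = ρ' h (g u)) (c : ℂ) (u : E) : g (c • u) = c • g u := by
  have := hg (algebraMap ℂ _ c) u
  rwa [AlgHom.commutes, AlgHom.commutes, Module.algebraMap_end_apply,
    Module.algebraMap_end_apply] at this

lemma map_regRep (ρ : HJ k J →ₐ[ℂ] Module.End A E) (ρ' : HJ k J →ₐ[ℂ] Module.End A' E')
    (g : E →+ E') (hg : ∀ h u, g (ρ h u) = ρ' h (g u)) (h : HH k) (F : weyl b Set.univ → E) :
    g ∘ regRep ρ h F = regRep ρ' h (g ∘ F) := by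
  have hs := map_smul_of_intertwines ρ ρ' g hg
  induction h using HJ.induction generalizing F with
  | algebraMap c =>
    ext w
    simp only [AlgHom.commutes, Module.algebraMap_end_apply, Pi.smul_apply, Function.comp_apply, hs]
  | refl α hα => ext w; simp only [regRep_t, Function.comp_apply, transl_apply]
  | vec v =>
    ext w
    simp only [regRep_vec, Function.comp_apply, dunkl_apply, map_add, map_sum, vecAct_apply, hg]
    congr 1
    refine Finset.sum_congr rfl fun i _ => ?_
    split_ifs
    · rw [hs]
    · rw [map_zero]
  | mul x y hx hy => rw [map_mul, map_mul, Module.End.mul_apply, Module.End.mul_apply, hx, hy]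
  | add x y hx hy =>
    rw [map_add, map_add, LinearMap.add_apply, LinearMap.add_apply, ← hx, ← hy]
    ext w
    simp

lemma map_extend (g : E →+ E') (F : minReps b J → E) :
    g ∘ extend J A E F = extend J A' E' (g ∘ F) := by
  classical
  ext w
  simp only [extend, LinearMap.sum_apply, Function.comp_apply, Finset.sum_apply, map_sum,
    LinearMap.comp_apply, LinearMap.proj_apply, LinearMap.single_apply]
  refine Finset.sum_congr rfl fun y _ => ?_
  by_cases hw : w = repW y
  · subst hw; rw [Pi.single_eq_same, Pi.single_eq_same]
  · rw [Pi.single_eq_of_ne hw, Pi.single_eq_of_ne hw, map_zero]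

/-- Induction is natural for additive maps intertwining two representations of `ℍ_J`, which may be
over different rings of scalars. -/
lemma map_indRep (ρ : HJ k J →ₐ[ℂ] Module.End A E) (ρ' : HJ k J →ₐ[ℂ] Module.End A' E')
    (g : E →+ E') (hg : ∀ h u, g (ρ h u) = ρ' h (g u)) (h : HH k) (F : minReps b J → E) :
    g ∘ indRep ρ h F = indRep ρ' h (g ∘ F) := by
  ext y
  rw [indRep_apply, indRep_apply, ← map_extend (A := A), ← map_regRep ρ ρ' g hg,
    Function.comp_apply, coord_apply, coord_apply, avg_apply, avg_apply, map_sum]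
  exact Finset.sum_congr rfl fun x _ => hg _ _

end Naturality

/-! ### The coordinate at the longest element -/

lemma twist_vec {J' : Set b.support} {w : V₀ ≃ₗ[ℝ] V₀} (h : MapsOnto b w J J') (v : Cx V₀) :
    twistInv k h (vec k J' v) = vec k J (cxMap w⁻¹ v) := by
  rw [twistInv, twist, HeckeAlg.lift_f, AlgHom.comp_apply, symInv_ι]

lemma twist_t {J' : Set b.support} {w : V₀ ≃ₗ[ℝ] V₀} (h : MapsOnto b w J J') (x : weyl b J') :
    twistInv k h (HeckeAlg.t x) = HeckeAlg.t (conjHom h x) := by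
  rw [twistInv, twist, HeckeAlg.lift_t]
  rfl

/-- The longest element of `W^{θ(J)}`. -/
def topRep (J : Set b.support) : minReps b (theta b J) :=
  ⟨wTop b (theta b J), (wTop_isLongest b _).1⟩

lemma topRep_mul_phi (J : Set b.support) : ((topRep J : minReps b (theta b J)) : V₀ ≃ₗ[ℝ] V₀) *
    phi b J = 1 := wTop_mul_phi b J

lemma len_lt_topRep {y : minReps b (theta b J)} (hy : y ≠ topRep J) :
    len b y < len b (topRep J : minReps b (theta b J)) :=
  len_lt_wTop b y.2 fun h => hy (Subtype.ext h)

lemma mem_filt_top {F : minReps b (theta b J) → E} :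
    F ∈ filt (theta b J) A E (len b (topRep J : minReps b (theta b J))) ↔ F (topRep J) = 0 := by
  refine ⟨fun h => h _ le_rfl, fun h y hy => ?_⟩
  by_cases hy' : y = topRep J
  · rw [hy', h]
  · exact absurd (len_lt_topRep hy') (not_lt.2 hy)

open Classical in
lemma sub_single_mem_filt (F : minReps b (theta b J) → E) :
    F - Pi.single (topRep J) (F (topRep J)) ∈
      filt (theta b J) A E (len b (topRep J : minReps b (theta b J))) :=
  mem_filt_top.2 (by rw [Pi.sub_apply, Pi.single_eq_same, sub_self])

variable (σ : HJ k J →ₐ[ℂ] Module.End A E)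

/-- On the module induced from `φ(E)`, the coordinate at the longest element of `W^{θ(J)}` is
`ℍ_J`-linear. -/
lemma indRep_incl_top (h : HJ k J) (F : minReps b (theta b J) → E) :
    indRep (σ.comp (twistInv k (phi_mapsOnto b J))) (incl k J h) F (topRep J) =
      σ h (F (topRep J)) := by
  classical
  induction h using HJ.induction generalizing F with
  | algebraMap c =>
    rw [AlgHom.commutes, AlgHom.commutes, AlgHom.commutes, Module.algebraMap_end_apply,
      Module.algebraMap_end_apply, Pi.smul_apply]
  | refl α hα =>
    obtain ⟨β, hβ, hαβ⟩ := (phi_mapsOnto b J).exists_right α hα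
    have hr := reflection_conj b (phi_mapsOnto b J).mem hαβ
    have h1 : conjHom (phi_mapsOnto b J) (sRefl hβ) = sRefl hα := by
      apply Subtype.ext
      change (phi b J)⁻¹ * P.reflection β * (phi b J)⁻¹⁻¹ = P.reflection α
      rw [hr]; group
    rw [incl_t, indRep_t_apply _ (y' := topRep J) (x := sRefl hβ), AlgHom.comp_apply, twist_t, h1]
    apply Subtype.ext
    change P.reflection α * _ = _ * P.reflection β
    have h3 := eq_inv_of_mul_eq_one_left (topRep_mul_phi (b := b) J)
    change P.reflection α * ((topRep J : minReps b (theta b J)) : V₀ ≃ₗ[ℝ] V₀) =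
      ((topRep J : minReps b (theta b J)) : V₀ ≃ₗ[ℝ] V₀) * P.reflection β
    rw [h3, hr]
    group
  | vec v =>
    rw [vec, incl_f]
    have h1 := mem_filt_top.1 (indRep_vec_mem_filt (σ.comp (twistInv k (phi_mapsOnto b J))) v
      (sub_single_mem_filt (A := A) F))
    have h2 := mem_filt_top.1 (indRep_vec_single (σ.comp (twistInv k (phi_mapsOnto b J))) v
      (topRep J) (F (topRep J)))
    rw [map_sub, Pi.sub_apply, sub_eq_zero] at h1
    rw [Pi.sub_apply, Pi.single_eq_same, AlgHom.comp_apply, twist_vec, ← cxMap_mul, ← mul_inv_rev,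
      topRep_mul_phi, inv_one, cxMap_one, sub_eq_zero] at h2
    rw [h1, h2]
  | mul x y hx hy => rw [map_mul, map_mul, Module.End.mul_apply, hx, hy, map_mul]; rfl
  | add x y hx hy =>
    rw [map_add, map_add, LinearMap.add_apply, Pi.add_apply, hx, hy, map_add, LinearMap.add_apply]

/-- Every coordinate is the top coordinate of a translate. -/
lemma indRep_t_top (ρ : HJ k (theta b J) →ₐ[ℂ] Module.End A E) (F : minReps b (theta b J) → E)
    (y : minReps b (theta b J)) :
    indRep ρ (HeckeAlg.t (repW (topRep J) * (repW y)⁻¹)) F (topRep J) = F y := by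
  rw [indRep_t_apply ρ (y := topRep J) (y' := y) (x := 1) (by rw [map_one, inv_mul_cancel_right, mul_one]),
    map_one, map_one, Module.End.one_apply]

lemma twist_vec_rep (y : minReps b (theta b J)) (v : Cx V₀) :
    twistInv k (phi_mapsOnto b J) (vec k (theta b J) (cxMap (y : V₀ ≃ₗ[ℝ] V₀)⁻¹ v)) =
      vec k J (cxMap ((y : V₀ ≃ₗ[ℝ] V₀) * phi b J)⁻¹ v) := by
  rw [twist_vec, mul_inv_rev, cxMap_mul]

end Filtration


/-! ### Coordinates on the tensor products -/

section BalTensorLift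

variable {H M N A : Type*} [Ring H] [Algebra ℂ H] [AddCommGroup M] [Module ℂ M] [Module H M]
  [IsScalarTower ℂ H M] [AddCommGroup N] [Module ℂ N] {r : A → M →ₗ[H] M} {l : A → N →ₗ[ℂ] N}
  {X : Type*} [AddCommGroup X] [Module ℂ X] [Module H X] [IsScalarTower ℂ H X]

/-- The universal property of `M ⊗_A N`. -/
def balLift (g : M →ₗ[H] N →ₗ[ℂ] X) (hg : ∀ m a n, g (r a m) n = g m (l a n)) :
    BalTensor H M N r l →ₗ[H] X :=
  (balRel H M N r l).liftQ (AlgebraTensorModule.lift g) (Submodule.span_le.2 (by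
    rintro _ ⟨m, a, n, rfl⟩
    rw [SetLike.mem_coe, LinearMap.mem_ker, map_sub, AlgebraTensorModule.lift_tmul,
      AlgebraTensorModule.lift_tmul, hg, sub_self]))

lemma balLift_ptmul (g : M →ₗ[H] N →ₗ[ℂ] X) (hg : ∀ m a n, g (r a m) n = g m (l a n)) (m : M)
    (n : N) : balLift g hg (ptmul r l m n) = g m n :=
  AlgebraTensorModule.lift_tmul g m n

lemma ptmul_balanced (m : M) (a : A) (n : N) : ptmul r l (r a m) n = ptmul r l m (l a n) :=
  (Submodule.Quotient.eq _).2 (Submodule.subset_span ⟨m, a, n, rfl⟩)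

variable (r l) in
/-- The universal bilinear map to `M ⊗_A N`. -/
def ptmulHom : M →ₗ[H] N →ₗ[ℂ] BalTensor H M N r l where
  toFun m :=
    { toFun := fun n => ptmul r l m n
      map_add' := fun n n' => by rw [ptmul, tmul_add, map_add]; rfl
      map_smul' := fun c n => by rw [ptmul, tmul_smul]; rfl }
  map_add' m m' := LinearMap.ext fun n => by
    change ptmul r l (m + m') n = ptmul r l m n + ptmul r l m' n
    rw [ptmul, add_tmul, map_add]; rfl
  map_smul' h m := LinearMap.ext fun n => by
    change ptmul r l (h • m) n = h • ptmul r l m n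
    rw [ptmul, ← smul_tmul', map_smul]; rfl

lemma ptmulHom_apply (m : M) (n : N) : ptmulHom r l m n = ptmul r l m n := rfl

lemma smul_ptmul (h : H) (m : M) (n : N) : h • ptmul r l m n = ptmul r l (h • m) n := by
  rw [← ptmulHom_apply, ← ptmulHom_apply, map_smul, LinearMap.smul_apply]

@[elab_as_elim]
lemma balTensor_induction {C : BalTensor H M N r l → Prop} (zero : C 0)
    (ptmul : ∀ m n, C (ptmul r l m n)) (add : ∀ x y, C x → C y → C (x + y))
    (z : BalTensor H M N r l) : C z := by
  obtain ⟨z, rfl⟩ := Submodule.mkQ_surjective _ z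
  induction z using TensorProduct.induction_on with
  | zero => rw [map_zero]; exact zero
  | tmul m n => exact ptmul m n
  | add x y hx hy => rw [map_add]; exact add _ _ hx hy

end BalTensorLift

section Associativity

variable {H B C E : Type*} [Ring H] [Algebra ℂ H] [Ring B] [Algebra ℂ B] [Ring C] [Algebra ℂ C]
  [AddCommGroup E] [Module ℂ E] {j : B →ₐ[ℂ] C} (σ : C →ₐ[ℂ] Module.End ℂ E)
  {r : B → H →ₗ[H] H}

variable (r) (j) in
/-- The `(H, C)`-bimodule `H ⊗_B C`. -/
abbrev BalUp : Type _ := BalTensor H H C r (fun a => LinearMap.mulLeft ℂ (j a))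

variable {r' : C → BalUp j r →ₗ[H] BalUp j r}

/-- The map `(h ⊗ x) ⊗ y ↦ h ⊗ x y` from `(H ⊗_B C) × E` to `H ⊗_B E`. -/
def assocAux : BalUp j r →ₗ[H] E →ₗ[ℂ] BalTensor H H E r (fun a => (σ.comp j) a) :=
  balLift (LinearMap.toSpanSingleton H (C →ₗ[ℂ] E →ₗ[ℂ] BalTensor H H E r (fun a => (σ.comp j) a))
    (LinearMap.llcomp ℂ E E _ (ptmulHom r (fun a => (σ.comp j) a) 1) ∘ₗ σ.toLinearMap))
    (fun h a x => by
      refine LinearMap.ext fun y => ?_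
      have h2 : ∀ h x, LinearMap.toSpanSingleton H
          (C →ₗ[ℂ] E →ₗ[ℂ] BalTensor H H E r (fun a => (σ.comp j) a))
          (LinearMap.llcomp ℂ E E _ (ptmulHom r (fun a => (σ.comp j) a) 1) ∘ₗ σ.toLinearMap)
            h x y = ptmul r (fun a => (σ.comp j) a) h (σ x y) := fun h x => by
        refine (smul_ptmul h 1 (σ x y)).trans ?_
        rw [smul_eq_mul, mul_one]
      rw [h2, h2, ptmul_balanced, LinearMap.mulLeft_apply, map_mul]
      rfl)

lemma assocAux_ptmul (h : H) (x : C) (y : E) :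
    assocAux σ (ptmul r (fun a => LinearMap.mulLeft ℂ (j a)) h x) y =
      ptmul r (fun a => (σ.comp j) a) h (σ x y) := by
  rw [assocAux, balLift_ptmul]
  refine (smul_ptmul h 1 (σ x y)).trans ?_
  rw [smul_eq_mul, mul_one]

lemma linearMap_ext_balTensor {M N A X : Type*} [AddCommGroup M] [Module ℂ M] [Module H M]
    [IsScalarTower ℂ H M] [AddCommGroup N] [Module ℂ N] {r : A → M →ₗ[H] M} {l : A → N →ₗ[ℂ] N}
    [AddCommGroup X] [Module H X] {g g' : BalTensor H M N r l →ₗ[H] X}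
    (h : ∀ m n, g (ptmul r l m n) = g' (ptmul r l m n)) : g = g' := by
  refine LinearMap.ext fun z => ?_
  induction z using balTensor_induction with
  | zero => rw [map_zero, map_zero]
  | ptmul m n => exact h m n
  | add x y hx hy => rw [map_add, map_add, hx, hy]

/-- The map `(H ⊗_B C) ⊗_C E → H ⊗_B E`. -/
def assocHom (hr' : ∀ x' h x, r' x' (ptmul r (fun a => LinearMap.mulLeft ℂ (j a)) h x) =
    ptmul r (fun a => LinearMap.mulLeft ℂ (j a)) h (x * x')) :
    BalTensor H (BalUp j r) E r' (fun a => σ a) →ₗ[H]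
      BalTensor H H E r (fun a => (σ.comp j) a) :=
  balLift (assocAux σ) (fun x x' y => by
    induction x using balTensor_induction with
    | zero => rw [map_zero, map_zero, LinearMap.zero_apply, LinearMap.zero_apply]
    | ptmul h x => rw [hr', assocAux_ptmul, assocAux_ptmul, map_mul, Module.End.mul_apply]
    | add x z hx hz =>
      rw [map_add, map_add, map_add, LinearMap.add_apply, LinearMap.add_apply, hx, hz])

/-- The map `H ⊗_B E → (H ⊗_B C) ⊗_C E`. -/
def assocInv
    (hr' : ∀ x' h x, r' x' (ptmul r (fun a => LinearMap.mulLeft ℂ (j a)) h x) =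
      ptmul r (fun a => LinearMap.mulLeft ℂ (j a)) h (x * x')) :
    BalTensor H H E r (fun a => (σ.comp j) a) →ₗ[H]
      BalTensor H (BalUp j r) E r' (fun a => σ a) :=
  balLift (LinearMap.toSpanSingleton H (E →ₗ[ℂ] BalTensor H (BalUp j r) E r' (fun a => σ a))
    (ptmulHom r' (fun a => σ a) (ptmul r (fun a => LinearMap.mulLeft ℂ (j a)) 1 1)))
    (fun h a y => by
      have h2 : ∀ h y, LinearMap.toSpanSingleton H
          (E →ₗ[ℂ] BalTensor H (BalUp j r) E r' (fun a => σ a))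
          (ptmulHom r' (fun a => σ a) (ptmul r (fun a => LinearMap.mulLeft ℂ (j a)) 1 1)) h y =
          ptmul r' (fun a => σ a) (ptmul r (fun a => LinearMap.mulLeft ℂ (j a)) h 1) y := fun h y => by
        refine (smul_ptmul h _ y).trans ?_
        rw [smul_ptmul, smul_eq_mul, mul_one]
      have h3 : ptmul r (fun a => LinearMap.mulLeft ℂ (j a)) (r a h) 1 =
          r' (j a) (ptmul r (fun a => LinearMap.mulLeft ℂ (j a)) h 1) := by
        rw [ptmul_balanced, hr', LinearMap.mulLeft_apply, mul_one, one_mul]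
      rw [h2, h2, h3, ptmul_balanced]
      rfl)

lemma assocInv_ptmul
    (hr' : ∀ x' h x, r' x' (ptmul r (fun a => LinearMap.mulLeft ℂ (j a)) h x) =
      ptmul r (fun a => LinearMap.mulLeft ℂ (j a)) h (x * x')) (h : H) (y : E) :
    assocInv (r' := r') σ hr' (ptmul r (fun a => (σ.comp j) a) h y) =
      ptmul r' (fun a => σ a) (ptmul r (fun a => LinearMap.mulLeft ℂ (j a)) h 1) y := by
  rw [assocInv, balLift_ptmul]
  refine (smul_ptmul h _ y).trans ?_
  rw [smul_ptmul, smul_eq_mul, mul_one]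

lemma assocHom_ptmul
    (hr' : ∀ x' h x, r' x' (ptmul r (fun a => LinearMap.mulLeft ℂ (j a)) h x) =
      ptmul r (fun a => LinearMap.mulLeft ℂ (j a)) h (x * x')) (h : H) (x : C) (y : E) :
    assocHom (r' := r') σ hr' (ptmul r' (fun a => σ a)
      (ptmul r (fun a => LinearMap.mulLeft ℂ (j a)) h x) y) =
      ptmul r (fun a => (σ.comp j) a) h (σ x y) := by
  rw [assocHom, balLift_ptmul, assocAux_ptmul]

/-- Associativity of the tensor product: `(H ⊗_B C) ⊗_C E = H ⊗_B E`. -/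
def assocEquiv
    (hr' : ∀ x' h x, r' x' (ptmul r (fun a => LinearMap.mulLeft ℂ (j a)) h x) =
      ptmul r (fun a => LinearMap.mulLeft ℂ (j a)) h (x * x')) :
    BalTensor H (BalUp j r) E r' (fun a => σ a) ≃ₗ[H]
      BalTensor H H E r (fun a => (σ.comp j) a) :=
  LinearEquiv.ofLinearMap (assocHom σ hr') (assocInv σ hr')
    (linearMap_ext_balTensor fun h y => by
      rw [LinearMap.comp_apply, LinearMap.id_apply, assocInv_ptmul, assocHom_ptmul, map_one]
      rfl)
    (linearMap_ext_balTensor fun x y => by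
      rw [LinearMap.comp_apply, LinearMap.id_apply]
      induction x using balTensor_induction with
      | zero => rw [← ptmulHom_apply, map_zero, LinearMap.zero_apply, map_zero, map_zero]
      | ptmul h x =>
        rw [assocHom_ptmul, assocInv_ptmul, ← ptmul_balanced, hr', one_mul]
      | add x x' hx hx' =>
        rw [← ptmulHom_apply, map_add, LinearMap.add_apply, map_add, map_add, ptmulHom_apply,
          ptmulHom_apply, hx, hx'])

end Associativity


section InducedModules

set_option linter.unusedSectionVars false

variable {ι V₀ N : Type*} [Fintype ι] [AddCommGroup V₀] [Module ℝ V₀] [AddCommGroup N] [Module ℝ N]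
  {P : RootPairing ι ℝ V₀ N} {b : SimpleRoots P} {k : Param b} {J : Set b.support}
  {A E : Type*} [CommRing A] [Algebra ℂ A] [AddCommGroup E] [Module ℂ E] [Module A E]
  [IsScalarTower ℂ A E] [P.IsReduced]

lemma Ind.tmul_incl (σ : HJ k J →ₐ[ℂ] Module.End ℂ E) (h : HH k) (a : HJ k J) (u : E) :
    Ind.tmul σ (h * incl k J a) u = Ind.tmul σ h (σ a u) :=
  ptmul_balanced (r := rightH k J) (l := fun a => σ a) h a u

lemma Ind.smul_tmul (σ : HJ k J →ₐ[ℂ] Module.End ℂ E) (h h' : HH k) (u : E) :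
    h • Ind.tmul σ h' u = Ind.tmul σ (h * h') u :=
  smul_ptmul _ _ _

/-- Frobenius reciprocity: an `ℍ_J`-linear map `E → X` to an `ℍ`-module extends to the induced
module. -/
def Ind.lift {X : Type*} [AddCommGroup X] [Module ℂ X] [Module (HH k) X] [IsScalarTower ℂ (HH k) X]
    (σ : HJ k J →ₐ[ℂ] Module.End ℂ E) (g : E →ₗ[ℂ] X) (hg : ∀ a u, g (σ a u) = incl k J a • g u) :
    Ind σ →ₗ[HH k] X :=
  balLift (LinearMap.toSpanSingleton (HH k) (E →ₗ[ℂ] X) g) (fun h a u => by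
    simp only [rightH, LinearMap.toSpanSingleton_apply, LinearMap.smul_apply, hg, smul_eq_mul,
      mul_smul])

lemma Ind.lift_tmul {X : Type*} [AddCommGroup X] [Module ℂ X] [Module (HH k) X]
    [IsScalarTower ℂ (HH k) X] (σ : HJ k J →ₐ[ℂ] Module.End ℂ E) (g : E →ₗ[ℂ] X)
    (hg : ∀ a u, g (σ a u) = incl k J a • g u) (h : HH k) (u : E) :
    Ind.lift σ g hg (Ind.tmul σ h u) = h • g u :=
  balLift_ptmul _ _ _ _

/-- The `ℍ`-module of functions `W^J → E`, with the action `indRep ρ`. -/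
def Model (_ρ : HJ k J →ₐ[ℂ] Module.End A E) : Type _ := minReps b J → E

instance (ρ : HJ k J →ₐ[ℂ] Module.End A E) : AddCommGroup (Model ρ) :=
  inferInstanceAs (AddCommGroup (minReps b J → E))

instance (ρ : HJ k J →ₐ[ℂ] Module.End A E) : Module ℂ (Model ρ) :=
  inferInstanceAs (Module ℂ (minReps b J → E))

instance (ρ : HJ k J →ₐ[ℂ] Module.End A E) : Module (HH k) (Model ρ) :=
  Module.compHom (minReps b J → E) (indRep ρ : HH k →+* Module.End A (minReps b J → E))

lemma Model.smul_def (ρ : HJ k J →ₐ[ℂ] Module.End A E) (h : HH k) (F : Model ρ) :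
    h • F = indRep ρ h F := rfl

instance (ρ : HJ k J →ₐ[ℂ] Module.End A E) : IsScalarTower ℂ (HH k) (Model ρ) :=
  ⟨fun c h F => by
    rw [Model.smul_def, Model.smul_def, map_smul]; rfl⟩

open Classical in
/-- The map `u ↦ 1 ⊗ u`. -/
def Model.ofOne (ρ : HJ k J →ₐ[ℂ] Module.End A E) : E →ₗ[ℂ] Model ρ :=
  LinearMap.single ℂ (fun _ : minReps b J => E) (oneRep J)

/-- The map `h ⊗ u ↦ h (1 ⊗ u)` to the coordinate space. -/
def indToModel (ρ : HJ k J →ₐ[ℂ] Module.End A E) (σ : HJ k J →ₐ[ℂ] Module.End ℂ E)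
    (hσ : ∀ h u, σ h u = ρ h u) : Ind σ →ₗ[HH k] Model ρ :=
  Ind.lift σ (Model.ofOne ρ) (fun a u => by
    classical
    rw [hσ]
    exact (indRep_incl_single ρ a u).symm)

open Classical in
lemma indToModel_tmul (ρ : HJ k J →ₐ[ℂ] Module.End A E) (σ : HJ k J →ₐ[ℂ] Module.End ℂ E)
    (hσ : ∀ h u, σ h u = ρ h u) (h : HH k) (u : E) :
    indToModel ρ σ hσ (Ind.tmul σ h u) = indRep ρ h (Pi.single (oneRep J) u) :=
  Ind.lift_tmul _ _ _ _ _

/-- The map taking a function `F : W^J → E` to `∑ t_y ⊗ F(y)`. -/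
def ofCoord (σ : HJ k J →ₐ[ℂ] Module.End ℂ E) : (minReps b J → E) →ₗ[ℂ] Ind σ :=
  ∑ y : minReps b J, ptmulHom (rightH k J) (fun a => σ a) (HeckeAlg.t (repW y)) ∘ₗ LinearMap.proj y

lemma ofCoord_apply (σ : HJ k J →ₐ[ℂ] Module.End ℂ E) (F : minReps b J → E) :
    ofCoord σ F = ∑ y, Ind.tmul σ (HeckeAlg.t (repW y)) (F y) := by
  rw [ofCoord, LinearMap.sum_apply]
  rfl

lemma exists_mem_lowH (h : HH k) : ∃ n, h ∈ lowH k n := by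
  suffices H : ∀ (h x : HH k), (∃ n, x ∈ lowH k n) → ∃ n, h * x ∈ lowH k n by
    have h1 := mem_lowH (k := k) (w := 1) (n := 1) (by
      rw [OneMemClass.coe_one, len_one]; exact one_pos) 1
    rw [map_one, map_one, mul_one] at h1
    have := H h 1 ⟨1, h1⟩
    rwa [mul_one] at this
  clear h
  intro h
  induction h using HJ.induction with
  | algebraMap c =>
    rintro x ⟨n, hn⟩
    exact ⟨n, by rw [← Algebra.smul_def]; exact Submodule.smul_mem _ _ hn⟩
  | refl α hα => rintro x ⟨n, hn⟩; exact ⟨n + 1, t_sRefl_mul_mem_lowH hn α⟩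
  | vec v =>
    rintro x ⟨n, hn⟩
    refine ⟨n, ?_⟩
    induction hn using Submodule.span_induction with
    | mem x hx =>
      obtain ⟨w, p, hw, rfl⟩ := hx
      have h1 := mul_f_mem_lowH (lowH_mono hw.le (vec_mul_t (k := k) w v)) p
      have h2 := mem_lowH (k := k) hw
        (SymmetricAlgebra.ι ℂ (Cx V₀) (cxMap (w : V₀ ≃ₗ[ℝ] V₀)⁻¹ v) * p)
      rw [map_mul, ← mul_assoc] at h2
      have h3 := add_mem h1 h2
      rwa [sub_mul, sub_add_cancel, mul_assoc] at h3
    | zero => rw [mul_zero]; exact zero_mem _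
    | add x y _ _ hx hy => rw [mul_add]; exact add_mem hx hy
    | smul c x _ hx => rw [mul_smul_comm]; exact Submodule.smul_mem _ _ hx
  | mul x y hx hy => intro z hz; rw [mul_assoc]; exact hx _ (hy _ hz)
  | add x y hx hy =>
    intro z hz
    obtain ⟨n, hn⟩ := hx z hz
    obtain ⟨n', hn'⟩ := hy z hz
    exact ⟨max n n', by
      rw [add_mul]
      exact add_mem (lowH_mono (le_max_left _ _) hn) (lowH_mono (le_max_right _ _) hn')⟩

lemma ofCoord_single [DecidableEq (minReps b J)] (σ : HJ k J →ₐ[ℂ] Module.End ℂ E) (y : minReps b J) (u : E) :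
    ofCoord σ (Pi.single y u) = Ind.tmul σ (HeckeAlg.t (repW y)) u := by
  rw [ofCoord_apply, Finset.sum_eq_single y]
  · rw [Pi.single_eq_same]
  · intro y' _ h
    rw [Pi.single_eq_of_ne h]
    exact map_zero (ptmulHom (rightH k J) (fun a => σ a) (HeckeAlg.t (repW y')))
  · simp

lemma ofCoord_surjective (σ : HJ k J →ₐ[ℂ] Module.End ℂ E) :
    Function.Surjective (ofCoord σ) := by
  classical
  rw [← LinearMap.range_eq_top, eq_top_iff]
  rintro z -
  induction z using balTensor_induction with
  | zero => exact zero_mem _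
  | add x y hx hy => exact add_mem hx hy
  | ptmul h u =>
    obtain ⟨n, hn⟩ := exists_mem_lowH h
    induction hn using Submodule.span_induction with
    | mem x hx =>
      obtain ⟨w, p, -, rfl⟩ := hx
      obtain ⟨y, x, rfl, -⟩ := exists_repW_mul J w
      have h1 : Ind.tmul σ (HeckeAlg.t (repW y * weylIncl J x) * HeckeAlg.f p) u =
          ofCoord σ (Pi.single y (σ (HeckeAlg.t x) (σ (HeckeAlg.f p) u))) := by
        rw [ofCoord_single, map_mul, ← incl_t, ← incl_f (J := J), Ind.tmul_incl, Ind.tmul_incl]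
      exact ⟨_, h1.symm⟩
    | zero =>
      have : ptmul (rightH k J) (fun a => σ a) 0 u = 0 := by
        rw [← ptmulHom_apply, map_zero, LinearMap.zero_apply]
      rw [this]
      exact zero_mem _
    | add x y _ _ hx hy =>
      rw [← ptmulHom_apply, map_add, LinearMap.add_apply]
      exact add_mem hx hy
    | smul c x _ hx =>
      have : ptmul (rightH k J) (fun a => σ a) (c • x) u =
          c • ptmul (rightH k J) (fun a => σ a) x u := by
        rw [← algebraMap_smul (HH k) c x, ← smul_ptmul, algebraMap_smul]
      rw [this]
      exact Submodule.smul_mem _ _ hx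

lemma indToModel_ofCoord (ρ : HJ k J →ₐ[ℂ] Module.End A E) (σ : HJ k J →ₐ[ℂ] Module.End ℂ E)
    (hσ : ∀ h u, σ h u = ρ h u) (F : minReps b J → E) :
    indToModel ρ σ hσ (ofCoord σ F) = F := by
  classical
  rw [ofCoord_apply, map_sum]
  conv_rhs => rw [eq_sum_single F]
  refine Finset.sum_congr rfl fun y _ => ?_
  rw [indToModel_tmul, ← single_eq_indRep]

/-- The module induced from `E` has the coordinate space `W^J → E`. -/
def indEquiv (ρ : HJ k J →ₐ[ℂ] Module.End A E) (σ : HJ k J →ₐ[ℂ] Module.End ℂ E)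
    (hσ : ∀ h u, σ h u = ρ h u) : Ind σ ≃ₗ[ℂ] (minReps b J → E) :=
  (LinearEquiv.ofBijective (ofCoord σ) ⟨fun F F' h => by
    rw [← indToModel_ofCoord ρ σ hσ F, h, indToModel_ofCoord], ofCoord_surjective σ⟩).symm

lemma indEquiv_ofCoord (ρ : HJ k J →ₐ[ℂ] Module.End A E) (σ : HJ k J →ₐ[ℂ] Module.End ℂ E)
    (hσ : ∀ h u, σ h u = ρ h u) (F : minReps b J → E) : indEquiv ρ σ hσ (ofCoord σ F) = F :=
  LinearEquiv.symm_apply_apply _ F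

lemma indEquiv_eq (ρ : HJ k J →ₐ[ℂ] Module.End A E) (σ : HJ k J →ₐ[ℂ] Module.End ℂ E)
    (hσ : ∀ h u, σ h u = ρ h u) (z : Ind σ) : indEquiv ρ σ hσ z = indToModel ρ σ hσ z := by
  obtain ⟨F, rfl⟩ := ofCoord_surjective σ z
  rw [indEquiv_ofCoord, indToModel_ofCoord]

lemma indEquiv_smul (ρ : HJ k J →ₐ[ℂ] Module.End A E) (σ : HJ k J →ₐ[ℂ] Module.End ℂ E)
    (hσ : ∀ h u, σ h u = ρ h u) (h : HH k) (z : Ind σ) :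
    indEquiv ρ σ hσ (h • z) = indRep ρ h (indEquiv ρ σ hσ z) := by
  rw [indEquiv_eq, indEquiv_eq, map_smul]
  rfl

open Classical in
lemma indEquiv_tmul (ρ : HJ k J →ₐ[ℂ] Module.End A E) (σ : HJ k J →ₐ[ℂ] Module.End ℂ E)
    (hσ : ∀ h u, σ h u = ρ h u) (h : HH k) (u : E) :
    indEquiv ρ σ hσ (Ind.tmul σ h u) = indRep ρ h (Pi.single (oneRep J) u) := by
  rw [indEquiv_eq, indToModel_tmul]

/-! ### Associativity of the tensor products -/

section Rational

variable (σ : RatHJ k J →ₐ[ℂ] Module.End ℂ E)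

/-- `𝓗^J ⊗_{𝓗_J} E` is the `ℍ`-module induced from the restriction of `E` to `ℍ_J`. -/
def ratIndEquiv : RatInd σ ≃ₗ[HH k] Ind (σ.comp (loc k J)) :=
  assocEquiv (j := loc k J) (r := rightH k J) (r' := rightRat k J) σ
    (fun _ _ _ => rfl)

lemma ratIndEquiv_tmul (h : HH k) (x : RatHJ k J) (y : E) :
    ratIndEquiv σ (RatInd.tmul σ (RatUp.tmul k J h x) y) =
      Ind.tmul (σ.comp (loc k J)) h (σ x y) :=
  assocHom_ptmul (j := loc k J) (r := rightH k J) (r' := rightRat k J) σ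
    (fun _ _ _ => rfl) h x y

/-- Coordinates on `𝓗^J ⊗_{𝓗_J} E`. -/
def ratEquiv (ρ : HJ k J →ₐ[ℂ] Module.End A E) (hσ : ∀ h u, σ (loc k J h) u = ρ h u) :
    RatInd σ ≃ₗ[ℂ] (minReps b J → E) :=
  (ratIndEquiv σ).restrictScalars ℂ ≪≫ₗ indEquiv ρ (σ.comp (loc k J)) hσ

lemma ratEquiv_smul (ρ : HJ k J →ₐ[ℂ] Module.End A E) (hσ : ∀ h u, σ (loc k J h) u = ρ h u)
    (h : HH k) (z : RatInd σ) :
    ratEquiv σ ρ hσ (h • z) = indRep ρ h (ratEquiv σ ρ hσ z) := by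
  refine Eq.trans ?_ (indEquiv_smul ρ (σ.comp (loc k J)) hσ h _)
  exact congrArg _ (map_smul (ratIndEquiv σ) h z)

open Classical in
lemma ratEquiv_tmul (ρ : HJ k J →ₐ[ℂ] Module.End A E) (hσ : ∀ h u, σ (loc k J h) u = ρ h u)
    (h : HH k) (x : RatHJ k J) (y : E) :
    ratEquiv σ ρ hσ (RatInd.tmul σ (RatUp.tmul k J h x) y) =
      indRep ρ h (Pi.single (oneRep J) (σ x y)) := by
  refine Eq.trans ?_ (indEquiv_tmul ρ (σ.comp (loc k J)) hσ h _)
  exact congrArg _ (ratIndEquiv_tmul σ h x y)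

end Rational

end InducedModules


/-! ### Deformations over rings of functions -/

section UnitPolynomials

open Polynomial

lemma isUnit_aeval_of_isRoot {B : Type*} [Ring B] [Algebra ℂ B] {D : B} {p : ℂ[X]} (hp : p ≠ 0)
    (h : ∀ c, p.IsRoot c → IsUnit (D - algebraMap ℂ B c)) : IsUnit (aeval D p) := by
  rw [(IsAlgClosed.splits p).eq_prod_roots, map_mul, aeval_C]
  refine IsUnit.mul ((IsUnit.mk0 _ (leadingCoeff_ne_zero.2 hp)).map (algebraMap ℂ B)) ?_
  have hr : ∀ c ∈ p.roots, IsUnit (D - algebraMap ℂ B c) := fun c hc => h c (isRoot_of_mem_roots hc)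
  generalize p.roots = s at hr
  induction s using Multiset.induction_on with
  | empty => simp
  | cons c s ih =>
    rw [Multiset.map_cons, Multiset.prod_cons, map_mul]
    refine IsUnit.mul ?_ (ih fun c hc => hr c (Multiset.mem_cons_of_mem hc))
    rw [map_sub, aeval_X, aeval_C]
    exact hr c (Multiset.mem_cons_self c s)

/-- If `p(D) = 0` and `p(-s)` is invertible, then `D + s` is invertible. -/
lemma isUnit_add_algebraMap {A B : Type*} [CommRing A] [Ring B] [Algebra A B] {D : B} {p : A[X]}
    (hp : aeval D p = 0) {s : A} (hs : IsUnit (p.eval (-s))) : IsUnit (D + algebraMap A B s) := by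
  obtain ⟨q, hq⟩ := X_sub_C_dvd_sub_C_eval (p := p) (a := -s)
  have h1 := congrArg (aeval D) hq
  rw [map_sub, hp, map_mul, map_sub, aeval_X, aeval_C, aeval_C, map_neg, sub_neg_eq_add,
    zero_sub] at h1
  have h2 : Commute (D + algebraMap A B s) (aeval D q) := by
    have := (Commute.all (X + C s) q).map (aeval D)
    rwa [map_add, aeval_X, aeval_C] at this
  refine (h2.isUnit_mul_iff.1 ?_).1
  rw [← h1]
  exact (hs.map (algebraMap A B)).neg

end UnitPolynomials

section HolFacts

variable {m : Type*}

lemma holToRat_algebraMap (p : MvPolynomial m ℂ) :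
    holToRat m (algebraMap _ (Hol m) p) = algebraMap _ (RatFun m) p := by
  change IsLocalization.lift _ (algebraMap (MvPolynomial m ℂ) (Hol m) p) = _
  exact IsLocalization.lift_eq (M := nonvan m) _ _

lemma evalZero_algebraMap (p : MvPolynomial m ℂ) :
    evalZero m (algebraMap _ (Hol m) p) = MvPolynomial.constantCoeff p := by
  have h2 : MvPolynomial.aeval (fun _ : m => (0 : ℂ)) p = MvPolynomial.constantCoeff p := by
    rw [MvPolynomial.aeval_zero']; rfl
  rw [← h2]
  change IsLocalization.lift _ (algebraMap (MvPolynomial m ℂ) (Hol m) p) = _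
  exact IsLocalization.lift_eq (M := nonvan m) _ _

lemma exists_hol_mul_eq (a : Hol m) : ∃ (p : MvPolynomial m ℂ) (q : nonvan m),
    a * algebraMap _ (Hol m) (q : MvPolynomial m ℂ) = algebraMap _ (Hol m) p := by
  obtain ⟨p, q, rfl⟩ := IsLocalization.exists_mk'_eq (nonvan m) a
  exact ⟨p, q, IsLocalization.mk'_spec _ _ _⟩

lemma holToRat_injective : Function.Injective (holToRat m) := by
  refine (injective_iff_map_eq_zero _).2 fun a ha => ?_
  obtain ⟨p, q, h⟩ := exists_hol_mul_eq a
  have h1 := congrArg (holToRat m) h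
  rw [map_mul, ha, zero_mul, holToRat_algebraMap] at h1
  have h2 : p = 0 := FaithfulSMul.algebraMap_injective (MvPolynomial m ℂ) (RatFun m) (by
    rw [← h1, map_zero])
  rw [h2, map_zero] at h
  exact (IsLocalization.map_units (Hol m) q).mul_left_eq_zero.1 h

lemma isUnit_of_evalZero_ne_zero {a : Hol m} (ha : evalZero m a ≠ 0) : IsUnit a := by
  obtain ⟨p, q, h⟩ := exists_hol_mul_eq a
  have h1 := congrArg (evalZero m) h
  rw [map_mul, evalZero_algebraMap, evalZero_algebraMap] at h1
  have hq : MvPolynomial.constantCoeff (q : MvPolynomial m ℂ) ≠ 0 := nonZeroDivisors.ne_zero q.2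
  have hp : p ∈ nonvan m := by
    refine mem_nonZeroDivisors_of_ne_zero ?_
    change MvPolynomial.constantCoeff p ≠ 0
    rw [← h1]
    exact mul_ne_zero ha hq
  have h2 := IsLocalization.map_units (Hol m) (⟨p, hp⟩ : nonvan m)
  rw [← h] at h2
  exact isUnit_of_mul_isUnit_left h2

end HolFacts

section DefRep

set_option linter.unusedSectionVars false

open Polynomial

variable {ι V₀ N : Type*} [AddCommGroup V₀] [Module ℝ V₀] [AddCommGroup N] [Module ℝ N]
  {P : RootPairing ι ℝ V₀ N} {b : SimpleRoots P} {k : Param b} {J : Set b.support}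
  {U : Type*} [AddCommGroup U] [Module ℂ U]
  {A A' : Type*} [CommRing A] [Algebra ℂ A] [CommRing A'] [Algebra ℂ A']

lemma add_algebraMap_comm {A B : Type*} [CommRing A] [Ring B] [Algebra A B] {x y : B}
    (h : x * y = y * x) (s t : A) : (x + algebraMap A B s) * (y + algebraMap A B t) =
      (y + algebraMap A B t) * (x + algebraMap A B s) := by
  have h1 := Algebra.commutes s y
  have h2 := Algebra.commutes t x
  have h3 := Algebra.commutes s (algebraMap A B t)
  rw [mul_add, add_mul, add_mul, mul_add, add_mul, add_mul, h, h1, h2, h3]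
  abel

section DefHom

variable {B : Type*} [Ring B] [Algebra ℂ B] [Algebra A B] [IsScalarTower ℂ A B]
  (β : Module.End ℂ U →ₐ[ℂ] B) (ρ : HJ k J →ₐ[ℂ] Module.End ℂ U) (η : Cx V₀ →ₗ[ℂ] A)

/-- The elements `β(v) + η(v)`. -/
def defVec : Cx V₀ →ₗ[ℂ] B :=
  β.toLinearMap ∘ₗ ρ.toLinearMap ∘ₗ HeckeAlg.f.toLinearMap ∘ₗ SymmetricAlgebra.ι ℂ (Cx V₀) +
    (IsScalarTower.toAlgHom ℂ A B).toLinearMap ∘ₗ η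

lemma defVec_apply (v : Cx V₀) : defVec β ρ η v = β (ρ (vec k J v)) + algebraMap A B (η v) := rfl

lemma defVec_comm (x y : Cx V₀) : defVec β ρ η x * defVec β ρ η y =
    defVec β ρ η y * defVec β ρ η x := by
  have h1 := congrArg (fun h => β (ρ h)) (vec_mul_vec (k := k) (J := J) x y)
  simp only [map_mul] at h1
  exact add_algebraMap_comm h1 _ _

/-- The deformation of `β ∘ ρ` in which `v ∈ V` acts by `β(v) + η(v)`, for a `W_J`-invariant linear
map `η : V → A`. -/
def defHom (hη : ∀ α ∈ J, ∀ v, η (cxMap (P.reflection α) v) = η v) : HJ k J →ₐ[ℂ] B :=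
  HeckeAlg.lift (((β : Module.End ℂ U →* B).comp (ρ : HJ k J →* _)).comp HeckeAlg.t)
    (symLift (defVec β ρ η) (defVec_comm β ρ η)) (by
    intro α hα v
    have h := congrArg (fun x => β (ρ x))
      (HeckeAlg.cross (k := k) (j := SymmetricAlgebra.ι ℂ (Cx V₀)) hα v)
    simp only [map_sub, map_mul, AlgHom.commutes] at h
    rw [symLift_ι, symLift_ι, defVec_apply, defVec_apply, hη α hα, map_mul, ← h]
    simp only [MonoidHom.comp_apply, MonoidHom.coe_coe]
    rw [mul_add, add_mul, Algebra.commutes (η v)]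
    abel)

variable (hη : ∀ α ∈ J, ∀ v, η (cxMap (P.reflection α) v) = η v)

lemma defHom_t (w : weyl b J) : defHom β ρ η hη (HeckeAlg.t w) = β (ρ (HeckeAlg.t w)) :=
  HeckeAlg.lift_t _ _ _ _

lemma defHom_vec (v : Cx V₀) : defHom β ρ η hη (vec k J v) =
    β (ρ (vec k J v)) + algebraMap A B (η v) :=
  (HeckeAlg.lift_f _ _ _ _).trans (symLift_ι _ _ v)

end DefHom

variable (ρ : HJ k J →ₐ[ℂ] Module.End ℂ U) (η : Cx V₀ →ₗ[ℂ] A)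
  (hη : ∀ α ∈ J, ∀ v, η (cxMap (P.reflection α) v) = η v)

/-- The representation of `ℍ_J` on `A ⊗ U` in which `t_w` acts by `1 ⊗ t_w` and `v ∈ V` by
`1 ⊗ v + η(v)`. -/
def defRep :
    HJ k J →ₐ[ℂ] Module.End A (A ⊗[ℂ] U) :=
  defHom (B := Module.End A (A ⊗[ℂ] U)) (Module.End.baseChangeHom ℂ A U) ρ η hη

lemma defRep_t (w : weyl b J) : defRep ρ η hη (HeckeAlg.t w) =
    Module.End.baseChangeHom ℂ A U (ρ (HeckeAlg.t w)) := defHom_t _ ρ η hη w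

lemma defRep_vec (v : Cx V₀) : defRep ρ η hη (vec k J v) =
    Module.End.baseChangeHom ℂ A U (ρ (vec k J v)) + algebraMap A _ (η v) := defHom_vec _ ρ η hη v

lemma baseChangeHom_tmul (F : Module.End ℂ U) (a : A) (u : U) :
    Module.End.baseChangeHom ℂ A U F (a ⊗ₜ u) = a ⊗ₜ F u := rfl

/-- The map `A ⊗ U → A' ⊗ U` induced by `φ : A → A'`. -/
def mapScalars (U : Type*) [AddCommGroup U] [Module ℂ U] (φ : A →ₐ[ℂ] A') :
    A ⊗[ℂ] U →ₗ[ℂ] A' ⊗[ℂ] U :=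
  TensorProduct.map φ.toLinearMap LinearMap.id

lemma mapScalars_smul (φ : A →ₐ[ℂ] A') (a : A) (z : A ⊗[ℂ] U) :
    mapScalars U φ (a • z) = φ a • mapScalars U φ z := by
  induction z using TensorProduct.induction_on with
  | zero => rw [smul_zero, map_zero, smul_zero]
  | tmul c u =>
    rw [smul_tmul', mapScalars, map_tmul, map_tmul, smul_tmul']
    simp
  | add x y hx hy => rw [smul_add, map_add, hx, hy, map_add, smul_add]

lemma mapScalars_baseChange (φ : A →ₐ[ℂ] A') (F : Module.End ℂ U) (z : A ⊗[ℂ] U) :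
    mapScalars U φ (Module.End.baseChangeHom ℂ A U F z) =
      Module.End.baseChangeHom ℂ A' U F (mapScalars U φ z) := by
  induction z using TensorProduct.induction_on with
  | zero => simp
  | tmul c u => rfl
  | add x y hx hy => rw [map_add, map_add, hx, hy, map_add, map_add]

lemma mapScalars_defRep (φ : A →ₐ[ℂ] A') (η' : Cx V₀ →ₗ[ℂ] A')
    (hη' : ∀ α ∈ J, ∀ v, η' (cxMap (P.reflection α) v) = η' v) (hφ : ∀ v, φ (η v) = η' v)
    (h : HJ k J) (z : A ⊗[ℂ] U) :
    mapScalars U φ (defRep ρ η hη h z) = defRep ρ η' hη' h (mapScalars U φ z) := by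
  induction h using HJ.induction generalizing z with
  | algebraMap c =>
    rw [AlgHom.commutes, AlgHom.commutes, Module.algebraMap_end_apply, Module.algebraMap_end_apply,
      map_smul]
  | refl α hα => rw [defRep_t, defRep_t, mapScalars_baseChange]
  | vec v =>
    rw [defRep_vec, defRep_vec, LinearMap.add_apply, LinearMap.add_apply, map_add,
      mapScalars_baseChange, Module.algebraMap_end_apply, Module.algebraMap_end_apply,
      mapScalars_smul, hφ]
  | mul x y hx hy => rw [map_mul, map_mul, Module.End.mul_apply, Module.End.mul_apply, hx, hy]
  | add x y hx hy =>
    rw [map_add, map_add, LinearMap.add_apply, LinearMap.add_apply, map_add, hx, hy]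

/-- The specialization `A ⊗ U → U` at a point `φ : A → ℂ`. -/
def specialize (U : Type*) [AddCommGroup U] [Module ℂ U] (φ : A →ₐ[ℂ] ℂ) : A ⊗[ℂ] U →ₗ[ℂ] U :=
  (TensorProduct.lid ℂ U).toLinearMap ∘ₗ TensorProduct.map φ.toLinearMap LinearMap.id

lemma specialize_tmul (φ : A →ₐ[ℂ] ℂ) (a : A) (u : U) : specialize U φ (a ⊗ₜ u) = φ a • u := rfl

lemma specialize_smul (φ : A →ₐ[ℂ] ℂ) (a : A) (z : A ⊗[ℂ] U) :
    specialize U φ (a • z) = φ a • specialize U φ z := by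
  induction z using TensorProduct.induction_on with
  | zero => rw [smul_zero, map_zero, smul_zero]
  | tmul c u => rw [smul_tmul', specialize_tmul, specialize_tmul, smul_eq_mul, map_mul, mul_smul]
  | add x y hx hy => rw [smul_add, map_add, hx, hy, map_add, smul_add]

lemma specialize_baseChange (φ : A →ₐ[ℂ] ℂ) (F : Module.End ℂ U) (z : A ⊗[ℂ] U) :
    specialize U φ (Module.End.baseChangeHom ℂ A U F z) = F (specialize U φ z) := by
  induction z using TensorProduct.induction_on with
  | zero => simp
  | tmul c u => rw [baseChangeHom_tmul, specialize_tmul, specialize_tmul, map_smul]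
  | add x y hx hy => rw [map_add, map_add, hx, hy, map_add, map_add]

/-- A deformation specializes to the original representation where `η` vanishes. -/
lemma specialize_defRep (φ : A →ₐ[ℂ] ℂ) (hφ : ∀ v, φ (η v) = 0) (h : HJ k J) (z : A ⊗[ℂ] U) :
    specialize U φ (defRep ρ η hη h z) = ρ h (specialize U φ z) := by
  induction h using HJ.induction generalizing z with
  | algebraMap c =>
    rw [AlgHom.commutes, AlgHom.commutes, Module.algebraMap_end_apply, Module.algebraMap_end_apply,
      map_smul]
  | refl α hα => rw [defRep_t, specialize_baseChange]
  | vec v =>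
    rw [defRep_vec, LinearMap.add_apply, map_add, specialize_baseChange,
      Module.algebraMap_end_apply, specialize_smul, hφ, zero_smul, add_zero]
  | mul x y hx hy => rw [map_mul, map_mul, Module.End.mul_apply, Module.End.mul_apply, hx, hy]
  | add x y hx hy =>
    rw [map_add, map_add, LinearMap.add_apply, LinearMap.add_apply, map_add, hx, hy]

section Forms

variable {m : Type*} [Fintype m] (ω : Module.Basis m ℂ (VJPerp J))

/-- The linear map `η_a : V → ℂ(a)`, with values in the functions holomorphic at `a = 0`. -/
def etaHol : Cx V₀ →ₗ[ℂ] Hol m :=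
  (IsScalarTower.toAlgHom ℂ (MvPolynomial m ℂ) (Hol m)).toLinearMap ∘ₗ
    ∑ i, (LinearMap.toSpanSingleton ℂ (MvPolynomial m ℂ) (MvPolynomial.X i)) ∘ₗ
      ((ω i : Module.Dual ℂ (Cx V₀)))

lemma etaHol_apply (v : Cx V₀) : etaHol ω v = algebraMap (MvPolynomial m ℂ) (Hol m)
      (∑ i, (ω i : Module.Dual ℂ (Cx V₀)) v • MvPolynomial.X i) := by
  rw [etaHol, LinearMap.comp_apply, LinearMap.sum_apply]
  rfl

lemma holToRat_etaHol (v : Cx V₀) : holToRat m (etaHol ω v) = eta ω v := by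
  rw [etaHol_apply, holToRat_algebraMap, eta_apply]

lemma evalZero_etaHol (v : Cx V₀) : evalZero m (etaHol ω v) = 0 := by
  rw [etaHol_apply, evalZero_algebraMap]
  simp

lemma etaHol_reflection (α : b.support) (hα : α ∈ J) (v : Cx V₀) :
    etaHol ω (cxMap (P.reflection α) v) = etaHol ω v :=
  holToRat_injective (by rw [holToRat_etaHol, holToRat_etaHol, eta_reflection ω hα])

lemma deform_t [Module.Finite ℂ U] (w : weyl b J) : deform ω ρ (HeckeAlg.t w) =
    Module.End.baseChangeHom ℂ (RatFun m) U (ρ (HeckeAlg.t w)) := by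
  rw [deform, HeckeAlg.lift_t]; rfl

lemma deform_f [Module.Finite ℂ U] (q : OJ J) : deform ω ρ (HeckeAlg.f q) = ratAct ω ρ q := by
  rw [deform, HeckeAlg.lift_f]

lemma loc_f (p : SV V₀) : loc k J (HeckeAlg.f p) = HeckeAlg.f (algebraMap (SV V₀) (OJ J) p) := by
  exact HeckeAlg.lift_f _ _ _ _

lemma loc_t (w : weyl b J) : loc k J (HeckeAlg.t w) = HeckeAlg.t w := by
  exact HeckeAlg.lift_t _ _ _ _

/-- The restriction of `U_a` to `ℍ_J`. -/
lemma deform_loc [Module.Finite ℂ U] (h : HJ k J) : deform ω ρ (loc k J h) =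
    defRep ρ (eta ω) (fun _ hα v => eta_reflection ω hα v) h := by
  induction h using HJ.induction with
  | algebraMap c => simp only [AlgHom.commutes]
  | refl α hα => rw [loc_t, deform_t, defRep_t]
  | vec v => rw [loc_f, deform_f, ratAct_algebraMap, symAct_ι, defRep_vec]
  | mul x y hx hy => rw [map_mul, map_mul, map_mul, hx, hy]
  | add x y hx hy => rw [map_add, map_add, map_add, hx, hy]

end Forms

/-! ### A polynomial annihilating the translated weights -/

section AnnPoly

variable [Fintype ι] [P.IsReduced] [Module.Finite ℂ U]

open Classical in
/-- The product over `1 ≠ x ∈ W^J` of the characteristic polynomials of `x⁻¹(v)` on `U`, shifted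
by `η(x⁻¹(v))`: it annihilates the operators by which the vectors `x⁻¹(v)` act on a deformation. -/
def annPoly (v : Cx V₀) : A[X] :=
  ∏ x ∈ Finset.univ.erase (oneRep J : minReps b J),
    ((LinearMap.charpoly (ρ (vec k J (cxMap (x : V₀ ≃ₗ[ℝ] V₀)⁻¹ v)))).map (algebraMap ℂ A)).comp
      (X - C (η (cxMap (x : V₀ ≃ₗ[ℝ] V₀)⁻¹ v)))

lemma annPoly_map (φ : A →ₐ[ℂ] A') (η' : Cx V₀ →ₗ[ℂ] A') (hφ : ∀ v, φ (η v) = η' v) (v : Cx V₀) :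
    (annPoly ρ η v).map (φ : A →+* A') = annPoly ρ η' v := by
  rw [annPoly, annPoly, Polynomial.map_prod]
  refine Finset.prod_congr rfl fun x _ => ?_
  rw [Polynomial.map_comp, Polynomial.map_map, Polynomial.map_sub, map_X, map_C]
  congr 2
  · rw [AlgHom.comp_algebraMap]
  · rw [RingHom.coe_coe, hφ]

variable {B : Type*} [Ring B] [Algebra ℂ B] [Algebra A B] [IsScalarTower ℂ A B]
  (β : Module.End ℂ U →ₐ[ℂ] B)

lemma aeval_comp_shift (p : ℂ[X]) (F : Module.End ℂ U) (s t : A) :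
    aeval (β F + algebraMap A B s) ((p.map (algebraMap ℂ A)).comp (X - C t)) =
      aeval (β F + algebraMap A B (s - t)) p := by
  rw [aeval_comp, aeval_map_algebraMap, map_sub, aeval_X, aeval_C, map_sub, add_sub_assoc]

lemma aeval_annPoly_eq_zero {x : minReps b J} (hx : x ≠ oneRep J) (v : Cx V₀) :
    aeval (β (ρ (vec k J (cxMap (x : V₀ ≃ₗ[ℝ] V₀)⁻¹ v))) +
      algebraMap A B (η (cxMap (x : V₀ ≃ₗ[ℝ] V₀)⁻¹ v))) (annPoly ρ η v) = 0 := by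
  classical
  rw [annPoly, ← Finset.mul_prod_erase _ _ (Finset.mem_erase.2 ⟨hx, Finset.mem_univ x⟩), map_mul,
    aeval_comp_shift, sub_self, map_zero, add_zero, aeval_algHom_apply, LinearMap.aeval_self_charpoly,
    map_zero, zero_mul]

lemma isUnit_aeval_annPoly (v v' : Cx V₀)
    (h : ∀ x : minReps b J, x ≠ oneRep J → ∀ c : ℂ,
      (ρ (vec k J (cxMap (x : V₀ ≃ₗ[ℝ] V₀)⁻¹ v))).HasEigenvalue c →
      IsUnit (aeval (algebraMap ℂ A c - (η v' - η (cxMap (x : V₀ ≃ₗ[ℝ] V₀)⁻¹ v)))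
        (LinearMap.charpoly (ρ (vec k J v'))))) :
    IsUnit (aeval (β (ρ (vec k J v')) + algebraMap A B (η v')) (annPoly ρ η v)) := by
  classical
  rw [annPoly]
  refine Finset.prod_induction _ (fun q => IsUnit (aeval (β (ρ (vec k J v')) +
    algebraMap A B (η v')) q)) (fun p q hp hq => by rw [map_mul]; exact hp.mul hq) (by simp) ?_
  intro x hx
  rw [aeval_comp_shift]
  refine isUnit_aeval_of_isRoot (LinearMap.charpoly_monic _).ne_zero fun c hc => ?_
  have h1 := h x (Finset.ne_of_mem_erase hx) c ((Module.End.hasEigenvalue_iff_isRoot_charpoly _ _).2 hc)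
  rw [IsScalarTower.algebraMap_apply ℂ A B, add_sub_assoc, ← map_sub]
  refine isUnit_add_algebraMap (p := (LinearMap.charpoly (ρ (vec k J v'))).map (algebraMap ℂ A)) ?_ ?_
  · rw [aeval_map_algebraMap, aeval_algHom_apply, LinearMap.aeval_self_charpoly, map_zero]
  · rw [neg_sub, eval_map_algebraMap]
    exact h1

end AnnPoly

end DefRep


/-! ### Weights of tempered modules -/

section Weights

set_option linter.unusedSectionVars false

variable {ι V₀ N : Type*} [AddCommGroup V₀] [Module ℝ V₀] [AddCommGroup N] [Module ℝ N]
  {P : RootPairing ι ℝ V₀ N} {b : SimpleRoots P} {k : Param b} {J : Set b.support}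
  {U : Type*} [AddCommGroup U] [Module ℂ U] [Module.Finite ℂ U]

lemma exists_common_eigenvector {V : Type*} [AddCommGroup V] [Module ℂ V]
    (D : V →ₗ[ℂ] Module.End ℂ U) (hD : ∀ x y, D x * D y = D y * D x) {v : V} {c : ℂ}
    (hc : (D v).HasEigenvalue c) :
    ∃ γ : Module.Dual ℂ V, γ v = c ∧ ∃ u : U, u ≠ 0 ∧ ∀ x, D x u = γ x • u := by
  have hcomm : ∀ x y u, D x (D y u) = D y (D x u) := fun x y u => by
    rw [← Module.End.mul_apply, hD, Module.End.mul_apply]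
  obtain ⟨T, ⟨hT0, hTD, hTv⟩, hmin⟩ := exists_minimal_of_wellFoundedLT
    (fun T : Submodule ℂ U => T ≠ ⊥ ∧ (∀ x, ∀ u ∈ T, D x u ∈ T) ∧ T ≤ (D v).eigenspace c)
    ⟨(D v).eigenspace c, hc, fun x u hu => by
      rw [Module.End.mem_eigenspace_iff] at hu ⊢
      rw [hcomm, hu, map_smul], le_rfl⟩
  -- every operator of the family acts on the minimal invariant subspace by a scalar
  have hsc : ∀ x, ∃ a : ℂ, ∀ u ∈ T, D x u = a • u := by
    intro x
    have : Nontrivial T := (Submodule.nontrivial_iff_ne_bot).2 hT0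
    obtain ⟨a, ha⟩ := Module.End.exists_eigenvalue ((D x).restrict (hTD x))
    obtain ⟨u, hu⟩ := ha.exists_hasEigenvector
    have hu1 : D x (u : U) = a • (u : U) := congrArg Subtype.val hu.apply_eq_smul
    refine ⟨a, fun u' hu' => ?_⟩
    have h1 := @hmin (T ⊓ (D x).eigenspace a) ⟨?_, ?_, inf_le_left.trans hTv⟩ inf_le_left
    · exact Module.End.mem_eigenspace_iff.1 (h1 hu').2
    · intro hbot
      have : (u : U) ∈ T ⊓ (D x).eigenspace a := ⟨u.2, Module.End.mem_eigenspace_iff.2 hu1⟩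
      rw [hbot, Submodule.mem_bot] at this
      exact hu.2 (Subtype.ext this)
    · rintro y w ⟨hw, hw'⟩
      refine ⟨hTD y w hw, ?_⟩
      rw [SetLike.mem_coe, Module.End.mem_eigenspace_iff] at hw' ⊢
      rw [hcomm, hw', map_smul]
  choose g hg using hsc
  obtain ⟨u, hu, hu0⟩ := Submodule.exists_mem_ne_zero_of_ne_bot hT0
  have hinj := smul_left_injective ℂ hu0
  refine ⟨{ toFun := g, map_add' := fun x y => hinj ?_, map_smul' := fun a x => hinj ?_ },
    hinj ?_, u, hu0, fun x => hg x u hu⟩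
  · simp only [add_smul]
    rw [← hg _ u hu, ← hg _ u hu, ← hg _ u hu, map_add, LinearMap.add_apply]
  · simp only [RingHom.id_apply, smul_eq_mul, mul_smul]
    rw [← hg _ u hu, ← hg _ u hu, map_smul, LinearMap.smul_apply]
  · change g v • u = c • u
    rw [← hg _ u hu]
    exact Module.End.mem_eigenspace_iff.1 (hTv hu)

variable {ρ : HJ k J →ₐ[ℂ] Module.End ℂ U}

lemma exists_isWeight {v : Cx V₀} {c : ℂ} (hc : (ρ (vec k J v)).HasEigenvalue c) :
    ∃ γ, IsWeight ρ γ ∧ γ v = c := by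
  obtain ⟨γ, hγ, u, hu, h⟩ := exists_common_eigenvector
    (ρ.toLinearMap ∘ₗ HeckeAlg.f.toLinearMap ∘ₗ SymmetricAlgebra.ι ℂ (Cx V₀)) (fun x y => by
      change ρ (vec k J x) * ρ (vec k J y) = ρ (vec k J y) * ρ (vec k J x)
      rw [← map_mul, vec_mul_vec, map_mul]) hc
  refine ⟨γ, ⟨u, hu, fun v => ⟨1, one_pos, ?_⟩⟩, hγ⟩
  rw [pow_one, LinearMap.sub_apply, Module.algebraMap_end_apply, sub_eq_zero]
  exact h v

lemma IsWeight.hasEigenvalue {γ : Module.Dual ℂ (Cx V₀)} (h : IsWeight ρ γ) (v : Cx V₀) :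
    (ρ (vec k J v)).HasEigenvalue (γ v) := by
  obtain ⟨u, hu, hr⟩ := h
  obtain ⟨r, -, hr⟩ := hr v
  intro hbot
  change Module.End.eigenspace _ _ = ⊥ at hbot
  rw [Module.End.eigenspace_def, LinearMap.ker_eq_bot] at hbot
  have h1 : Function.Injective ((ρ (vec k J v) - algebraMap ℂ (Module.End ℂ U) (γ v)) ^ r) := by
    rw [Module.End.coe_pow]
    exact hbot.iterate r
  exact hu (h1 (by rw [map_zero]; exact hr))

variable [Finite ι]

lemma module_finite_of_simpleRoots (b : SimpleRoots P) : Module.Finite ℝ V₀ :=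
  Module.Finite.of_basis b.basis

lemma finite_isWeight : {γ | IsWeight ρ γ}.Finite := by
  have := module_finite_of_simpleRoots b
  let B := Module.finBasis ℂ (Cx V₀)
  have h1 : (Set.univ.pi fun i => {c | (ρ (vec k J (B i))).HasEigenvalue c}).Finite :=
    Set.Finite.pi fun i => Module.End.finite_hasEigenvalue _
  refine (h1.preimage (f := fun (γ : Module.Dual ℂ (Cx V₀)) i => γ (B i)) ?_).subset ?_
  · intro γ _ γ' _ h
    exact B.ext fun i => congrFun h i
  · intro γ hγ i _
    exact IsWeight.hasEigenvalue hγ (B i)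

lemma vec_mul_of_fixed {z : Cx V₀} (hz : ∀ α ∈ J, cxMap (P.reflection α) z = z) (h : HJ k J) :
    vec k J z * h = h * vec k J z := by
  induction h using HJ.induction with
  | algebraMap c => exact (Algebra.commutes c _).symm
  | refl α hα =>
    have h1 : cxCoroot P α z = 0 := by
      have h2 := hz α hα
      rw [cxMap_reflection, sub_eq_self] at h2
      exact (smul_eq_zero.1 h2).resolve_right (cxRoot_ne_zero _)
    rw [vec_mul_t_sRefl, hz α hα, h1, mul_zero, map_zero, add_zero]
  | vec v => exact vec_mul_vec _ _
  | mul x y hx hy => rw [← mul_assoc, hx, mul_assoc, hy, mul_assoc]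
  | add x y hx hy => rw [mul_add, add_mul, hx, hy]

/-- The vectors fixed by `W_J` are central in `ℍ_J`, so that each has only one eigenvalue on an
indecomposable module. -/
lemma IsWeight.apply_eq_of_fixed (hρ : IsIndec ρ) {γ γ' : Module.Dual ℂ (Cx V₀)}
    (hγ : IsWeight ρ γ) (hγ' : IsWeight ρ γ') {z : Cx V₀}
    (hz : ∀ α ∈ J, cxMap (P.reflection α) z = z) : γ' z = γ z := by
  set f := ρ (vec k J z) - algebraMap ℂ (Module.End ℂ U) (γ z) with hf
  have hcomm : ∀ h : HJ k J, Commute f (ρ h) := fun h => by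
    refine Commute.sub_left ?_ (Algebra.commutes _ _)
    change ρ (vec k J z) * ρ h = ρ h * ρ (vec k J z)
    rw [← map_mul, vec_mul_of_fixed hz, map_mul]
  obtain ⟨u, hu, hr⟩ := hγ
  obtain ⟨r, -, hr⟩ := hr z
  obtain ⟨n, hn, hrn⟩ := ((LinearMap.eventually_isCompl_ker_pow_range_pow f).and
    (Filter.eventually_ge_atTop r)).exists
  have hker : IsStable ρ (LinearMap.ker (f ^ n)) := fun h x hx => by
    rw [LinearMap.mem_ker] at hx ⊢
    rw [← Module.End.mul_apply, ((hcomm h).pow_left n).eq, Module.End.mul_apply, hx, map_zero]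
  have hrange : IsStable ρ (LinearMap.range (f ^ n)) := by
    rintro h _ ⟨x, rfl⟩
    refine ⟨ρ h x, ?_⟩
    rw [← Module.End.mul_apply, ((hcomm h).pow_left n).eq, Module.End.mul_apply]
  have h0 : f ^ n = 0 := by
    rcases hρ.2 _ _ hker hrange hn with h | h
    · exfalso
      have : u ∈ LinearMap.ker (f ^ n) := by
        obtain ⟨e, rfl⟩ := Nat.exists_eq_add_of_le' hrn
        rw [LinearMap.mem_ker, pow_add, Module.End.mul_apply]
        exact (congrArg _ hr).trans (map_zero _)
      rw [h, Submodule.mem_bot] at this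
      exact hu this
    · exact LinearMap.range_eq_bot.1 h
  obtain ⟨u', hu'⟩ := (hγ'.hasEigenvalue z).exists_hasEigenvector
  have h1 : f.HasEigenvector (γ' z - γ z) u' := by
    refine ⟨Module.End.mem_eigenspace_iff.2 ?_, hu'.2⟩
    rw [hf, LinearMap.sub_apply, hu'.apply_eq_smul, Module.algebraMap_end_apply, sub_smul]
  have h2 := h1.pow_apply n
  rw [h0, LinearMap.zero_apply] at h2
  exact sub_eq_zero.1 (eq_zero_of_pow_eq_zero ((smul_eq_zero.1 h2.symm).resolve_right hu'.2))

end Weights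

section Tempered

set_option linter.unusedSectionVars false

variable {ι V₀ N : Type*} [Fintype ι] [AddCommGroup V₀] [Module ℝ V₀] [AddCommGroup N] [Module ℝ N]
  {P : RootPairing ι ℝ V₀ N} {b : SimpleRoots P} {k : Param b} {J : Set b.support}
  {U : Type*} [AddCommGroup U] [Module ℂ U] [Module.Finite ℂ U]
  {ρ : HJ k J →ₐ[ℂ] Module.End ℂ U}

lemma exists_rootForm_eq (b : SimpleRoots P) (g : Module.Dual ℝ V₀) :
    ∃ n, ∀ y, P.RootForm n y = g y := by
  have := module_finite_of_simpleRoots b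
  have h1 : Function.Injective P.RootForm := by
    refine (injective_iff_map_eq_zero _).2 fun x hx => ?_
    by_contra hne
    have := rootForm_pos b hne
    rw [hx, LinearMap.zero_apply] at this
    exact lt_irrefl _ this
  have h2 := (LinearMap.injective_iff_surjective_of_finrank_eq_finrank
    (f := (P.RootForm : V₀ →ₗ[ℝ] Module.Dual ℝ V₀)) Subspace.dual_finrank_eq.symm).1 h1
  obtain ⟨n, hn⟩ := h2 g
  exact ⟨n, fun y => by rw [hn]⟩

/-- The real part of a weight of a tempered module is the sum of a vector orthogonal to `J` which
is positive on the other simple roots and of one in the cone generated by `-J`. -/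
lemma IsTempered.exists_decomp (hρ : IsTempered ρ) {γ : Module.Dual ℂ (Cx V₀)}
    (hγ : IsWeight ρ γ) : ∃ n d : V₀, (∀ y, rePart γ y = P.RootForm (n + d) y) ∧
      (∀ α ∈ J, P.RootForm (P.root α) n = 0) ∧ (∀ α ∉ J, 0 < P.RootForm (P.root α) n) ∧
      PosVec b (-d) ∧ ∀ β ∉ J, b.basis.repr d β = 0 := by
  classical
  obtain ⟨a, c, ha, hc, h⟩ := hρ γ hγ
  set S := (Set.toFinite J).toFinset with hS
  set S' := (Set.toFinite Jᶜ).toFinset with hS'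
  rw [finsum_mem_eq_finite_toFinset_sum _ (Set.toFinite J),
    finsum_mem_eq_finite_toFinset_sum _ (Set.toFinite Jᶜ), ← hS, ← hS'] at h
  have hB : ∀ α : b.support, 0 < P.RootForm (P.root α) (P.root α) := fun α =>
    rootForm_pos b (P.ne_zero _)
  obtain ⟨n, hn⟩ := exists_rootForm_eq b (∑ α ∈ S', c α • b.basis.coord α)
  set d := ∑ α ∈ S, (2 * a α / P.RootForm (P.root α) (P.root α)) • P.root α with hd
  have hnα : ∀ α : b.support, P.RootForm (P.root α) n = if α ∈ S' then c α else 0 := by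
    intro α
    rw [rootForm_comm, hn, LinearMap.sum_apply]
    simp only [LinearMap.smul_apply, Module.Basis.coord_apply, ← b.basis_apply,
      Module.Basis.repr_self, Finsupp.single_apply, smul_eq_mul, mul_ite, mul_one, mul_zero]
    rw [Finset.sum_ite_eq]
  have hdβ : ∀ β : b.support, b.basis.repr d β =
      if β ∈ S then 2 * a β / P.RootForm (P.root β) (P.root β) else 0 := by
    intro β
    rw [hd, map_sum, Finsupp.finsetSum_apply]
    have : ∀ α : b.support, b.basis.repr ((2 * a α / P.RootForm (P.root α) (P.root α)) •
        P.root α) β = if β = α then 2 * a α / P.RootForm (P.root α) (P.root α) else 0 := by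
      intro α
      rw [map_smul, Finsupp.smul_apply, ← b.basis_apply, Module.Basis.repr_self,
        Finsupp.single_apply, smul_eq_mul, mul_ite, mul_one, mul_zero]
      simp only [eq_comm]
    simp only [this]
    rw [Finset.sum_ite_eq]
  refine ⟨n, d, fun y => ?_, fun α hα => ?_, fun α hα => ?_, fun β => ?_, fun β hβ => ?_⟩
  · rw [h, map_add, LinearMap.add_apply, LinearMap.add_apply, hn, add_comm, hd, map_sum,
      LinearMap.sum_apply, LinearMap.sum_apply]
    congr 1
    rw [LinearMap.sum_apply]
    refine Finset.sum_congr rfl fun α _ => ?_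
    have h1 := two_mul_rootForm (P := P) (α : ι) y
    rw [map_smul, LinearMap.smul_apply, LinearMap.smul_apply, smul_eq_mul, smul_eq_mul,
      div_mul_eq_mul_div, eq_div_iff (hB α).ne']
    linear_combination (-a α) * h1
  · rw [hnα, if_neg]
    simpa [hS'] using hα
  · rw [hnα, if_pos]
    · exact hc α
    · simpa [hS'] using hα
  · rw [map_neg, Finsupp.neg_apply, hdβ]
    split_ifs
    · rw [neg_nonneg]
      exact div_nonpos_of_nonpos_of_nonneg (by linarith [ha β]) (hB β).le
    · simp
  · rw [hdβ, if_neg]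
    simpa [hS] using hβ

lemma rootForm_eq_zero_of_supported {J : Set b.support} {n d : V₀}
    (hn : ∀ α ∈ J, P.RootForm (P.root α) n = 0) (hd : ∀ β ∉ J, b.basis.repr d β = 0) :
    P.RootForm d n = 0 := by
  have := Fintype.ofFinite b.support
  rw [← b.basis.sum_repr d, map_sum, LinearMap.sum_apply]
  refine Finset.sum_eq_zero fun β _ => ?_
  rw [map_smul, LinearMap.smul_apply, b.basis_apply]
  by_cases hβ : β ∈ J
  · rw [hn β hβ, smul_zero]
  · rw [hd β hβ, zero_smul]

variable [P.IsReduced]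

/-- The weights of an indecomposable tempered module are not conjugate to each other under
nontrivial elements of `W^J`. -/
lemma IsTempered.weight_ne (hρ : IsTempered ρ) (hρ' : IsIndec ρ) {γ γ' : Module.Dual ℂ (Cx V₀)}
    (hγ : IsWeight ρ γ) (hγ' : IsWeight ρ γ') {x : V₀ ≃ₗ[ℝ] V₀} (hx : x ∈ minReps b J)
    (h : γ = γ' ∘ₗ cxMap x⁻¹) : x = 1 := by
  obtain ⟨n, d, h1, h2, h3, h4, h5⟩ := hρ.exists_decomp hγ
  obtain ⟨n', d', h1', h2', h3', h4', h5'⟩ := hρ.exists_decomp hγ'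
  have h2n : ∀ α ∈ J, P.RootForm (P.root α) (n - n') = 0 := fun α hα => by
    rw [map_sub, h2 α hα, h2' α hα, sub_zero]
  -- the dominant parts of the two weights agree
  have hz : ∀ α ∈ J, cxMap (P.reflection α) ((1 : ℂ) ⊗ₜ[ℝ] (n - n')) = 1 ⊗ₜ (n - n') := by
    intro α hα
    have h6 := two_mul_rootForm (P := P) α (n - n')
    rw [h2n α hα, mul_zero] at h6
    have h7 := (mul_eq_zero.1 h6.symm).resolve_left (rootForm_pos b (P.ne_zero _)).ne'
    rw [cxMap_tmul, RootPairing.reflection_apply, h7, zero_smul, sub_zero]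
  have hγz := congrArg Complex.re (hγ.apply_eq_of_fixed hρ' hγ' hz)
  have e1 : (γ (1 ⊗ₜ (n - n'))).re = P.RootForm (n + d) (n - n') := h1 _
  have e2 : (γ' (1 ⊗ₜ (n - n'))).re = P.RootForm (n' + d') (n - n') := h1' _
  rw [e1, e2, map_add, map_add, LinearMap.add_apply, LinearMap.add_apply,
    rootForm_eq_zero_of_supported h2n h5, rootForm_eq_zero_of_supported h2n h5', add_zero,
    add_zero] at hγz
  have hnn : n = n' := by
    by_contra hne
    have := rootForm_pos b (sub_ne_zero.2 hne)
    rw [map_sub P.RootForm, LinearMap.sub_apply] at this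
    linarith
  subst hnn
  refine langlands b h2 h3 h4' h5 h5' hx ?_
  have h8 : ∀ y, P.RootForm (x (n + d') - (n + d)) y = 0 := by
    intro y
    have h9 : rePart γ y = rePart γ' ((x⁻¹ : V₀ ≃ₗ[ℝ] V₀) y) := by rw [h]; rfl
    have h10 := rootForm_weyl b hx.1 (n + d') ((x⁻¹ : V₀ ≃ₗ[ℝ] V₀) y)
    have h11 : x ((x⁻¹ : V₀ ≃ₗ[ℝ] V₀) y) = y := by
      rw [← LinearEquiv.mul_apply, mul_inv_cancel]; rfl
    rw [h11, ← h1', ← h9, h1] at h10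
    rw [map_sub P.RootForm, LinearMap.sub_apply, h10, sub_self]
  by_contra hne
  have := rootForm_pos b (sub_ne_zero.2 hne)
  rw [h8] at this
  exact lt_irrefl _ this

/-- A functional on `V` which vanishes on `V_J` and is `1` on the other simple roots. -/
def outerCoord (J : Set b.support) : Module.Dual ℂ (Cx V₀) :=
  Module.Dual.baseChange ℂ
    (∑ α ∈ (Set.toFinite Jᶜ).toFinset, b.basis.coord α : Module.Dual ℝ V₀)

lemma outerCoord_tmul (x : V₀) : outerCoord (b := b) J (1 ⊗ₜ x) =
    ((∑ α ∈ (Set.toFinite Jᶜ).toFinset, b.basis.repr x α : ℝ) : ℂ) := by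
  rw [outerCoord, Module.Dual.baseChange_apply_tmul, LinearMap.sum_apply]
  simp

lemma outerCoord_eq_zero {v : Cx V₀} (hv : v ∈ VJ J) : outerCoord (b := b) J v = 0 := by
  induction hv using Submodule.span_induction with
  | mem x hx =>
    obtain ⟨α, hα, rfl⟩ := hx
    change outerCoord J (1 ⊗ₜ P.root α) = 0
    rw [outerCoord_tmul, Complex.ofReal_eq_zero]
    refine Finset.sum_eq_zero fun β hβ => ?_
    rw [← b.basis_apply, Module.Basis.repr_self, Finsupp.single_eq_of_ne]
    rintro rfl
    simp [hα] at hβ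
  | zero => rw [map_zero]
  | add x y _ _ hx hy => rw [map_add, hx, hy, add_zero]
  | smul c x _ hx => rw [map_smul, hx, smul_zero]

/-- A nontrivial `x ∈ W^J` does not fix `V` modulo `V_J`: it makes a simple root `α ∉ J` negative. -/
lemma exists_outerCoord_ne {x : minReps b J} (hx : x ≠ oneRep J) :
    ∃ v, (outerCoord J - outerCoord J ∘ₗ cxMap (x : V₀ ≃ₗ[ℝ] V₀)⁻¹ : Module.Dual ℂ (Cx V₀)) v ≠
      0 := by
  obtain ⟨α, -, hα⟩ := exists_descent b x.2.1 (fun h => hx (Subtype.ext h))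
  have hαJ : α ∉ J := fun hc => not_posVec_weyl_neg b (posVec_of_mem_minReps b x.2 hc) hα
  refine ⟨1 ⊗ₜ (x : V₀ ≃ₗ[ℝ] V₀) (P.root α), ?_⟩
  have h1 : ((x : V₀ ≃ₗ[ℝ] V₀)⁻¹ : V₀ ≃ₗ[ℝ] V₀) ((x : V₀ ≃ₗ[ℝ] V₀) (P.root α)) = P.root α := by
    rw [← LinearEquiv.mul_apply, inv_mul_cancel]; rfl
  rw [LinearMap.sub_apply, LinearMap.comp_apply, cxMap_tmul, h1, outerCoord_tmul, outerCoord_tmul,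
    ← Complex.ofReal_sub, Complex.ofReal_ne_zero]
  have h2 : ∑ β ∈ (Set.toFinite Jᶜ).toFinset, b.basis.repr ((x : V₀ ≃ₗ[ℝ] V₀) (P.root α)) β ≤ 0 :=
    Finset.sum_nonpos fun β _ => by simpa using hα β
  have h3 : ∑ β ∈ (Set.toFinite Jᶜ).toFinset, b.basis.repr (P.root α) β = 1 := by
    rw [Finset.sum_eq_single α]
    · rw [← b.basis_apply, Module.Basis.repr_self, Finsupp.single_eq_same]
    · intro β _ hβ
      rw [← b.basis_apply, Module.Basis.repr_self, Finsupp.single_eq_of_ne hβ]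
    · intro h; exact absurd hαJ (by simpa using h)
  rw [h3]
  intro h
  linarith

/-- The existence of `v ∈ V` which separates the weights of `U` from their translates under the
nontrivial elements of `W^J`, and which none of these elements fixes modulo `V_J`. -/
lemma exists_generic (hρ : IsTempered ρ) (hρ' : IsIndec ρ) : ∃ v : Cx V₀,
    ∀ x : minReps b J, x ≠ oneRep J → v - cxMap (x : V₀ ≃ₗ[ℝ] V₀)⁻¹ v ∉ VJ J ∧
      ∀ c : ℂ, (ρ (vec k J (cxMap (x : V₀ ≃ₗ[ℝ] V₀)⁻¹ v))).HasEigenvalue c →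
        ¬ (ρ (vec k J v)).HasEigenvalue c := by
  have hfin : Finite {γ | IsWeight ρ γ} := finite_isWeight.to_subtype
  let I := {x : minReps b J // x ≠ oneRep J} ⊕
    ({x : minReps b J // x ≠ oneRep J} × {γ | IsWeight ρ γ} × {γ | IsWeight ρ γ})
  let g : I → Module.Dual ℂ (Cx V₀) := Sum.elim
    (fun x => outerCoord J - outerCoord J ∘ₗ cxMap (x : V₀ ≃ₗ[ℝ] V₀)⁻¹)
    (fun p => (p.2.1 : Module.Dual ℂ (Cx V₀)) -
      (p.2.2 : Module.Dual ℂ (Cx V₀)) ∘ₗ cxMap ((p.1 : minReps b J) : V₀ ≃ₗ[ℝ] V₀)⁻¹)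
  obtain ⟨v, hv⟩ := Module.Dual.exists_forall_ne_zero_of_forall_exists g (by
    rintro (x | ⟨x, γ, γ'⟩)
    · exact exists_outerCoord_ne x.2
    · by_contra! hc
      refine x.2 (Subtype.ext (hρ.weight_ne hρ' γ.2 γ'.2 x.1.2 ?_))
      exact sub_eq_zero.1 (LinearMap.ext hc))
  refine ⟨v, fun x hx => ⟨fun hm => hv (.inl ⟨x, hx⟩) ?_, fun c h1 h2 => ?_⟩⟩
  · have := outerCoord_eq_zero hm
    rw [map_sub] at this
    exact this
  · obtain ⟨γ', hγ', h1⟩ := exists_isWeight h1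
    obtain ⟨γ, hγ, h2⟩ := exists_isWeight h2
    refine hv (.inr (⟨x, hx⟩, ⟨γ, hγ⟩, ⟨γ', hγ'⟩)) ?_
    change γ v - γ' (cxMap (x : V₀ ≃ₗ[ℝ] V₀)⁻¹ v) = 0
    rw [h1, h2, sub_self]

end Tempered


/-! ### Invertibility of the inverted roots in the localization -/

section Localized

set_option linter.unusedSectionVars false

variable {ι V₀ N : Type*} [Fintype ι] [AddCommGroup V₀] [Module ℝ V₀] [AddCommGroup N] [Module ℝ N]
  {P : RootPairing ι ℝ V₀ N} {b : SimpleRoots P} {k : Param b} {J : Set b.support}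
  [P.IsReduced]

lemma cxRoot_notMem_VJ {w : V₀ ≃ₗ[ℝ] V₀} (hw : w ∈ minReps b J) {i : ι}
    (hi : i ∈ inversions b w) : cxRoot P i ∉ VJ J := by
  intro hm
  obtain ⟨h1, h2⟩ := (mem_inversions_iff b hw.1).1 hi
  have h3 := outerCoord_eq_zero hm
  change outerCoord J (1 ⊗ₜ P.root i) = 0 at h3
  rw [outerCoord_tmul, Complex.ofReal_eq_zero, Finset.sum_eq_zero_iff_of_nonneg fun β _ => h1 β]
    at h3
  obtain ⟨j, hj, -⟩ := weyl_root b hw.1 i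
  have h4 : PosVec b (w (P.root i)) := by
    refine PosVec.map b (w : V₀ →ₗ[ℝ] V₀) h1 fun α hα => posVec_of_mem_minReps b hw ?_
    by_contra hc
    exact hα (h3 α (by simpa using hc))
  rw [hj] at h2 h4
  exact not_posVec_neg b h4 h2

lemma isUnit_toOJ_sub {v : Cx V₀} (hv : v ∉ VJ J) (c : ℂ) :
    IsUnit (toOJ J v - algebraMap ℂ (OJ J) c) := by
  have h := IsLocalization.map_units (OJ J) (⟨SymmetricAlgebra.ι ℂ (Cx V₀) v - algebraMap ℂ _ c,
    Submonoid.subset_closure ⟨v, hv, c, rfl⟩⟩ : denoms J)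
  rwa [map_sub, ← IsScalarTower.algebraMap_apply] at h

lemma isUnit_toOJ {v : Cx V₀} (hv : v ∉ VJ J) : IsUnit (toOJ J v) := by
  simpa using isUnit_toOJ_sub hv 0

/-- The denominator of `τ` is the inverse of the leading coefficient of `τ̃`. -/
lemma rootProd_mul_invProd {l : List b.support} (hl : IsReduced b l)
    (h : ∀ i ∈ inversions b (wordProd b l), cxRoot P i ∉ VJ J) :
    algebraMap (SV V₀) (OJ J) (rootProd l) * invProd J (wordProd b l) = 1 := by
  induction l with
  | nil =>
    have h1 : inversions b (wordProd b ([] : List b.support)) = ∅ := by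
      refine Set.eq_empty_of_forall_notMem fun i hi => ?_
      obtain ⟨h1, h2⟩ := (mem_inversions_iff b (wordProd_mem_univ b _)).1 hi
      exact not_posVec_neg b h1 h2
    rw [invProd, h1, finprod_mem_empty, mul_one, rootProd, map_one]
  | cons α l ih =>
    obtain ⟨i, hi, hi', hins⟩ := hl.inversions_cons
    rw [hins] at h
    have h1 := ih hl.tail fun j hj => h j (Set.mem_insert_of_mem _ hj)
    have h2 : algebraMap (SV V₀) (OJ J) (symRoot α l) = toOJ J (cxRoot P i) := by
      rw [symRoot, cxRoot, cxMap_tmul, ← hi]; rfl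
    rw [invProd] at h1
    rw [invProd, hins, finprod_mem_insert _ hi' (Set.toFinite _), rootProd, map_mul, h2,
      mul_mul_mul_comm, mul_comm (toOJ J (cxRoot P i)), mul_left_comm]
    rw [mul_assoc (algebraMap (SV V₀) (OJ J) (rootProd l)), Ring.inverse_mul_cancel _
      (isUnit_toOJ (h i (Set.mem_insert _ _))), mul_one, mul_comm, h1]

/-- The factors `k² - β² = -(β - k)(β + k)` are invertible, since the localization inverts `β - c` for
all constants `c`. -/
lemma isUnit_sqProd {l : List b.support} (hl : IsReduced b l)
    (h : ∀ i ∈ inversions b (wordProd b l), cxRoot P i ∉ VJ J) :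
    IsUnit (algebraMap (SV V₀) (OJ J) (sqProd k l)) := by
  induction l with
  | nil => rw [sqProd, map_one]; exact isUnit_one
  | cons α l ih =>
    obtain ⟨i, hi, hi', hins⟩ := hl.inversions_cons
    rw [hins] at h
    have h2 : algebraMap (SV V₀) (OJ J) (symRoot α l) = toOJ J (cxRoot P i) := by
      rw [symRoot, cxRoot, cxMap_tmul, ← hi]; rfl
    have h3 := h i (Set.mem_insert _ _)
    have h4 : algebraMap (SV V₀) (OJ J) (algebraMap ℂ _ (k.val α ^ 2) - symRoot α l ^ 2) =
        -((toOJ J (cxRoot P i) - algebraMap ℂ (OJ J) (k.val α)) *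
          (toOJ J (cxRoot P i) - algebraMap ℂ (OJ J) (-k.val α))) := by
      rw [map_sub, map_pow (algebraMap (SV V₀) (OJ J)) (symRoot α l), h2,
        ← IsScalarTower.algebraMap_apply, map_pow, map_neg]
      ring
    rw [sqProd, map_mul, h4]
    exact (ih hl.tail fun j hj => h j (Set.mem_insert_of_mem _ hj)).mul
      ((isUnit_toOJ_sub h3 _).mul (isUnit_toOJ_sub h3 _)).neg

end Localized

/-! ### Killing the lower coordinates -/

section Killing

set_option linter.unusedSectionVars false

open Polynomial

variable {ι V₀ N : Type*} [Fintype ι] [AddCommGroup V₀] [Module ℝ V₀] [AddCommGroup N] [Module ℝ N]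
  {P : RootPairing ι ℝ V₀ N} {b : SimpleRoots P} {k : Param b} {J : Set b.support}
  {A E : Type*} [CommRing A] [Algebra ℂ A] [AddCommGroup E] [Module ℂ E] [Module A E]
  [IsScalarTower ℂ A E] [P.IsReduced]

/-- An exponent, the sum of the largest lengths in `W^{θ(J)}` and `W^J`, large enough for the passage
through the length filtrations of the modules induced from `φ(E)` and from `E`. -/
def expo (J : Set b.support) : ℕ := len b (wTop b (theta b J)) + len b (wTop b J)

variable {σ : HJ k J →ₐ[ℂ] Module.End A E} {v : Cx V₀} {Q : A[X]}

/-- A vector without coordinate at the longest element is killed by a power of any polynomial in `v`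
which annihilates the operators `x⁻¹(v)`, `1 ≠ x ∈ W^J`: on `φ(E)` the coordinate at `y ∈ W^{θ(J)}` is
acted upon by `(y φ)⁻¹(v)` up to terms of smaller length, and `y φ = 1` only for the longest `y`. -/
lemma eq_zero_of_top_eq_zero
    (hQ : ∀ x : minReps b J, x ≠ oneRep J →
      aeval (σ (vec k J (cxMap (x : V₀ ≃ₗ[ℝ] V₀)⁻¹ v))) Q = 0)
    {F : minReps b (theta b J) → E} (hF : F (topRep J) = 0) :
    aeval (indRep (σ.comp (twistInv k (phi_mapsOnto b J))) (vec k Set.univ v)) (Q ^ expo J) F =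
      0 := by
  rw [← Submodule.mem_bot A, ← filt_zero]
  refine aeval_pow_mem_filt' (d := len b (wTop b (theta b J))) _ v Q (Nat.le_add_right _ _)
    (fun y _ hy => ?_) (by rw [zero_add]; exact mem_filt_top.2 hF)
  rw [AlgHom.comp_apply, twist_vec_rep]
  refine hQ ⟨_, mul_phi_mem_minReps b y.2⟩ fun h => ?_
  have h1 : (y : V₀ ≃ₗ[ℝ] V₀) * phi b J = 1 := congrArg Subtype.val h
  have h2 : (y : V₀ ≃ₗ[ℝ] V₀) = wTop b (theta b J) :=
    mul_right_cancel (h1.trans (wTop_mul_phi b J).symm)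
  rw [h2, zero_add] at hy
  exact lt_irrefl _ hy

open Classical in
lemma eq_single_of_aeval
    (hQ : ∀ x : minReps b J, x ≠ oneRep J →
      aeval (σ (vec k J (cxMap (x : V₀ ≃ₗ[ℝ] V₀)⁻¹ v))) Q = 0) (F : minReps b J → E) :
    ∃ u, aeval (indRep σ (vec k Set.univ v)) (Q ^ (expo J + 1)) F = Pi.single (oneRep J) u := by
  refine ⟨_, eq_single_of_mem_filt_one (A := A) (aeval_pow_mem_filt' (n := 1) (d := len b (wTop b J) + 1)
    _ v Q (Nat.add_le_add_right (Nat.le_add_left _ _) _) (fun y hy _ => hQ y ?_) ?_)⟩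
  · rintro rfl
    change 1 ≤ len b 1 at hy
    rw [len_one] at hy
    omega
  · intro y hy
    have := (wTop_isLongest b J).2 y y.2
    omega

/-- The top coordinate intertwines the polynomials in `v ∈ V`. -/
lemma aeval_indRep_top (Q : A[X]) (F : minReps b (theta b J) → E) :
    aeval (indRep (σ.comp (twistInv k (phi_mapsOnto b J))) (vec k Set.univ v)) Q F (topRep J) =
      aeval (σ (vec k J v)) Q (F (topRep J)) := by
  have h := map_aeval_apply (RingHom.id A)
    (Pi.evalAddMonoidHom (fun _ : minReps b (theta b J) => E) (topRep J)) (fun _ _ => rfl)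
    (D := indRep (σ.comp (twistInv k (phi_mapsOnto b J))) (vec k Set.univ v))
    (D' := σ (vec k J v)) (fun F => by
      rw [← incl_vec]
      exact indRep_incl_top σ (vec k J v) F) Q F
  rwa [Polynomial.map_id] at h

end Killing

/-! ### Generic vectors -/

section Generic

set_option linter.unusedSectionVars false

open Polynomial

variable {ι V₀ N : Type*} [Fintype ι] [AddCommGroup V₀] [Module ℝ V₀] [AddCommGroup N] [Module ℝ N]
  {P : RootPairing ι ℝ V₀ N} {b : SimpleRoots P} {k : Param b} {J : Set b.support}
  {U : Type*} [AddCommGroup U] [Module ℂ U] [Module.Finite ℂ U] [P.IsReduced]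

/-- `v ∈ V` separates the weights of `U` from their translates under the nontrivial elements of
`W^J`, and none of these elements fixes it modulo `V_J`. -/
def IsGeneric (ρ : HJ k J →ₐ[ℂ] Module.End ℂ U) (v : Cx V₀) : Prop :=
  ∀ x : minReps b J, x ≠ oneRep J → v - cxMap (x : V₀ ≃ₗ[ℝ] V₀)⁻¹ v ∉ VJ J ∧
    ∀ c : ℂ, (ρ (vec k J (cxMap (x : V₀ ≃ₗ[ℝ] V₀)⁻¹ v))).HasEigenvalue c →
      ¬ (ρ (vec k J v)).HasEigenvalue c

variable {ρ : HJ k J →ₐ[ℂ] Module.End ℂ U} {m : Type*} [Fintype m] (ω : Module.Basis m ℂ (VJPerp J))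
  {v : Cx V₀}

section Scalars

variable {A : Type*} [CommRing A] [Algebra ℂ A] {η : Cx V₀ →ₗ[ℂ] A}
  (hη : ∀ α ∈ J, ∀ v, η (cxMap (P.reflection α) v) = η v)

lemma isUnit_aeval_defRep {v' : Cx V₀} (h : ∀ x : minReps b J, x ≠ oneRep J → ∀ c : ℂ,
      (ρ (vec k J (cxMap (x : V₀ ≃ₗ[ℝ] V₀)⁻¹ v))).HasEigenvalue c →
      IsUnit (aeval (algebraMap ℂ A c - (η v' - η (cxMap (x : V₀ ≃ₗ[ℝ] V₀)⁻¹ v)))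
        (LinearMap.charpoly (ρ (vec k J v'))))) :
    IsUnit (aeval (defRep ρ η hη (vec k J v')) (annPoly ρ η v)) := by
  have h1 := isUnit_aeval_annPoly (B := Module.End A (A ⊗[ℂ] U)) ρ η
    (Module.End.baseChangeHom ℂ A U) v v' h
  have h2 := defRep_vec ρ η hη v'
  generalize defRep ρ η hη (vec k J v') = D at h2 ⊢
  subst h2
  exact h1

lemma aeval_defRep_eq_zero {x : minReps b J} (hx : x ≠ oneRep J) :
    aeval (defRep ρ η hη (vec k J (cxMap (x : V₀ ≃ₗ[ℝ] V₀)⁻¹ v))) (annPoly ρ η v) = 0 := by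
  have h1 := aeval_annPoly_eq_zero (B := Module.End A (A ⊗[ℂ] U)) ρ η
    (Module.End.baseChangeHom ℂ A U) hx v
  have h2 := defRep_vec ρ η hη (cxMap (x : V₀ ≃ₗ[ℝ] V₀)⁻¹ v)
  generalize defRep ρ η hη (vec k J (cxMap (x : V₀ ≃ₗ[ℝ] V₀)⁻¹ v)) = D at h2 ⊢
  subst h2
  exact h1

end Scalars

/-- The representation of `ℍ_J` on `U_a`. -/
abbrev ratRep (ρ : HJ k J →ₐ[ℂ] Module.End ℂ U) :
    HJ k J →ₐ[ℂ] Module.End (RatFun m) (RatFun m ⊗[ℂ] U) :=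
  defRep ρ (eta ω) fun _ hα v => eta_reflection ω hα v

/-- The lattice in `U_a` of the elements holomorphic at `a = 0`, as a representation of `ℍ_J`. -/
abbrev holRep (ρ : HJ k J →ₐ[ℂ] Module.End ℂ U) :
    HJ k J →ₐ[ℂ] Module.End (Hol m) (Hol m ⊗[ℂ] U) :=
  defRep ρ (etaHol ω) (etaHol_reflection ω)

/-- Over `ℂ(a)` only the condition modulo `V_J` is used: `η_a(v - x⁻¹(v))` is then transcendental, so
that it is not a difference of eigenvalues. -/
lemma isUnit_ratRep (hv : IsGeneric ρ v) {v' : Cx V₀} (hv' : eta ω v' = eta ω v) :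
    IsUnit (aeval (ratRep ω ρ (vec k J v')) (annPoly ρ (eta ω) v)) := by
  refine isUnit_aeval_defRep _ fun x hx c _ => IsUnit.mk0 _ fun h => ?_
  rw [hv', ← map_sub] at h
  exact not_isAlgebraic_eta ω (hv x hx).1 c ⟨_, (LinearMap.charpoly_monic _).ne_zero, h⟩

/-- At `a = 0` the eigenvalues of `v` and `x⁻¹(v)` on `U` are distinct, so that `annPoly` is invertible
also over the functions holomorphic there. -/
lemma isUnit_holRep (hv : IsGeneric ρ v) :
    IsUnit (aeval (holRep ω ρ (vec k J v)) (annPoly ρ (etaHol ω) v)) := by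
  refine isUnit_aeval_defRep _ fun x hx c hc => isUnit_of_evalZero_ne_zero fun h => ?_
  rw [← aeval_algHom_apply, map_sub, map_sub, evalZero_etaHol, evalZero_etaHol, sub_zero, sub_zero,
    AlgHom.commutes] at h
  refine (hv x hx).2 c hc ((Module.End.hasEigenvalue_iff_isRoot_charpoly _ _).2 ?_)
  rwa [Algebra.algebraMap_self, RingHom.id_apply, coe_aeval_eq_eval] at h

lemma isUnit_rep (hv : IsGeneric ρ v) :
    IsUnit (aeval (ρ (vec k J v)) (annPoly ρ (0 : Cx V₀ →ₗ[ℂ] ℂ) v)) := by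
  have h := isUnit_aeval_annPoly ρ (0 : Cx V₀ →ₗ[ℂ] ℂ) (AlgHom.id ℂ (Module.End ℂ U)) v v
    fun x hx c hc => ?_
  · simpa using h
  · refine IsUnit.mk0 _ fun h => (hv x hx).2 c hc
      ((Module.End.hasEigenvalue_iff_isRoot_charpoly _ _).2 ?_)
    simpa using h

lemma aeval_ratRep_eq_zero {x : minReps b J} (hx : x ≠ oneRep J) :
    aeval (ratRep ω ρ (vec k J (cxMap (x : V₀ ≃ₗ[ℝ] V₀)⁻¹ v))) (annPoly ρ (eta ω) v) = 0 := by
  exact aeval_defRep_eq_zero _ hx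

lemma aeval_rep_eq_zero {x : minReps b J} (hx : x ≠ oneRep J) :
    aeval (ρ (vec k J (cxMap (x : V₀ ≃ₗ[ℝ] V₀)⁻¹ v))) (annPoly ρ (0 : Cx V₀ →ₗ[ℂ] ℂ) v) = 0 := by
  simpa using aeval_annPoly_eq_zero ρ (0 : Cx V₀ →ₗ[ℂ] ℂ) (AlgHom.id ℂ (Module.End ℂ U)) hx v

end Generic


/-! ### The intertwining map in coordinates -/

section Intertwiner

set_option linter.unusedSectionVars false

open Polynomial

variable {ι V₀ N : Type*} [Fintype ι] [AddCommGroup V₀] [Module ℝ V₀] [AddCommGroup N] [Module ℝ N]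
  {P : RootPairing ι ℝ V₀ N} {b : SimpleRoots P} {k : Param b} {J : Set b.support}
  {A E : Type*} [CommRing A] [Algebra ℂ A] [AddCommGroup E] [Module ℂ E] [Module A E]
  [IsScalarTower ℂ A E] [P.IsReduced]

lemma ratTwistInv_f {J' : Set b.support} {w : V₀ ≃ₗ[ℝ] V₀} (h : MapsOnto b w J J') (q : OJ J') :
    ratTwistInv k h (HeckeAlg.f q) = HeckeAlg.f (ratInv h q) := by
  rw [ratTwistInv, twist, HeckeAlg.lift_f, AlgHom.comp_apply]

lemma ratTwistInv_loc {J' : Set b.support} {w : V₀ ≃ₗ[ℝ] V₀} (h : MapsOnto b w J J')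
    (x : HJ k J') : ratTwistInv k h (loc k J' x) = loc k J (twistInv k h x) := by
  induction x using HeckeAlg.induction with
  | algebraMap c => simp only [AlgHom.commutes]
  | t w =>
    rw [loc_t, twist_t, loc_t, ratTwistInv, twist, HeckeAlg.lift_t]
    rfl
  | f q =>
    have h1 : twistInv k h (HeckeAlg.f q) = HeckeAlg.f (symInv w q) := by
      rw [twistInv, twist, HeckeAlg.lift_f, AlgHom.comp_apply]
    rw [loc_f, ratTwistInv_f, h1, loc_f]
    exact congrArg _ (IsLocalization.lift_eq (M := denoms J') _ _)
  | mul x y hx hy => simp only [map_mul, hx, hy]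
  | add x y hx hy => simp only [map_add, hx, hy]

variable (σr : RatHJ k J →ₐ[ℂ] Module.End A E) (σ : HJ k J →ₐ[ℂ] Module.End A E)

/-- The representation `φ(E)` of `ℍ_{θ(J)}`. -/
abbrev phiTwist : HJ k (theta b J) →ₐ[ℂ] Module.End A E :=
  σ.comp (twistInv k (phi_mapsOnto b J))

/-- The action on `φ(E)` of the denominator of `τ`. -/
def denomAct (l : List b.support) : Module.End A E :=
  σr (ratTwistInv k (phi_mapsOnto b J) (HeckeAlg.f (invProd (theta b J) (wordProd b l))))

/-- The coordinates of `τ ⊗ φ(y)`. -/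
def tauCoord (l : List b.support) : E →ₗ[A] (minReps b (theta b J) → E) :=
  haveI := Classical.decEq (minReps b (theta b J))
  indRep (phiTwist σ) (tauTilde k l) ∘ₗ
    LinearMap.single A (fun _ : minReps b (theta b J) => E) (oneRep (theta b J)) ∘ₗ denomAct σr l

open Classical in
lemma tauCoord_apply (l : List b.support) (y : E) : tauCoord σr σ l y =
    indRep (phiTwist σ) (tauTilde k l) (Pi.single (oneRep (theta b J)) (denomAct σr l y)) := by
  rw [tauCoord]
  simp only [LinearMap.comp_apply, LinearMap.single_apply]
  congr!

variable {σr σ} {l : List b.support}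

lemma phiTwist_f_mul_denomAct (hσ : ∀ h, σr (loc k J h) = σ h)
    (p : SV V₀) : phiTwist σ (HeckeAlg.f p) * denomAct σr l =
    σr (ratTwistInv k (phi_mapsOnto b J) (HeckeAlg.f
      (algebraMap (SV V₀) (OJ (theta b J)) p * invProd (theta b J) (wordProd b l)))) := by
  rw [map_mul, map_mul, map_mul, denomAct, ← loc_f, ratTwistInv_loc, hσ]
  rfl

lemma vec_mul_denomAct (hσ : ∀ h, σr (loc k J h) = σ h)
    (v : Cx V₀) : σ (vec k J v) * denomAct σr l =
    denomAct σr l * σ (vec k J v) := by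
  rw [denomAct, ratTwistInv_f, ← hσ, vec, loc_f, ← map_mul, ← map_mul, ← map_mul, ← map_mul,
    mul_comm]

/-- `τ` intertwines the actions of `V`. -/
lemma indRep_vec_tauCoord (hσ : ∀ h, σr (loc k J h) = σ h)
    (hl : wordProd b l = wTop b (theta b J)) (v : Cx V₀) (y : E) :
    indRep (phiTwist σ) (vec k Set.univ v) (tauCoord σr σ l y) =
      tauCoord σr σ l (σ (vec k J v) y) := by
  classical
  have h1 : (wordProd b l)⁻¹ = phi b J := by
    rw [hl]; exact inv_eq_of_mul_eq_one_right (wTop_mul_phi b J)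
  have h2 : cxMap (phi b J)⁻¹ (cxMap (phi b J) v) = v := cxMap_inv_left _ _
  rw [tauCoord_apply, tauCoord_apply, ← Module.End.mul_apply, ← map_mul, vec_mul_tauTilde, map_mul,
    Module.End.mul_apply, ← incl_vec (J := theta b J), indRep_incl_single, AlgHom.comp_apply,
    twist_vec, h1, h2, ← Module.End.mul_apply, ← Module.End.mul_apply, vec_mul_denomAct hσ]

/-- The coordinate of `τ ⊗ φ(y)` at the longest element is `y`. -/
lemma tauCoord_top (hσ : ∀ h, σr (loc k J h) = σ h)
    (hl : IsReducedWord b l (wTop b (theta b J))) (y : E) : tauCoord σr σ l y (topRep J) = y := by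
  classical
  have hred : IsReduced b l := ⟨rfl, by rw [hl.1]; exact hl.2⟩
  have hw := wTop_isLongest b (theta b J)
  have h1 := mem_filt_top.1 (hl.2 ▸ indRep_lowH_single (phiTwist σ) (tauTilde_sub_mem (k := k) l)
    (denomAct σr l y))
  have h3 : HeckeAlg.t (wordW b l) = (HeckeAlg.t (repW (topRep J)) : HH k) :=
    congrArg _ (Subtype.ext hl.1)
  have h4 := phiTwist_f_mul_denomAct hσ (l := l) (rootProd l)
  rw [rootProd_mul_invProd hred (fun i hi => cxRoot_notMem_VJ hw.1 (hl.1 ▸ hi)), map_one, map_one,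
    map_one] at h4
  rw [map_sub, LinearMap.sub_apply, Pi.sub_apply, sub_eq_zero, map_mul, Module.End.mul_apply,
    ← incl_f (J := theta b J), indRep_incl_single, ← Module.End.mul_apply, h4, h3,
    Module.End.one_apply, ← single_eq_indRep, Pi.single_eq_same] at h1
  rw [tauCoord_apply]
  exact h1

open Classical in
/-- The element `τ̃` of the reversed word maps `τ ⊗ φ(y)` to `1 ⊗ φ(Z y)` with `Z` invertible. -/
lemma exists_indRep_tauCoord (hσ : ∀ h, σr (loc k J h) = σ h)
    (hl : IsReducedWord b l (wTop b (theta b J))) : ∃ Z : Module.End A E, IsUnit Z ∧ ∀ y,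
    indRep (phiTwist σ) (tauTilde k l.reverse) (tauCoord σr σ l y) =
      Pi.single (oneRep (theta b J)) (Z y) := by
  have hred : IsReduced b l := ⟨rfl, by rw [hl.1]; exact hl.2⟩
  have hw := wTop_isLongest b (theta b J)
  have hi : ∀ i ∈ inversions b (wordProd b l), cxRoot P i ∉ VJ (theta b J) :=
    fun i hi => cxRoot_notMem_VJ hw.1 (hl.1 ▸ hi)
  refine ⟨phiTwist σ (HeckeAlg.f (sqProd k l)) * denomAct σr l, ?_, fun y => ?_⟩
  · rw [phiTwist_f_mul_denomAct hσ]
    exact (((IsUnit.mul (isUnit_sqProd hred hi)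
      (.of_mul_eq_one_right _ (rootProd_mul_invProd hred hi))).map HeckeAlg.f).map _).map σr
  · rw [tauCoord_apply, ← Module.End.mul_apply, ← map_mul, tauTilde_reverse_mul,
      ← incl_f (J := theta b J), indRep_incl_single]
    rfl

/-- `τ` intertwines the actions of `ℍ_J`. The difference between the two sides for a reflection has
no coordinate at the longest element, so that it is killed by a polynomial in `v` which acts
invertibly on `E`. -/
lemma indRep_incl_tauCoord (hσ : ∀ h, σr (loc k J h) = σ h)
    (hl : IsReducedWord b l (wTop b (theta b J))) {v : Cx V₀} {Q : A[X]}
    (hQ : ∀ x : minReps b J, x ≠ oneRep J →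
      aeval (σ (vec k J (cxMap (x : V₀ ≃ₗ[ℝ] V₀)⁻¹ v))) Q = 0)
    (hu : ∀ α ∈ J, IsUnit (aeval (σ (vec k J (cxMap (P.reflection α) v))) Q))
    (h : HJ k J) (y : E) :
    indRep (phiTwist σ) (incl k J h) (tauCoord σr σ l y) = tauCoord σr σ l (σ h y) := by
  induction h using HJ.induction generalizing y with
  | algebraMap c =>
    simp only [AlgHom.commutes, Module.algebraMap_end_apply]
    rw [← algebraMap_smul A c y, map_smul, algebraMap_smul]
  | refl α hα =>
    set s : HJ k J := HeckeAlg.t (sRefl hα) with hs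
    let X : E →ₗ[A] (minReps b (theta b J) → E) :=
      indRep (phiTwist σ) (incl k J s) ∘ₗ tauCoord σr σ l - tauCoord σr σ l ∘ₗ σ s
    have hX : ∀ y, X y = indRep (phiTwist σ) (incl k J s) (tauCoord σr σ l y) -
      tauCoord σr σ l (σ s y) := fun _ => rfl
    have htop : ∀ y, X y (topRep J) = 0 := fun y => by
      rw [hX, Pi.sub_apply, indRep_incl_top, tauCoord_top hσ hl, tauCoord_top hσ hl, sub_self]
    have hrel := vec_mul_t_sRefl (k := k) hα v
    have hvX : ∀ y, X (σ (vec k J (cxMap (P.reflection α) v)) y) =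
        indRep (phiTwist σ) (vec k Set.univ v) (X y) := fun y => by
      have e1 := indRep_vec_tauCoord hσ hl.1
      set c : ℂ := k.val α * cxCoroot P α v
      have e2 : ∀ z : E, σ (vec k J v) (σ s z) =
          σ s (σ (vec k J (cxMap (P.reflection α) v)) z) + algebraMap ℂ A c • z := fun z => by
        rw [← Module.End.mul_apply, ← map_mul, hrel, map_add, map_mul, AlgHom.commutes,
          LinearMap.add_apply, Module.End.mul_apply, Module.algebraMap_end_apply,
          algebraMap_smul]
      have e3 : ∀ F, indRep (phiTwist σ) (vec k Set.univ v) (indRep (phiTwist σ) (incl k J s) F) =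
          indRep (phiTwist σ) (incl k J s)
            (indRep (phiTwist σ) (vec k Set.univ (cxMap (P.reflection α) v)) F) +
              algebraMap ℂ A c • F := fun F => by
        rw [← incl_vec (J := J) v, ← incl_vec (J := J) (cxMap _ v), ← Module.End.mul_apply,
          ← map_mul, ← map_mul, hrel, map_add, map_add, map_mul, map_mul, AlgHom.commutes,
          AlgHom.commutes, LinearMap.add_apply, Module.End.mul_apply, Module.algebraMap_end_apply,
          algebraMap_smul]
      rw [hX, hX, map_sub, e3, e1, e1, e2, map_add, map_smul, add_sub_add_right_eq_sub]
    have hzero : ∀ y, X y = 0 := fun y => by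
      obtain ⟨y', rfl⟩ := ((Module.End.isUnit_iff _).1 ((hu α hα).pow (expo J))).2 y
      rw [← map_pow]
      have h1 := map_aeval_apply (RingHom.id A) X.toAddMonoidHom (fun a x => map_smul X a x)
        hvX (Q ^ expo J) y'
      rw [Polynomial.map_id] at h1
      exact h1.trans (eq_zero_of_top_eq_zero hQ (htop y'))
    exact sub_eq_zero.1 (hzero y)
  | vec v' => rw [incl_vec]; exact indRep_vec_tauCoord hσ hl.1 v' y
  | mul x z hx hz =>
    rw [map_mul, map_mul, map_mul, Module.End.mul_apply, Module.End.mul_apply, hz, hx]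
  | add x z hx hz =>
    rw [map_add, map_add, map_add, LinearMap.add_apply, LinearMap.add_apply, hz, hx, map_add]

end Intertwiner


/-! ### Bijectivity of the generic intertwining map -/

section Bijective

set_option linter.unusedSectionVars false

variable {ι V₀ N : Type*} [Fintype ι] [AddCommGroup V₀] [Module ℝ V₀] [AddCommGroup N] [Module ℝ N]
  {P : RootPairing ι ℝ V₀ N} {b : SimpleRoots P} {k : Param b} {J : Set b.support}
  {A E : Type*} [CommRing A] [Algebra ℂ A] [AddCommGroup E] [Module ℂ E] [Module A E]
  [IsScalarTower ℂ A E] [P.IsReduced]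

/-- The bijection `y ↦ y φ⁻¹` from `W^J` to `W^{θ(J)}`. -/
def repEquiv (J : Set b.support) : minReps b J ≃ minReps b (theta b J) where
  toFun y := ⟨y * (phi b J)⁻¹, mul_phi_inv_mem_minReps b y.2⟩
  invFun y := ⟨y * phi b J, mul_phi_mem_minReps b y.2⟩
  left_inv _ := Subtype.ext (inv_mul_cancel_right _ _)
  right_inv _ := Subtype.ext (mul_inv_cancel_right _ _)

/-- The map on the induced modules defined by `τ` is bijective. It is onto because the image contains
`1 ⊗ φ(E)`, to which `τ̃` of the reversed word maps `τ ⊗ φ(E)`; then it is injective because both sides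
are direct sums of equally many copies of the finite `A`-module `E`. -/
lemma lift_bijective [Module.Finite A E] {σr : RatHJ k J →ₐ[ℂ] Module.End A E}
    {σ : HJ k J →ₐ[ℂ] Module.End A E} {l : List b.support} (hσ : ∀ h, σr (loc k J h) = σ h)
    (hl : IsReducedWord b l (wTop b (theta b J))) {σC : HJ k J →ₐ[ℂ] Module.End ℂ E}
    {X : Type*} [AddCommGroup X] [Module ℂ X] [Module (HH k) X]
    [IsScalarTower ℂ (HH k) X] (κ : X ≃ₗ[ℂ] (minReps b (theta b J) → E))
    (hκ : ∀ h z, κ (h • z) = indRep (phiTwist σ) h (κ z)) (g : E →ₗ[ℂ] X)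
    (hg : ∀ y, κ (g y) = tauCoord σr σ l y) (hg' : ∀ a u, g (σC a u) = incl k J a • g u) :
    Function.Bijective (Ind.lift σC g hg') := by
  classical
  let Φ : (minReps b J → E) →ₗ[A] (minReps b (theta b J) → E) :=
    ∑ y : minReps b J, indRep (phiTwist σ) (HeckeAlg.t (repW y)) ∘ₗ tauCoord σr σ l ∘ₗ
      LinearMap.proj y
  have hΦ : ∀ F, κ (Ind.lift σC g hg' (ofCoord σC F)) = Φ F := fun F => by
    rw [ofCoord_apply, map_sum, map_sum, LinearMap.sum_apply]
    refine Finset.sum_congr rfl fun y _ => ?_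
    rw [Ind.lift_tmul, hκ, hg]
    rfl
  have hstable : ∀ h, ∀ F ∈ LinearMap.range Φ, indRep (phiTwist σ) h F ∈ LinearMap.range Φ := by
    rintro h _ ⟨F, rfl⟩
    obtain ⟨F', hF'⟩ := ofCoord_surjective σC (h • ofCoord σC F)
    refine ⟨F', ?_⟩
    rw [← hΦ, ← hΦ, hF', map_smul, hκ]
  have hG : ∀ y, tauCoord σr σ l y ∈ LinearMap.range Φ := fun y => by
    obtain ⟨F, hF⟩ := ofCoord_surjective σC (Ind.tmul σC 1 y)
    refine ⟨F, ?_⟩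
    rw [← hΦ, hF, Ind.lift_tmul, one_smul, hg]
  obtain ⟨Z, hZ, hZ'⟩ := exists_indRep_tauCoord hσ hl
  have hsurj : Function.Surjective Φ := by
    rw [← LinearMap.range_eq_top, Submodule.eq_top_iff']
    intro F
    rw [eq_sum_single F]
    refine sum_mem fun y _ => ?_
    obtain ⟨u, hu⟩ := ((Module.End.isUnit_iff _).1 hZ).2 (F y)
    have h1 := hstable (HeckeAlg.t (repW y)) _ (hstable (tauTilde k l.reverse) _ (hG u))
    rwa [hZ', hu, ← single_eq_indRep] at h1
  have hinj : Function.Injective Φ := by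
    have h1 := OrzechProperty.injective_of_surjective_endomorphism
      (Φ ∘ₗ (LinearEquiv.funCongrLeft A E (repEquiv J)).toLinearMap)
      (hsurj.comp (LinearEquiv.surjective _))
    rw [LinearMap.coe_comp] at h1
    exact h1.of_comp_right (LinearEquiv.surjective _)
  constructor
  · intro z z' h
    obtain ⟨F, rfl⟩ := ofCoord_surjective σC z
    obtain ⟨F', rfl⟩ := ofCoord_surjective σC z'
    rw [hinj ((hΦ F).symm.trans ((congrArg κ h).trans (hΦ F')))]
  · intro x
    obtain ⟨F, hF⟩ := hsurj (κ x)
    exact ⟨ofCoord σC F, κ.injective (by rw [hΦ, hF])⟩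

end Bijective

/-! ### Integrality of the intertwining map -/

section Integrality

set_option linter.unusedSectionVars false

open Polynomial

variable {ι V₀ N : Type*} [Fintype ι] [AddCommGroup V₀] [Module ℝ V₀] [AddCommGroup N] [Module ℝ N]
  {P : RootPairing ι ℝ V₀ N} {b : SimpleRoots P} {k : Param b} {J : Set b.support}
  {A E : Type*} [CommRing A] [Algebra ℂ A] [AddCommGroup E] [Module ℂ E] [Module A E]
  [IsScalarTower ℂ A E] [P.IsReduced]
  {A' E' : Type*} [CommRing A'] [Algebra ℂ A'] [AddCommGroup E'] [Module ℂ E'] [Module A' E']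
  [IsScalarTower ℂ A' E']

/-- If a polynomial `Q` in `v` annihilates the lower coordinates on a module over `A'`, and acts
invertibly on a lattice `E` over a subring `A`, then the intertwining map is defined over `A`:
on `Q(v) z` it is the result of the application of `Q(v)` to `t_w ⊗ z` with `w` the longest element. -/
lemma exists_integral_tauCoord {σr : RatHJ k J →ₐ[ℂ] Module.End A' E'}
    {σ' : HJ k J →ₐ[ℂ] Module.End A' E'} {σ : HJ k J →ₐ[ℂ] Module.End A E} {l : List b.support}
    (hσ : ∀ h, σr (loc k J h) = σ' h) (hl : IsReducedWord b l (wTop b (theta b J)))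
    {v : Cx V₀} {Q : A[X]} (φ : A →+* A')
    (hQ : ∀ x : minReps b J, x ≠ oneRep J →
      aeval (σ' (vec k J (cxMap (x : V₀ ≃ₗ[ℝ] V₀)⁻¹ v))) (Q.map φ) = 0)
    (hu : IsUnit (aeval (σ (vec k J v)) Q))
    (hu' : ∀ α ∈ J, IsUnit (aeval (σ' (vec k J (cxMap (P.reflection α) v))) (Q.map φ)))
    (g : E →+ E') (hginj : Function.Injective g) (hgφ : ∀ (a : A) x, g (a • x) = φ a • g x)
    (hg : ∀ h u, g (σ h u) = σ' h (g u)) :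
    ∃ T : E →ₗ[A] (minReps b (theta b J) → E), (∀ z, g ∘ T z = tauCoord σr σ' l (g z)) ∧
      (∀ z, T z (topRep J) = z) ∧
      ∀ h z, T (σ h z) = indRep (phiTwist σ) (incl k J h) (T z) := by
  classical
  have hg2 : ∀ h u, g (phiTwist σ h u) = phiTwist σ' h (g u) := fun h u => hg _ _
  have hpow : (Q.map φ) ^ expo J = (Q ^ expo J).map φ := (Polynomial.map_pow φ _).symm
  obtain ⟨I, hI⟩ := (hu.pow (expo J)).exists_right_inv
  rw [← map_pow] at hI
  let T : E →ₗ[A] (minReps b (theta b J) → E) :=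
    aeval (indRep (phiTwist σ) (vec k Set.univ v)) (Q ^ expo J) ∘ₗ
      LinearMap.single A (fun _ : minReps b (theta b J) => E) (topRep J) ∘ₗ I
  have hT : ∀ z, g ∘ T z = tauCoord σr σ' l (g z) := fun z => by
    have hz : z = aeval (σ (vec k J v)) (Q ^ expo J) (I z) := by
      rw [← Module.End.mul_apply, hI, Module.End.one_apply]
    have h1 : g ∘ T z = aeval (indRep (phiTwist σ') (vec k Set.univ v)) ((Q ^ expo J).map φ)
        (Pi.single (topRep J) (g (I z))) := by
      have h2 := map_aeval_apply φ (g.compLeft (minReps b (theta b J)))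
        (fun a F => funext fun y => hgφ a (F y))
        (map_indRep (phiTwist σ) (phiTwist σ') g hg2 (vec k Set.univ v)) (Q ^ expo J)
        (Pi.single (topRep J) (I z))
      refine h2.trans (congrArg _ ?_)
      ext y
      exact (Pi.apply_single (fun _ => g) (fun _ => map_zero g) (topRep J) (I z) y)
    have h3 := map_aeval_apply φ g hgφ (hg (vec k J v)) (Q ^ expo J) (I z)
    rw [← hz] at h3
    have h4 := map_aeval_apply (RingHom.id A') (tauCoord σr σ' l).toAddMonoidHom
      (fun a x => map_smul (tauCoord σr σ' l) a x)
      (fun y => (indRep_vec_tauCoord hσ hl.1 v y).symm) ((Q ^ expo J).map φ) (g (I z))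
    rw [Polynomial.map_id] at h4
    change tauCoord σr σ' l (aeval (σ' (vec k J v)) ((Q ^ expo J).map φ) (g (I z))) =
      aeval (indRep (phiTwist σ') (vec k Set.univ v)) ((Q ^ expo J).map φ)
        (tauCoord σr σ' l (g (I z))) at h4
    rw [h1, h3, h4, ← hpow, eq_comm, ← sub_eq_zero, ← map_sub]
    refine eq_zero_of_top_eq_zero hQ ?_
    rw [Pi.sub_apply, tauCoord_top hσ hl, Pi.single_eq_same, sub_self]
  refine ⟨T, hT, fun z => ?_, fun h z => ?_⟩
  · refine hginj ((congrFun (hT z) (topRep J)).trans ?_)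
    rw [tauCoord_top hσ hl]
  · refine (hginj.comp_left : Function.Injective fun F : minReps b (theta b J) → E => g ∘ F) ?_
    change g ∘ _ = g ∘ _
    rw [hT, hg, map_indRep (phiTwist σ) (phiTwist σ') g hg2, hT,
      indRep_incl_tauCoord hσ hl hQ hu']

end Integrality

/-! ### Proper submodules of the induced module -/

section Irreducible

set_option linter.unusedSectionVars false

open Polynomial

variable {ι V₀ N : Type*} [Fintype ι] [AddCommGroup V₀] [Module ℝ V₀] [AddCommGroup N] [Module ℝ N]
  {P : RootPairing ι ℝ V₀ N} {b : SimpleRoots P} {k : Param b} {J : Set b.support}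
  {U : Type*} [AddCommGroup U] [Module ℂ U] [P.IsReduced]

/-- If `U` is irreducible, every homomorphism from `I(J, U)` to `I(θ(J), φ(U))` kills all proper
submodules: such a submodule does not meet `1 ⊗ U`, so that it is killed by the polynomials in `v`
which map `I(J, U)` to `1 ⊗ U`; these act invertibly on the top coordinate of the image. -/
lemma le_ker_of_ne_top {ρ : HJ k J →ₐ[ℂ] Module.End ℂ U} (hρ : IsIrred ρ) {v : Cx V₀} {Q : ℂ[X]}
    (hQ : ∀ x : minReps b J, x ≠ oneRep J →
      aeval (ρ (vec k J (cxMap (x : V₀ ≃ₗ[ℝ] V₀)⁻¹ v))) Q = 0)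
    (hu : IsUnit (aeval (ρ (vec k J v)) Q)) (Δ : Ind ρ →ₗ[HH k] Ind (phiRep ρ))
    {M : Submodule (HH k) (Ind ρ)} (hM : M ≠ ⊤) : M ≤ LinearMap.ker Δ := by
  classical
  let p : Submodule ℂ U := (M.restrictScalars ℂ).comap
    (ptmulHom (rightH k J) (fun a => ρ a) (1 : HH k))
  have hp : ∀ u, u ∈ p ↔ Ind.tmul ρ 1 u ∈ M := fun _ => Iff.rfl
  have hpbot : p = ⊥ := by
    refine (hρ.2 p fun h u hu => ?_).resolve_right fun htop => hM ?_
    · rw [hp] at hu ⊢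
      rw [← Ind.tmul_incl, one_mul, ← mul_one (incl k J h), ← Ind.smul_tmul]
      exact M.smul_mem _ hu
    · rw [Submodule.eq_top_iff']
      intro z
      induction z using balTensor_induction with
      | zero => exact M.zero_mem
      | ptmul h u =>
        have h1 : Ind.tmul ρ 1 u ∈ M := (hp u).1 (htop ▸ Submodule.mem_top)
        have h2 := M.smul_mem h h1
        rwa [Ind.smul_tmul, mul_one] at h2
      | add x y hx hy => exact M.add_mem hx hy
  let κ := indEquiv ρ ρ fun _ _ => rfl
  let κ' := indEquiv (phiTwist ρ) (phiRep ρ) fun _ _ => rfl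
  have hκ' : ∀ h z, κ' (h • z) = indRep (phiTwist ρ) h (κ' z) := fun h z => indEquiv_smul _ _ _ h z
  set q : HH k := aeval (vec k Set.univ v) (Q ^ (expo J + 1)) with hq
  have hkill : ∀ z ∈ M, q • z = 0 := fun z hz => by
    obtain ⟨u, hu⟩ := eq_single_of_aeval hQ (κ z)
    rw [aeval_algHom_apply] at hu
    have h1 : q • z = Ind.tmul ρ 1 u := κ.injective (by
      rw [indEquiv_smul, indEquiv_tmul, map_one, Module.End.one_apply]
      exact hu)
    have h2 : u ∈ p := (hp u).2 (h1 ▸ M.smul_mem q hz)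
    rw [hpbot, Submodule.mem_bot] at h2
    rw [h1, h2]
    exact map_zero (ptmulHom (rightH k J) (fun a => ρ a) (1 : HH k))
  have htop : ∀ z ∈ M, κ' (Δ z) (topRep J) = 0 := fun z hz => by
    have h1 : κ' (q • Δ z) = 0 := by rw [← map_smul, hkill z hz, map_zero, map_zero]
    have h2 := aeval_indRep_top (σ := ρ) (v := v) (Q ^ (expo J + 1)) (κ' (Δ z))
    rw [hκ'] at h1
    rw [aeval_algHom_apply, ← hq] at h2
    have h3 := congrFun h1 (topRep J)
    have h4 := ((Module.End.isUnit_iff _).1 (hu.pow (expo J + 1))).1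
    rw [← map_pow] at h4
    refine h4 ?_
    rw [map_zero, ← h2]
    exact h3
  intro z hz
  rw [LinearMap.mem_ker]
  refine κ'.injective (funext fun y => ?_)
  rw [← indRep_t_top (phiTwist ρ) (κ' (Δ z)) y, ← hκ', ← map_smul, htop _ (M.smul_mem _ hz),
    map_zero]
  rfl

end Irreducible


/-! ### The intertwining map on tensor products -/

section RationalInduction

set_option linter.unusedSectionVars false

open Polynomial

variable {ι V₀ N : Type*} [Fintype ι] [AddCommGroup V₀] [Module ℝ V₀] [AddCommGroup N] [Module ℝ N]
  {P : RootPairing ι ℝ V₀ N} {b : SimpleRoots P} {k : Param b} {J : Set b.support}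
  {A E : Type*} [CommRing A] [Algebra ℂ A] [AddCommGroup E] [Module ℂ E] [Module A E]
  [IsScalarTower ℂ A E] [P.IsReduced]
  {σr : RatHJ k J →ₐ[ℂ] Module.End A E} {σ : HJ k J →ₐ[ℂ] Module.End A E}
  {σC : RatHJ k J →ₐ[ℂ] Module.End ℂ E} {l : List b.support}

/-- The representation `φ(E)` of `𝓗_{θ(J)}`. -/
abbrev ratPhiTwist (σC : RatHJ k J →ₐ[ℂ] Module.End ℂ E) :
    RatHJ k (theta b J) →ₐ[ℂ] Module.End ℂ E :=
  σC.comp (ratTwistInv k (phi_mapsOnto b J))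

lemma ratPhiTwist_loc (hσ : ∀ h, σr (loc k J h) = σ h) (hC : ∀ x y, σC x y = σr x y)
    (h : HJ k (theta b J)) (y : E) :
    ratPhiTwist σC (loc k (theta b J) h) y = phiTwist σ h y := by
  rw [AlgHom.comp_apply, AlgHom.comp_apply, ratTwistInv_loc, hC, hσ]

/-- The map `y ↦ τ ⊗ φ(y)`. -/
def tauMap (σC : RatHJ k J →ₐ[ℂ] Module.End ℂ E) (l : List b.support) :
    E →ₗ[ℂ] RatInd (ratPhiTwist σC) :=
  ptmulHom (rightRat k (theta b J)) (fun a => ratPhiTwist σC a) (tau k (theta b J) l)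

/-- Coordinates on `𝓗^{θ(J)} ⊗ φ(E)`. -/
def ratCoord (hσ : ∀ h, σr (loc k J h) = σ h) (hC : ∀ x y, σC x y = σr x y) :
    RatInd (ratPhiTwist σC) ≃ₗ[ℂ] (minReps b (theta b J) → E) :=
  ratEquiv (ratPhiTwist σC) (phiTwist σ) (ratPhiTwist_loc hσ hC)

lemma ratCoord_smul (hσ : ∀ h, σr (loc k J h) = σ h) (hC : ∀ x y, σC x y = σr x y) (h : HH k)
    (z : RatInd (ratPhiTwist σC)) :
    ratCoord hσ hC (h • z) = indRep (phiTwist σ) h (ratCoord hσ hC z) :=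
  ratEquiv_smul _ _ _ h z

lemma ratCoord_tauMap (hσ : ∀ h, σr (loc k J h) = σ h) (hC : ∀ x y, σC x y = σr x y) (y : E) :
    ratCoord hσ hC (tauMap σC l y) = tauCoord σr σ l y := by
  classical
  have h1 : denomAct σr l y = ratPhiTwist σC
      (HeckeAlg.f (invProd (theta b J) (wordProd b l))) y := (hC _ y).symm
  rw [tauCoord_apply, h1]
  exact ratEquiv_tmul (ratPhiTwist σC) (phiTwist σ) (ratPhiTwist_loc hσ hC) _ _ _

lemma tauMap_injective (hσ : ∀ h, σr (loc k J h) = σ h) (hC : ∀ x y, σC x y = σr x y)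
    (hl : IsReducedWord b l (wTop b (theta b J))) : Function.Injective (tauMap σC l) := by
  intro y y' h
  have h1 := congrFun (congrArg (ratCoord hσ hC) h) (topRep J)
  rwa [ratCoord_tauMap, ratCoord_tauMap, tauCoord_top hσ hl, tauCoord_top hσ hl] at h1

lemma tauMap_loc (hσ : ∀ h, σr (loc k J h) = σ h) (hC : ∀ x y, σC x y = σr x y)
    (hl : IsReducedWord b l (wTop b (theta b J))) {v : Cx V₀} {Q : A[X]}
    (hQ : ∀ x : minReps b J, x ≠ oneRep J →
      aeval (σ (vec k J (cxMap (x : V₀ ≃ₗ[ℝ] V₀)⁻¹ v))) Q = 0)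
    (hu : ∀ α ∈ J, IsUnit (aeval (σ (vec k J (cxMap (P.reflection α) v))) Q))
    (h : HJ k J) (y : E) :
    tauMap σC l (σC (loc k J h) y) = incl k J h • tauMap σC l y := by
  refine (ratCoord hσ hC).injective ?_
  have h1 : σC (loc k J h) y = σ h y := (hC _ y).trans (congrArg (fun f => f y) (hσ h))
  calc ratCoord hσ hC (tauMap σC l (σC (loc k J h) y))
      = tauCoord σr σ l (σC (loc k J h) y) := ratCoord_tauMap hσ hC _
    _ = tauCoord σr σ l (σ h y) := congrArg _ h1
    _ = indRep (phiTwist σ) (incl k J h) (tauCoord σr σ l y) :=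
        (indRep_incl_tauCoord hσ hl hQ hu h y).symm
    _ = indRep (phiTwist σ) (incl k J h) (ratCoord hσ hC (tauMap σC l y)) :=
        congrArg _ (ratCoord_tauMap hσ hC y).symm
    _ = ratCoord hσ hC (incl k J h • tauMap σC l y) := (ratCoord_smul hσ hC _ _).symm

lemma exists_ratInd_equiv [Module.Finite A E] (hσ : ∀ h, σr (loc k J h) = σ h)
    (hC : ∀ x y, σC x y = σr x y) (hl : IsReducedWord b l (wTop b (theta b J)))
    (hequiv : ∀ h y, tauMap σC l (σC (loc k J h) y) = incl k J h • tauMap σC l y) :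
    ∃ Δa : RatInd σC ≃ₗ[HH k] RatInd (ratPhiTwist σC),
      ∀ y, Δa (RatInd.tmul σC (RatUp.tmul k J 1 1) y) = tauMap σC l y := by
  have hg : ∀ (a : HJ k J) y, tauMap σC l ((σC.comp (loc k J)) a y) =
      incl k J a • tauMap σC l y := hequiv
  have hbij := lift_bijective hσ hl (ratCoord hσ hC) (ratCoord_smul hσ hC) (tauMap σC l)
    (ratCoord_tauMap hσ hC) hg
  refine ⟨ratIndEquiv σC ≪≫ₗ LinearEquiv.ofBijective _ hbij, fun y => ?_⟩
  have h1 : ratIndEquiv σC (RatInd.tmul σC (RatUp.tmul k J 1 1) y) =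
      Ind.tmul (σC.comp (loc k J)) 1 y := by
    rw [ratIndEquiv_tmul, map_one σC, Module.End.one_apply]
  have h2 := Ind.lift_tmul (σC.comp (loc k J)) (tauMap σC l) hg 1 y
  rw [one_smul] at h2
  exact (congrArg (Ind.lift (σC.comp (loc k J)) (tauMap σC l) hg) h1).trans h2

lemma ratEquiv_sum {ρa : RatHJ k J →ₐ[ℂ] Module.End ℂ E} (hσ : ∀ h u, ρa (loc k J h) u = σ h u)
    (F : minReps b J → E) : ratEquiv ρa σ hσ
      (∑ w, RatInd.tmul ρa (RatUp.tmul k J (tRep w) 1) (F w)) = F := by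
  classical
  rw [map_sum]
  conv_rhs => rw [eq_sum_single F]
  refine Finset.sum_congr rfl fun w _ => ?_
  rw [ratEquiv_tmul, map_one, Module.End.one_apply]
  exact (single_eq_indRep σ w _).symm

end RationalInduction

/-! ### Holomorphic elements in coordinates -/

section HolomorphicCoordinates

set_option linter.unusedSectionVars false

variable {ι V₀ N : Type*} [Fintype ι] [AddCommGroup V₀] [Module ℝ V₀] [AddCommGroup N] [Module ℝ N]
  {P : RootPairing ι ℝ V₀ N} {b : SimpleRoots P} {k : Param b} {J : Set b.support}
  {U : Type*} [AddCommGroup U] [Module ℂ U] [P.IsReduced] {m : Type*}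

lemma mapScalars_holToRat_injective : Function.Injective (mapScalars U (holToRat m)) :=
  Module.Flat.rTensor_preserves_injective_linearMap (M := U) (holToRat m).toLinearMap
    holToRat_injective

variable {ρa : RatHJ k J →ₐ[ℂ] Module.End ℂ (RatFun m ⊗[ℂ] U)}
  {σ : HJ k J →ₐ[ℂ] Module.End (RatFun m) (RatFun m ⊗[ℂ] U)}
  {ρ : HJ k J →ₐ[ℂ] Module.End ℂ U}

lemma ratEquiv_holSum (hσ : ∀ h u, ρa (loc k J h) u = σ h u)
    (y : minReps b J →₀ Hol m ⊗[ℂ] U) :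
    ratEquiv ρa σ hσ (holSum ρa y) = mapScalars U (holToRat m) ∘ y := by
  refine Eq.trans (congrArg _ ?_) (ratEquiv_sum hσ (mapScalars U (holToRat m) ∘ y))
  rw [holSum, Finsupp.sum_fintype _ _ fun w => ?_]
  · rfl
  · rw [map_zero (TensorProduct.map (holToRat m).toLinearMap (LinearMap.id (R := ℂ) (M := U)))]
    exact map_zero (ptmulHom (rightRat k J) (fun a => ρa a) _)

lemma indEquiv_zeroSum (y : minReps b J →₀ Hol m ⊗[ℂ] U) :
    indEquiv ρ ρ (fun _ _ => rfl) (zeroSum ρ y) = specialize U (evalZero m) ∘ y := by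
  classical
  rw [zeroSum, Finsupp.sum_fintype _ _ fun w => ?_, map_sum]
  · rw [eq_sum_single (specialize U (evalZero m) ∘ y)]
    refine Finset.sum_congr rfl fun w _ => ?_
    rw [indEquiv_tmul]
    exact (single_eq_indRep ρ w _).symm
  · rw [map_zero, map_zero]
    exact map_zero (ptmulHom (rightH k J) (fun a => ρ a) _)

lemma isHolomorphic_of_coord (hσ : ∀ h u, ρa (loc k J h) u = σ h u) {x : RatInd ρa}
    {F : minReps b J → Hol m ⊗[ℂ] U} (h : ratEquiv ρa σ hσ x = mapScalars U (holToRat m) ∘ F) :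
    IsHolomorphic ρa x := by
  refine ⟨Finsupp.equivFunOnFinite.symm F, (ratEquiv ρa σ hσ).injective ?_⟩
  rw [ratEquiv_holSum, h]
  rfl

/-- The coordinates of the specialization; in particular, it does not depend on the choice of the
expression of a holomorphic element. -/
lemma indEquiv_atZero (hσ : ∀ h u, ρa (loc k J h) u = σ h u) {x : RatInd ρa}
    {F : minReps b J → Hol m ⊗[ℂ] U} (h : ratEquiv ρa σ hσ x = mapScalars U (holToRat m) ∘ F) :
    indEquiv ρ ρ (fun _ _ => rfl) (atZero ρ ρa x) = specialize U (evalZero m) ∘ F := by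
  have hx := isHolomorphic_of_coord hσ h
  have h1 := congrArg (ratEquiv ρa σ hσ) hx.choose_spec
  rw [ratEquiv_holSum, h] at h1
  have h2 : F = hx.choose := funext fun y => mapScalars_holToRat_injective (congrFun h1 y)
  rw [atZero, dif_pos hx, indEquiv_zeroSum, ← h2]

end HolomorphicCoordinates

/-! ### Specialization of a lattice -/

section Specialization

set_option linter.unusedSectionVars false

open Polynomial

variable {ι V₀ N : Type*} [Fintype ι] [AddCommGroup V₀] [Module ℝ V₀] [AddCommGroup N] [Module ℝ N]
  {P : RootPairing ι ℝ V₀ N} {b : SimpleRoots P} {k : Param b} {J : Set b.support}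
  {U : Type*} [AddCommGroup U] [Module ℂ U] [P.IsReduced] {ρ : HJ k J →ₐ[ℂ] Module.End ℂ U}
  {A : Type*} [CommRing A] [Algebra ℂ A] {η : Cx V₀ →ₗ[ℂ] A}
  {hη : ∀ α ∈ J, ∀ v, η (cxMap (P.reflection α) v) = η v}

lemma exists_specialize {κ : Type*} (T : A ⊗[ℂ] U →ₗ[A] (κ → A ⊗[ℂ] U)) (φ : A →ₐ[ℂ] ℂ) :
    ∃ T₀ : U →ₗ[ℂ] (κ → U), (∀ u, T₀ u = specialize U φ ∘ T (1 ⊗ₜ u)) ∧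
      ∀ z, T₀ (specialize U φ z) = specialize U φ ∘ T z := by
  let T₀ : U →ₗ[ℂ] (κ → U) := (specialize U φ).compLeft κ ∘ₗ T.restrictScalars ℂ ∘ₗ
    TensorProduct.mk ℂ A U 1
  have hT₀ : ∀ u, T₀ u = specialize U φ ∘ T (1 ⊗ₜ u) := fun _ => rfl
  refine ⟨T₀, hT₀, fun z => ?_⟩
  induction z using TensorProduct.induction_on with
  | zero =>
    rw [map_zero, map_zero, map_zero]
    ext y
    exact (map_zero (specialize U φ)).symm
  | tmul a u =>
    have h2 : (a ⊗ₜ u : A ⊗[ℂ] U) = a • 1 ⊗ₜ u := by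
      rw [smul_tmul', smul_eq_mul, mul_one]
    rw [specialize_tmul, map_smul, hT₀, h2, map_smul]
    ext y
    exact (specialize_smul _ _ _).symm
  | add x y hx hy =>
    rw [map_add, map_add, map_add, hx, hy]
    ext i
    exact (map_add (specialize U φ) _ _).symm

/-- The specialization at a point where `η` vanishes of an intertwining map defined over `A`. -/
lemma exists_intertwining_specialize (φ : A →ₐ[ℂ] ℂ) (hφ : ∀ v, φ (η v) = 0)
    {T : A ⊗[ℂ] U →ₗ[A] (minReps b (theta b J) → A ⊗[ℂ] U)} (htop : ∀ z, T z (topRep J) = z)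
    (hequiv : ∀ h z, T (defRep ρ η hη h z) =
      indRep (phiTwist (defRep ρ η hη)) (incl k J h) (T z)) :
    ∃ T₀ : U →ₗ[ℂ] Ind (phiRep ρ),
      (∀ u, indEquiv (phiRep ρ) (phiRep ρ) (fun _ _ => rfl) (T₀ u) =
        specialize U φ ∘ T (1 ⊗ₜ u)) ∧ Function.Injective T₀ ∧
      ∀ h u, T₀ (ρ h u) = incl k J h • T₀ u := by
  obtain ⟨T₀, hT₀, hspec⟩ := exists_specialize T φ
  let κ := indEquiv (phiRep ρ) (phiRep ρ) fun _ _ => rfl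
  have hκ : ∀ u, κ (κ.symm (T₀ u)) = T₀ u := fun u => κ.apply_symm_apply _
  refine ⟨κ.symm.toLinearMap ∘ₗ T₀, fun u => (hκ u).trans (hT₀ u), ?_, fun h u => ?_⟩
  · refine κ.symm.injective.comp fun u u' h => ?_
    have h2 : ∀ u, T₀ u (topRep J) = u := fun u => by
      rw [hT₀, Function.comp_apply, htop, specialize_tmul, map_one, one_smul]
    rw [← h2 u, h, h2]
  · refine κ.injective ?_
    have h3 : specialize U φ (defRep ρ η hη h (1 ⊗ₜ u)) = ρ h u := by
      rw [specialize_defRep ρ _ _ _ hφ, specialize_tmul, map_one, one_smul]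
    have h4 := map_indRep (phiTwist (defRep ρ η hη)) (phiRep ρ)
      (specialize U φ).toAddMonoidHom
      (fun h z => specialize_defRep ρ _ _ _ hφ _ z) (incl k J h) (T (1 ⊗ₜ u))
    refine (hκ _).trans (Eq.trans ?_ (indEquiv_smul _ _ _ _ _).symm)
    refine Eq.trans ?_ (congrArg (indRep (phiRep ρ) (incl k J h)) (hκ u).symm)
    rw [← h3, hspec, hequiv, hT₀]
    exact h4

variable {A' : Type*} [CommRing A'] [Algebra ℂ A'] {η' : Cx V₀ →ₗ[ℂ] A'}
  {hη' : ∀ α ∈ J, ∀ v, η' (cxMap (P.reflection α) v) = η' v} [Module.Finite ℂ U]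

lemma exists_integral_tauCoord_defRep {σr : RatHJ k J →ₐ[ℂ] Module.End A' (A' ⊗[ℂ] U)}
    {l : List b.support} (hσ : ∀ h, σr (loc k J h) = defRep ρ η' hη' h)
    (hl : IsReducedWord b l (wTop b (theta b J))) {v : Cx V₀} (φ : A →ₐ[ℂ] A')
    (hφ : ∀ v, φ (η v) = η' v) (hinj : Function.Injective (mapScalars U φ))
    (hQ : ∀ x : minReps b J, x ≠ oneRep J →
      aeval (defRep ρ η' hη' (vec k J (cxMap (x : V₀ ≃ₗ[ℝ] V₀)⁻¹ v))) (annPoly ρ η' v) = 0)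
    (hu : IsUnit (aeval (defRep ρ η hη (vec k J v)) (annPoly ρ η v)))
    (hu' : ∀ α ∈ J, IsUnit (aeval (defRep ρ η' hη' (vec k J (cxMap (P.reflection α) v)))
      (annPoly ρ η' v))) :
    ∃ T : A ⊗[ℂ] U →ₗ[A] (minReps b (theta b J) → A ⊗[ℂ] U),
      (∀ z, mapScalars U φ ∘ T z = tauCoord σr (defRep ρ η' hη') l (mapScalars U φ z)) ∧
      (∀ z, T z (topRep J) = z) ∧
      ∀ h z, T (defRep ρ η hη h z) =
        indRep (phiTwist (defRep ρ η hη)) (incl k J h) (T z) := by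
  rw [← annPoly_map ρ η φ η' hφ v] at hQ hu'
  exact exists_integral_tauCoord hσ hl (φ : A →+* A') hQ hu hu' (mapScalars U φ).toAddMonoidHom
    hinj (fun a z => mapScalars_smul _ a z) (mapScalars_defRep ρ _ _ φ _ _ hφ)

end Specialization


/-! ### The intertwining map of a tempered module -/

section TemperedIntertwining

set_option linter.unusedSectionVars false

variable {ι V₀ N : Type*} [Fintype ι] [AddCommGroup V₀] [Module ℝ V₀] [AddCommGroup N] [Module ℝ N]
  {P : RootPairing ι ℝ V₀ N} {b : SimpleRoots P} {k : Param b} {J : Set b.support}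
  {U : Type*} [AddCommGroup U] [Module ℂ U] [Module.Finite ℂ U] [P.IsReduced]
  {m : Type*} [Fintype m] (ω : Module.Basis m ℂ (VJPerp J)) {ρ : HJ k J →ₐ[ℂ] Module.End ℂ U}
  {l : List b.support} {v : Cx V₀}

lemma deform_loc_apply (h : HJ k J) : deform ω ρ (loc k J h) = ratRep ω ρ h := deform_loc ρ ω h

lemma deformC_apply (x : RatHJ k J) (y : RatFun m ⊗[ℂ] U) : deformC ω ρ x y = deform ω ρ x y := rfl

lemma isUnit_ratRep_reflection (hv : IsGeneric ρ v) (α : b.support) (hα : α ∈ J) :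
    IsUnit (Polynomial.aeval (ratRep ω ρ (vec k J (cxMap (P.reflection α) v)))
      (annPoly ρ (eta ω) v)) := isUnit_ratRep ω hv (eta_reflection ω hα v)

/-- The map `y ↦ τ ⊗ φ(y)` is `ℍ_J`-linear. -/
lemma tauMap_deformC (hv : IsGeneric ρ v) (hl : IsReducedWord b l (wTop b (theta b J)))
    (h : HJ k J) (y : RatFun m ⊗[ℂ] U) : tauMap (deformC ω ρ) l (deformC ω ρ (loc k J h) y) =
      incl k J h • tauMap (deformC ω ρ) l y :=
  tauMap_loc (deform_loc_apply ω) (deformC_apply ω) hl (fun _ hx => aeval_ratRep_eq_zero ω hx)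
    (isUnit_ratRep_reflection ω hv) h y

lemma exists_integral_tau (hv : IsGeneric ρ v) (hl : IsReducedWord b l (wTop b (theta b J))) :
    ∃ T : Hol m ⊗[ℂ] U →ₗ[Hol m] (minReps b (theta b J) → Hol m ⊗[ℂ] U),
      (∀ z, mapScalars U (holToRat m) ∘ T z =
        tauCoord (deform ω ρ) (ratRep ω ρ) l (mapScalars U (holToRat m) z)) ∧
      (∀ z, T z (topRep J) = z) ∧
      ∀ h z, T (holRep ω ρ h z) = indRep (phiTwist (holRep ω ρ)) (incl k J h) (T z) :=
  exists_integral_tauCoord_defRep (deform_loc_apply ω) hl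
    (holToRat m) (holToRat_etaHol ω) mapScalars_holToRat_injective
    (fun _ hx => aeval_ratRep_eq_zero ω hx) (isUnit_holRep ω hv) (isUnit_ratRep_reflection ω hv)

lemma ratEquiv_tauTmul (y : RatFun m ⊗[ℂ] U) :
    ratEquiv (phiDeform ω ρ) (phiTwist (ratRep ω ρ))
      (ratPhiTwist_loc (deform_loc_apply ω) (deformC_apply ω)) (tauTmul ω ρ l y) =
      tauCoord (deform ω ρ) (ratRep ω ρ) l y :=
  ratCoord_tauMap (deform_loc_apply ω) (deformC_apply ω) y

lemma mapScalars_one_tmul (u : U) : mapScalars U (holToRat m) (1 ⊗ₜ u) = 1 ⊗ₜ u :=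
  (TensorProduct.map_tmul _ _ _ _).trans (congrArg (· ⊗ₜ u) (map_one (holToRat m)))

/-- The elements `τ ⊗ φ(u)` are holomorphic, and their specializations at `a = 0` define an
injective `ℍ_J`-linear map. -/
lemma exists_tauZero (hv : IsGeneric ρ v) (hl : IsReducedWord b l (wTop b (theta b J))) :
    (∀ u : U, IsHolomorphic (phiDeform ω ρ) (tauTmul ω ρ l (1 ⊗ₜ[ℂ] u))) ∧
    ∃ T₀ : U →ₗ[ℂ] Ind (phiRep ρ), (∀ u, T₀ u = tauZero ω ρ l u) ∧ Function.Injective T₀ ∧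
      ∀ h u, T₀ (ρ h u) = incl k J h • T₀ u := by
  obtain ⟨T, hT, htop, hTequiv⟩ := exists_integral_tau ω hv hl
  have hcoord : ∀ u, ratEquiv (phiDeform ω ρ) (phiTwist (ratRep ω ρ))
      (ratPhiTwist_loc (deform_loc_apply ω) (deformC_apply ω)) (tauTmul ω ρ l (1 ⊗ₜ[ℂ] u)) =
        mapScalars U (holToRat m) ∘ T (1 ⊗ₜ u) := fun u =>
    (ratEquiv_tauTmul ω _).trans
      ((congrArg (tauCoord (deform ω ρ) (ratRep ω ρ) l) (mapScalars_one_tmul u).symm).trans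
        (hT _).symm)
  obtain ⟨T₀, hT₀, hT₀inj, hT₀equiv⟩ :=
    exists_intertwining_specialize (evalZero m) (evalZero_etaHol ω) htop hTequiv
  exact ⟨fun u => isHolomorphic_of_coord _ (hcoord u), T₀, fun u =>
    (indEquiv (phiRep ρ) (phiRep ρ) fun _ _ => rfl).injective
      ((hT₀ u).trans (indEquiv_atZero _ (hcoord u)).symm), hT₀inj, hT₀equiv⟩

lemma exists_tau_submodule (hv : IsGeneric ρ v) (hl : IsReducedWord b l (wTop b (theta b J))) :
    ∃ S : Submodule ℂ (RatInd (phiDeform ω ρ)),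
      (∀ x, x ∈ S ↔ ∃ y, x = tauTmul ω ρ l y) ∧
      (∀ h : HJ k J, ∀ x ∈ S, incl k J h • x ∈ S) ∧
      ∃ e : (RatFun m ⊗[ℂ] U) ≃ₗ[ℂ] S,
        (∀ y, (e y : RatInd (phiDeform ω ρ)) = tauTmul ω ρ l y) ∧
        ∀ (h : HJ k J) y, (e (deformC ω ρ (loc k J h) y) : RatInd (phiDeform ω ρ)) =
          incl k J h • (e y : RatInd (phiDeform ω ρ)) := by
  refine ⟨LinearMap.range (tauMap (deformC ω ρ) l), fun x => ?_, ?_,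
      LinearEquiv.ofInjective _ (tauMap_injective (deform_loc_apply ω) (deformC_apply ω) hl),
      fun _ => rfl, tauMap_deformC ω hv hl⟩
  · exact ⟨fun ⟨y, hy⟩ => ⟨y, hy.symm⟩, fun ⟨y, hy⟩ => ⟨y, hy.symm⟩⟩
  · rintro h _ ⟨y, rfl⟩
    exact ⟨_, tauMap_deformC ω hv hl h y⟩

lemma exists_tau_equiv (hv : IsGeneric ρ v) (hl : IsReducedWord b l (wTop b (theta b J))) :
    ∃ Δa : RatInd (deformC ω ρ) ≃ₗ[HH k] RatInd (phiDeform ω ρ),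
      ∀ y, Δa (RatInd.tmul (deformC ω ρ) (RatUp.tmul k J 1 1) y) = tauTmul ω ρ l y :=
  exists_ratInd_equiv (deform_loc_apply ω) (deformC_apply ω) hl (tauMap_deformC ω hv hl)

lemma exists_tauZero_submodule (hv : IsGeneric ρ v)
    (hl : IsReducedWord b l (wTop b (theta b J))) :
    ∃ S : Submodule ℂ (Ind (phiRep ρ)),
      (∀ x, x ∈ S ↔ ∃ u, x = tauZero ω ρ l u) ∧
      (∀ h : HJ k J, ∀ x ∈ S, incl k J h • x ∈ S) ∧
      ∃ e : U ≃ₗ[ℂ] S,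
        (∀ u, (e u : Ind (phiRep ρ)) = tauZero ω ρ l u) ∧
        ∀ (h : HJ k J) u, (e (ρ h u) : Ind (phiRep ρ)) = incl k J h • (e u : Ind (phiRep ρ)) := by
  obtain ⟨-, T₀, hzero, hT₀inj, hT₀equiv⟩ := exists_tauZero ω hv hl
  refine ⟨LinearMap.range T₀, fun x => ?_, ?_, LinearEquiv.ofInjective _ hT₀inj, hzero, hT₀equiv⟩
  · exact ⟨fun ⟨u, hu⟩ => ⟨u, hu.symm.trans (hzero u)⟩, fun ⟨u, hu⟩ => ⟨u, (hzero u).trans hu.symm⟩⟩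
  · rintro h _ ⟨u, rfl⟩
    exact ⟨_, hT₀equiv h u⟩

/-- The kernel of the induced map is the largest proper submodule if `U` is irreducible, because
the map kills every proper submodule and is nonzero. -/
lemma exists_ind_hom [Nontrivial U] (hv : IsGeneric ρ v)
    (hl : IsReducedWord b l (wTop b (theta b J))) :
    ∃ Δ : Ind ρ →ₗ[HH k] Ind (phiRep ρ),
      (∀ u, Δ (Ind.tmul ρ 1 u) = tauZero ω ρ l u) ∧
      (IsIrred ρ → ∃ M : Submodule (HH k) (Ind ρ), M ≠ ⊤ ∧ (∀ M', M' ≠ ⊤ → M' ≤ M) ∧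
        Nonempty (LinearMap.range Δ ≃ₗ[HH k] (Ind ρ ⧸ M))) := by
  obtain ⟨-, T₀, hzero, hT₀inj, hT₀equiv⟩ := exists_tauZero ω hv hl
  have hΔ : ∀ u, Ind.lift ρ T₀ hT₀equiv (Ind.tmul ρ 1 u) = T₀ u := fun u => by
    rw [Ind.lift_tmul, one_smul]
  refine ⟨Ind.lift ρ T₀ hT₀equiv, fun u => (hΔ u).trans (hzero u), fun hirr =>
    ⟨LinearMap.ker (Ind.lift ρ T₀ hT₀equiv), fun h => ?_, fun M' hM' =>
      le_ker_of_ne_top hirr (fun _ hx => aeval_rep_eq_zero hx) (isUnit_rep hv) _ hM',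
      ⟨(LinearMap.quotKerEquivRange _).symm⟩⟩⟩
  obtain ⟨u, hu0⟩ := exists_ne (0 : U)
  have h1 : Ind.tmul ρ 1 u ∈ LinearMap.ker (Ind.lift ρ T₀ hT₀equiv) := h ▸ Submodule.mem_top
  exact hu0 (hT₀inj ((hΔ u).symm.trans ((LinearMap.mem_ker.1 h1).trans (map_zero T₀).symm)))

end TemperedIntertwining

end GradedHecke

end

open GradedHecke
theorem proposition4p9 {ι V₀ N U m : Type*} [Finite ι] [AddCommGroup V₀] [Module ℝ V₀]
    [AddCommGroup N] [Module ℝ N] (P : RootPairing ι ℝ V₀ N) [P.IsReduced] (b : SimpleRoots P)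
    (k : Param b) (J : Set b.support)
    [AddCommGroup U] [Module ℂ U] [Module.Finite ℂ U]
    (ρ : HJ k J →ₐ[ℂ] Module.End ℂ U) (hindec : IsIndec ρ) (htemp : IsTempered ρ)
    [Fintype m] (ω : Module.Basis m ℂ (VJPerp J))
    (l : List b.support) (hl : IsReducedWord b l (wTop b (theta b J))) :
    -- (1) holomorphy
    (∀ u : U, IsHolomorphic (phiDeform ω ρ) (tauTmul ω ρ l (1 ⊗ₜ[ℂ] u))) ∧
    -- (2) the subspace `{τ ⊗ φ(y)}` is an `ℍ_J`-submodule isomorphic to `U_a`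
    (∃ S : Submodule ℂ (RatInd (phiDeform ω ρ)),
      (∀ x, x ∈ S ↔ ∃ y, x = tauTmul ω ρ l y) ∧
      (∀ h : HJ k J, ∀ x ∈ S, incl k J h • x ∈ S) ∧
      ∃ e : (RatFun m ⊗[ℂ] U) ≃ₗ[ℂ] S,
        (∀ y, (e y : RatInd (phiDeform ω ρ)) = tauTmul ω ρ l y) ∧
        ∀ (h : HJ k J) y, (e (deformC ω ρ (loc k J h) y) : RatInd (phiDeform ω ρ)) =
          incl k J h • (e y : RatInd (phiDeform ω ρ))) ∧
    -- (3) the induced `ℍ`-isomorphism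
    (∃ Δa : RatInd (deformC ω ρ) ≃ₗ[HH k] RatInd (phiDeform ω ρ),
      ∀ y, Δa (RatInd.tmul (deformC ω ρ) (RatUp.tmul k J 1 1) y) = tauTmul ω ρ l y) ∧
    -- (4) the specialized subspace is an `ℍ_J`-submodule isomorphic to `U`
    (∃ S : Submodule ℂ (Ind (phiRep ρ)),
      (∀ x, x ∈ S ↔ ∃ u, x = tauZero ω ρ l u) ∧
      (∀ h : HJ k J, ∀ x ∈ S, incl k J h • x ∈ S) ∧
      ∃ e : U ≃ₗ[ℂ] S,
        (∀ u, (e u : Ind (phiRep ρ)) = tauZero ω ρ l u) ∧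
        ∀ (h : HJ k J) u, (e (ρ h u) : Ind (phiRep ρ)) = incl k J h • (e u : Ind (phiRep ρ))) ∧
    -- (5) the induced `ℍ`-map, and its image for irreducible `U`
    (∃ Δ : Ind ρ →ₗ[HH k] Ind (phiRep ρ),
      (∀ u, Δ (Ind.tmul ρ 1 u) = tauZero ω ρ l u) ∧
      (IsIrred ρ → ∃ M : Submodule (HH k) (Ind ρ), M ≠ ⊤ ∧ (∀ M', M' ≠ ⊤ → M' ≤ M) ∧
        Nonempty (LinearMap.range Δ ≃ₗ[HH k] (Ind ρ ⧸ M)))) := by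
  have := Fintype.ofFinite ι
  have := hindec.1
  have hgen : ∃ v, IsGeneric ρ v := exists_generic htemp hindec
  have hv := hgen.choose_spec
  exact ⟨(exists_tauZero ω hv hl).1, exists_tau_submodule ω hv hl, exists_tau_equiv ω hv hl,
    exists_tauZero_submodule ω hv hl, exists_ind_hom ω hv hl⟩
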